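/- **Code.** Let $k_1,k_2\ge 2$ be even, $n_i=k_i+2$. The data qubits of $I_{k_2}\circ I_{k_1}$ form a grid $(x,y)\in[n_1]\times[n_2]$ ($x$ column, $y$ row). For each Pauli type $P\in\{X,Z\}$ the stabilizers of type $P$ are generated by the products of $P$ over a row ("low-level") and over a pair of columns ("high-level"). Errors of each type are taken up to stabilizers of that type. **QEC cycle.** First the $X$ stabilizers are extracted, then the $Z$ stabilizers by the Hadamard-conjugate circuit (exchange $X\leftrightarrow Z$ and reverse every CX). Extraction of the $X$ stabilizers: (i) an $I_{k_1}$ ancilla block $a_0,\dots,a_{n_1-1}$ is prepared in $|\bar +\rangle^{\otimes k_1}$ by a two-branch tree: $a_0$ in $|0\rangle$, the others in $|+\rangle$, and for $i=1,\dots,n_1-1$ a CX from $a_i$ to $a_{\max(i-2,0)}$; the operator $X_{a_{n_1-2}}X_{a_{n_1-1}}$ is measured with one more qubit, and the attempt is discarded if the outcome is nontrivial. (ii) $n_1$ flag qubits $f_x$ are prepared in $|0\rangle$; transversal CX from $a_x$ to $f_x$; for each row $y$ transversal CX onto row $y$ from the ancilla block ($y$ even) or from the flags ($y$ odd); again transversal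 CX from $a_x$ to $f_x$; the $a_x$ are measured in the $X$ basis (register HighX) and the $f_x$ in the $Z$ basis (column hook flags of type $X$). (iii) For each row $y$: an ancilla in $|+\rangle$, a flag in $|0\rangle$, CX from ancilla to flag, CX onto $(x,y)$ from the ancilla ($x$ even) or the flag ($x$ odd) for all $x$, CX from ancilla to flag; the ancilla is measured in the $X$ basis (register LowX), the flag in the $Z$ basis (row hook flag of type $X$). **Faults.** A fault at a location is an arbitrary Pauli error on the qubits of one preparation or CX gate after it, or of one measurement before it. **Decoder.** $Z$ errors are decoded after the extraction of the $X$ stabilizers, $X$ errors after that of the $Z$ stabilizers, independently and by the same rule. The decoder for errors of type $P$ uses the sets $h_x$ of columns and $h_y$ of rows whose type-$P$ hook flags were raised since the previous extraction that detects type $P$, a number PrevFailures and a bit InputErrorAllowed passed from the previous cycle (initially $0$ and true), the set $x_s$ of columns with nontrivial high-level outcome (defined up to complement; the smaller set is taken), and the set $y_s$ of rows with nontrivial low-level outcome. It acts as follows, in this order; unless stated otherwise it passes on PrevFailures $=0$, InputErrorAllowed $=$ true. 1. If InputErrorAllowed is false and one of $x_s,y_s,h_x,h_y$ is nonempty: halt.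 2. If $h_x=h_y=\emptyset$ and $|x_s|+|y_s|=1$: halt if PrevFailures $>0$; else apply no correction and pass on PrevFailures $=1$ and InputErrorAllowed $=(x_s=\emptyset)$. 3. If $h_x=h_y=\emptyset$ otherwise: no correction if $x_s=y_s=\emptyset$; correct $(x,y)$ if $x_s=\{x\}$, $y_s=\{y\}$; correct all of column $0$ if $x_s=\emptyset$ and $y_s=[n_2]$; else halt. 4. If $h_x=\{x\}$, $h_y=\emptyset$: if $x_s=\emptyset$ and $|y_s|$ is even, or $x_s=\{x\}$ and $|y_s|$ is odd, correct column $x$ in the rows $y_s$; else halt. 5. If $h_x=\emptyset$, $h_y=\{y\}$: if $y_s=\emptyset$ and $|x_s|$ is even, or $y_s=\{y\}$ and $|x_s|$ is odd, correct row $y$ in the columns $x_s$; else halt. 6. Otherwise halt. **Generalized weight.** An error of one type, together with the pending hook-flag sets $(h_x,h_y)$ of that type, has generalized weight $0$ if it is trivial and $h_x=h_y=\emptyset$. It has generalized weight $\le 1$ if it has generalized weight $0$, or is (up to stabilizers) a single-qubit error or a whole column with $h_x=h_y=\emptyset$, or a string in column $x$ with $h_x=\{x\},h_y=\emptyset$,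 or a string in row $y$ with $h_x=\emptyset,h_y=\{y\}$. It has generalized weight $\le 2$ if it is a product of two errors of generalized weight $\le1$ (taking the unions of the flag sets), or a string in one column or one row with $h_x=h_y=\emptyset$. For a general Pauli error both bounds are imposed on its $X$ part and on its $Z$ part; generalized weight $2$ means $\le 2$ and not $\le 1$. "Error-free" means trivial error, no pending flags, PrevFailures $=0$ and InputErrorAllowed true for both types. **Proposition.** In all runs in which no ancilla preparation is discarded: 1. Without internal faults, an input of generalized weight $\le 1$ (such that, for each type, InputErrorAllowed is true or the input has generalized weight $0$) yields an error-free output, and an input of generalized weight $2$ makes the cycle halt. 2. With at most one internal fault, an error-free input does not halt and yields an output of generalized weight $\le1$ (with, for each type, InputErrorAllowed true or generalized weight $0$). With at most one internal fault, an input of generalized weight $\le 1$ yields an output of generalized weight $\le 1$, or the cycle halts, or it passes on flags with which the next cycle halts, if that has at most one fault. 3. With at most two internal faults, an error-free input yields an output of generalized weight $\le2$, or the cycle halts. -/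

import Mathlib

/-! ## Pauli frames and faulty stabilizer circuits -/

namespace Iceberg

/-- The two Pauli types. `X` also stands for the `X` measurement basis / the state `|+⟩`, and
`Z` for the `Z` measurement basis / the state `|0⟩`. -/
inductive Basis
  | X
  | Z
deriving DecidableEq

instance : Fintype Basis := ⟨{.X, .Z}, fun b => by cases b <;> decide⟩

/-- Exchange of `X` and `Z` (conjugation by the Hadamard gate). -/
def Basis.dual : Basis → Basis
  | .X => .Z
  | .Z => .X

/-- Instructions of a CSS circuit: preparation of a qubit in the `+1` eigenstate of the Pauli
operator `b` (so `|+⟩` for `b = X`, `|0⟩` for `b = Z`), the CX gate with control `c` and target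
`t`, and the measurement of a qubit in the basis `b`. -/
inductive Instr (Q : Type)
  | prep (b : Basis) (q : Q)
  | cx (c t : Q)
  | meas (b : Basis) (q : Q)

/-- What happens at one circuit location. `fst` and `snd` are the Pauli errors (up to phase; the
coordinate `b` is `1` iff a factor of type `b` is present) on the first and the second qubit of
the instruction (`snd` is used for `cx` only). Errors act after preparations and gates, and before
measurements. The bit `gauge` is not an error: a freshly prepared `+1` eigenstate of the Pauli
operator `b` is not changed by `b`, so the `b`-coordinate of its frame is arbitrary, and letting it
range over both values produces every intrinsically random measurement outcome. -/
structure Event where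
  gauge : ZMod 2
  fst : Basis → ZMod 2
  snd : Basis → ZMod 2

/-- The location is faulty. -/
def Event.isFault (ε : Event) : Bool := decide (ε.fst ≠ 0 ∨ ε.snd ≠ 0)

/-- The Pauli frame of a set `Q` of qubits (`frame b q = 1` iff the deviation from the ideal state
has a factor of type `b` at `q`), with the record of the measurement outcomes, where `1` is the
outcome `-1`. -/
structure RunState (Q : Type) where
  frame : Basis → Q → ZMod 2
  record : Q → ZMod 2

section Circuits

variable {Q : Type} [DecidableEq Q]

/-- Multiplication of a frame by the single-qubit Pauli operator `p` at `q`. -/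
def addPauli (f : Basis → Q → ZMod 2) (q : Q) (p : Basis → ZMod 2) : Basis → Q → ZMod 2 :=
  fun b q' => if q' = q then f b q' + p b else f b q'

/-- One (possibly faulty) location. -/
def step (s : RunState Q) : Instr Q × Event → RunState Q
  | (.prep b q, ε) =>
      { frame := addPauli
          (fun a q' => if q' = q then (if a = b then ε.gauge else 0) else s.frame a q') q ε.fst
        record := s.record }
  | (.cx c t, ε) =>
      { frame := addPauli (addPauli
          (fun a q' => match a with
            | .X => if q' = t then s.frame .X t + s.frame .X c else s.frame .X q'
            | .Z => if q' = c then s.frame .Z c + s.frame .Z t else s.frame .Z q')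
          c ε.fst) t ε.snd
        record := s.record }
  | (.meas b q, ε) =>
      { frame := addPauli s.frame q ε.fst
        record := fun q' =>
          if q' = q then addPauli s.frame q ε.fst b.dual q else s.record q' }

/-- Execution of an annotated circuit. -/
def run (L : List (Instr Q × Event)) (s : RunState Q) : RunState Q := L.foldl step s

/-- The number of faulty locations of an annotated circuit. -/
def faults (L : List (Instr Q × Event)) : ℕ := L.countP (fun p => p.2.isFault)

end Circuits

/-! ## The code

The physical qubits form an `n₁ × n₂` grid; `(x, y)` is the qubit in column `x` and row `y`. -/

/-- Pauli operators of one fixed type on the data qubits. -/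
abbrev Grid (n₁ n₂ : ℕ) := Fin n₁ → Fin n₂ → ZMod 2

section Code

variable {n₁ n₂ : ℕ}

/-- The vertical string with column `x` and rows `S`. -/
def vString (x : Fin n₁) (S : Finset (Fin n₂)) : Grid n₁ n₂ :=
  fun i j => if i = x ∧ j ∈ S then 1 else 0

/-- The horizontal string with row `y` and columns `S`. -/
def hString (S : Finset (Fin n₁)) (y : Fin n₂) : Grid n₁ n₂ :=
  fun i j => if i ∈ S ∧ j = y then 1 else 0

variable (n₁ n₂) in
/-- The stabilizers of either type of the concatenated iceberg code: generated by the rows and the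
pairs of columns. -/
def stabilizers : Submodule (ZMod 2) (Grid n₁ n₂) :=
  Submodule.span (ZMod 2)
    (Set.range (fun y : Fin n₂ => hString (Finset.univ : Finset (Fin n₁)) y) ∪
     Set.range (fun p : Fin n₁ × Fin n₁ =>
       vString p.1 (Finset.univ : Finset (Fin n₂)) + vString p.2 Finset.univ))

/-- Equality up to a stabilizer. -/
def SameError (e e' : Grid n₁ n₂) : Prop := e - e' ∈ stabilizers n₁ n₂

/-- No error, and no column or row flagged. -/
def IsWeightZero (e : Grid n₁ n₂) (C : Finset (Fin n₁)) (R : Finset (Fin n₂)) : Prop :=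
  SameError e 0 ∧ C = ∅ ∧ R = ∅

/-- Errors of one Pauli type of generalized weight at most one. `C` and `R` are the columns and
rows known (from flags) to carry a string: no error, a single-qubit error, a vertical string with
known column, a horizontal string with known row, or an error on a whole column. -/
def IsGenWeightLeOne (e : Grid n₁ n₂) (C : Finset (Fin n₁)) (R : Finset (Fin n₂)) : Prop :=
  IsWeightZero e C R ∨
  (∃ x y, SameError e (vString x {y}) ∧ C = ∅ ∧ R = ∅) ∨
  (∃ x S, SameError e (vString x S) ∧ C = {x} ∧ R = ∅) ∨
  (∃ y S, SameError e (hString S y) ∧ C = ∅ ∧ R = {y}) ∨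
  (∃ x, SameError e (vString x Finset.univ) ∧ C = ∅ ∧ R = ∅)

/-- Errors of one Pauli type of generalized weight at most two: a product of two errors of
generalized weight at most one, or a vertical or horizontal string with no known coordinate. -/
def IsGenWeightLeTwo (e : Grid n₁ n₂) (C : Finset (Fin n₁)) (R : Finset (Fin n₂)) : Prop :=
  (∃ e₁ C₁ R₁ e₂ C₂ R₂, IsGenWeightLeOne e₁ C₁ R₁ ∧ IsGenWeightLeOne e₂ C₂ R₂ ∧
    e = e₁ + e₂ ∧ C = C₁ ∪ C₂ ∧ R = R₁ ∪ R₂) ∨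
  (∃ x S, SameError e (vString x S) ∧ C = ∅ ∧ R = ∅) ∨
  (∃ y S, SameError e (hString S y) ∧ C = ∅ ∧ R = ∅)

end Code

/-! ## The syndrome extraction circuits -/

/-- The qubits: the data grid, the high-level ancilla (an iceberg code block) and its flags, the
qubit that verifies the preparation of the high-level ancilla, and for each row the Bell pair
(ancilla, flag) of the low-level extraction. -/
inductive Qubit (n₁ n₂ : ℕ)
  | data (x : Fin n₁) (y : Fin n₂)
  | anc (x : Fin n₁)
  | flag (x : Fin n₁)
  | check
  | rowAnc (y : Fin n₂)
  | rowFlag (y : Fin n₂)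
deriving DecidableEq

section Extraction

variable {n₁ n₂ : ℕ}

/-- The CX gate with control `c` and target `t` in the extraction of the `X` stabilizers, and its
conjugate by Hadamard gates in the extraction of the `Z` stabilizers. -/
def couple (b : Basis) (c t : Qubit n₁ n₂) : Instr (Qubit n₁ n₂) :=
  match b with
  | .X => .cx c t
  | .Z => .cx t c

/-- The parent in the two-branch tree `0 → 1 → 3 → 5 → ⋯`, `0 → 2 → 4 → ⋯`. -/
def treeParent (x : Fin n₁) : Fin n₁ := ⟨x.val - 2, lt_of_le_of_lt (Nat.sub_le _ _) x.isLt⟩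

variable (n₁ n₂)

/-- Two-branch preparation of the high-level ancilla in the logical `|+⋯+⟩` (for `b = X`) or
`|0⋯0⟩` (for `b = Z`) state, with the verification of the two ends of the branches. -/
def ancillaPreparation (b : Basis) : List (Instr (Qubit n₁ n₂)) :=
  (List.finRange n₁).map (fun x => .prep (if x.val = 0 then b.dual else b) (.anc x)) ++
  ((List.finRange n₁).filter (fun x => x.val ≠ 0)).map
    (fun x => couple b (.anc x) (.anc (treeParent x))) ++
  [.prep b .check] ++
  ((List.finRange n₁).filter (fun x => n₁ ≤ x.val + 2)).map (fun x => couple b .check (.anc x)) ++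
  [.meas b .check]

/-- Extraction of the high-level stabilizers (pairs of columns): the ancilla block is coupled
transversally to its flags, then ancilla and flags are coupled transversally to every other row,
then the ancilla is coupled to the flags again, and both are measured. -/
def highExtraction (b : Basis) : List (Instr (Qubit n₁ n₂)) :=
  (List.finRange n₁).map (fun x => .prep b.dual (.flag x)) ++
  (List.finRange n₁).map (fun x => couple b (.anc x) (.flag x)) ++
  (List.finRange n₂).flatMap (fun y => (List.finRange n₁).map (fun x =>
    couple b (if Even y.val then .anc x else .flag x) (.data x y))) ++
  (List.finRange n₁).map (fun x => couple b (.anc x) (.flag x)) ++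
  (List.finRange n₁).map (fun x => .meas b (.anc x)) ++
  (List.finRange n₁).map (fun x => .meas b.dual (.flag x))

/-- Bell-pair extraction of the low-level stabilizer of the row `y`. -/
def rowExtraction (b : Basis) (y : Fin n₂) : List (Instr (Qubit n₁ n₂)) :=
  [.prep b (.rowAnc y), .prep b.dual (.rowFlag y), couple b (.rowAnc y) (.rowFlag y)] ++
  (List.finRange n₁).map (fun x =>
    couple b (if Even x.val then .rowAnc y else .rowFlag y) (.data x y)) ++
  [couple b (.rowAnc y) (.rowFlag y), .meas b (.rowAnc y), .meas b.dual (.rowFlag y)]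

/-- One half of the QEC cycle: extraction of all stabilizers of type `b`. -/
def extraction (b : Basis) : List (Instr (Qubit n₁ n₂)) :=
  ancillaPreparation n₁ n₂ b ++ highExtraction n₁ n₂ b ++
    (List.finRange n₂).flatMap (rowExtraction n₁ n₂ b)

end Extraction

/-! ## The decoder -/

section Decoder

variable {n₁ n₂ : ℕ}

/-- What the decoder for one type of errors remembers: the columns and rows whose hook flags were
raised since the last extraction of the stabilizers that detect this type of errors, the number of
internal faults seen at that extraction, and whether an input error is now allowed. -/
structure Memory (n₁ n₂ : ℕ) where
  hookCols : Finset (Fin n₁)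
  hookRows : Finset (Fin n₂)
  prevFailures : ℕ
  inputErrorAllowed : Bool

/-- The memory before the first cycle. -/
def Memory.blank : Memory n₁ n₂ := ⟨∅, ∅, 0, true⟩

/-- The columns with an odd number of errors according to the transversal measurement of the
high-level ancilla. Only the relative values of the outcomes are meaningful, so this is the smaller
one of the two compatible sets. -/
def xCoords (high : Fin n₁ → ZMod 2) : Finset (Fin n₁) :=
  let S := Finset.univ.filter (fun x => high x = 1)
  if 2 * S.card ≤ n₁ then S else Sᶜ

/-- The rows with an odd number of errors according to the low-level syndromes. -/
def yCoords (low : Fin n₂ → ZMod 2) : Finset (Fin n₂) :=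
  Finset.univ.filter (fun y => low y = 1)

/-- The operator supported on `S × T`. -/
def rectangle (S : Finset (Fin n₁)) (T : Finset (Fin n₂)) : Grid n₁ n₂ :=
  fun i j => if i ∈ S ∧ j ∈ T then 1 else 0

/-- Decoding of a reliable syndrome without flags: a correction, or `none` (halt). -/
def noiselessDecode (xs : Finset (Fin n₁)) (ys : Finset (Fin n₂)) : Option (Grid n₁ n₂) :=
  if xs = ∅ ∧ ys = ∅ then some 0
  else if xs.card = 1 ∧ ys.card = 1 then some (rectangle xs ys)
  else if xs = ∅ ∧ ys = Finset.univ then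
    some (rectangle (Finset.univ.filter (fun x => x.val = 0)) Finset.univ)
  else none

/-- Circuit-level decoding of one type of errors: the correction and the memory that is passed on,
or `none` (halt). -/
def decode (m : Memory n₁ n₂) (high : Fin n₁ → ZMod 2) (low : Fin n₂ → ZMod 2) :
    Option (Grid n₁ n₂ × Memory n₁ n₂) :=
  let xs := xCoords high
  let ys := yCoords low
  let hx := m.hookCols
  let hy := m.hookRows
  if m.inputErrorAllowed = false ∧ ¬ (xs = ∅ ∧ ys = ∅ ∧ hx = ∅ ∧ hy = ∅) then none
  else if hx = ∅ ∧ hy = ∅ then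
    if xs.card + ys.card = 1 then
      -- only one coordinate was seen: an internal fault occurred, and the error, if any, is passed
      -- on; without a row coordinate, the next cycle must not see any input error
      if 0 < m.prevFailures then none
      else some (0, ⟨∅, ∅, 1, decide (xs = ∅)⟩)
    else (noiselessDecode xs ys).map (fun c => (c, Memory.blank))
  else if hx.card = 1 ∧ hy = ∅ then
    -- vertical hook error; halt if there is another error in addition to it
    if xs = (if Even ys.card then ∅ else hx) then some (rectangle hx ys, Memory.blank) else none
  else if hx = ∅ ∧ hy.card = 1 then
    -- horizontal hook error; halt if there is another error in addition to it
    if ys = (if Even xs.card then ∅ else hy) then some (rectangle xs hy, Memory.blank) else none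
  else none

end Decoder

/-! ## The QEC cycle -/

/-- The state between two cycles: `err a` is the error of type `a` on the data qubits, and `mem a`
is the memory of the decoder for errors of type `a`. -/
structure CycleState (n₁ n₂ : ℕ) where
  err : Basis → Grid n₁ n₂
  mem : Basis → Memory n₁ n₂

/-- The result of a run: `discarded` if the verification of the preparation of an ancilla block
failed (this attempt is not used), `halted` if the decoder halts, else the new state. -/
inductive Outcome (n₁ n₂ : ℕ)
  | discarded
  | halted
  | ok (s : CycleState n₁ n₂)

section Cycle

variable {n₁ n₂ : ℕ}

/-- One half of the QEC cycle, with the annotated circuit `L` for the extraction of the stabilizers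
of type `b`: errors of the other type are decoded from the syndromes and the hook flags raised
earlier and are corrected; the flags raised in this half concern hook errors of type `b`. -/
def halfCycle (b : Basis) (L : List (Instr (Qubit n₁ n₂) × Event)) (s : CycleState n₁ n₂) :
    Outcome n₁ n₂ :=
  let r := run L
    { frame := fun a q => match q with
        | .data x y => s.err a x y
        | _ => 0
      record := fun _ => 0 }
  if r.record .check ≠ 0 then .discarded
  else
    match decode (s.mem b.dual) (fun x => r.record (.anc x)) (fun y => r.record (.rowAnc y)) with
    | none => .halted
    | some (c, m) => .ok
        { err := fun a x y => r.frame a (.data x y) + (if a = b then 0 else c x y)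
          mem := fun a =>
            if a = b then
              { s.mem b with
                hookCols := (s.mem b).hookCols ∪
                  Finset.univ.filter (fun x => r.record (.flag x) = 1)
                hookRows := (s.mem b).hookRows ∪
                  Finset.univ.filter (fun y => r.record (.rowFlag y) = 1) }
            else m }

/-- Annotated circuits for the two halves of a QEC cycle. -/
abbrev CycleRun (n₁ n₂ : ℕ) :=
  List (Instr (Qubit n₁ n₂) × Event) × List (Instr (Qubit n₁ n₂) × Event)

/-- `ρ` is an execution of the QEC cycle (`X` stabilizers first, then `Z` stabilizers) with at most
`k` faulty locations. -/
def IsCycle (k : ℕ) (ρ : CycleRun n₁ n₂) : Prop :=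
  ρ.1.map Prod.fst = extraction n₁ n₂ .X ∧ ρ.2.map Prod.fst = extraction n₁ n₂ .Z ∧
    faults ρ.1 + faults ρ.2 ≤ k

/-- The QEC cycle, with decoding and correction. -/
def cycle (ρ : CycleRun n₁ n₂) (s : CycleState n₁ n₂) : Outcome n₁ n₂ :=
  match halfCycle .X ρ.1 s with
  | .ok s' => halfCycle .Z ρ.2 s'
  | o => o

namespace CycleState

/-- No error, and nothing was passed on by the previous cycle. -/
def ErrorFree (s : CycleState n₁ n₂) : Prop :=
  ∀ a, SameError (s.err a) 0 ∧ s.mem a = Memory.blank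

/-- Generalized weight at most one. -/
def GenWeightLeOne (s : CycleState n₁ n₂) : Prop :=
  ∀ a, IsGenWeightLeOne (s.err a) (s.mem a).hookCols (s.mem a).hookRows

/-- Generalized weight at most two. -/
def GenWeightLeTwo (s : CycleState n₁ n₂) : Prop :=
  ∀ a, IsGenWeightLeTwo (s.err a) (s.mem a).hookCols (s.mem a).hookRows

/-- Generalized weight two. -/
def GenWeightTwo (s : CycleState n₁ n₂) : Prop := s.GenWeightLeTwo ∧ ¬ s.GenWeightLeOne

/-- The previous cycle did not forbid the errors that are present. -/
def Allowed (s : CycleState n₁ n₂) : Prop :=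
  ∀ a, (s.mem a).inputErrorAllowed = true ∨
    IsWeightZero (s.err a) (s.mem a).hookCols (s.mem a).hookRows

end CycleState

end Cycle

end Iceberg

namespace Iceberg

/-! ## Backward propagation of sensitivities -/

section Propagation

variable {Q : Type} [DecidableEq Q] {M : Type} [AddCommGroup M] [Module (ZMod 2) M]

/-! Pauli errors propagate linearly, so circuits can be analysed backwards. A linear observable of
the final frame assigns to each qubit a sensitivity in a `ZMod 2`-module, and `back` pulls it
through an instruction. If the sensitivities met by faults lie in a set `E` (for a CX also their
sum) and those met by the random frames of preparations lie in a subspace `G`, then any run gives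
the ideal value, plus an element of `G`, plus at most one element of `E` per faulty location
(`exists_effects`). It suffices to traverse the circuit once for each of two observables.

While the stabilizers of type `b` are extracted, errors of type `b` flow from the ancillas to the
data. The observable (data error, column flags, row flags) shows that a fault causes an error of
generalized weight at most one, up to unflagged stabilizers (`passes_hook`). Errors of the dual type
flow from the data to the ancillas. The observable (data error, verification, high-level and
low-level outcomes) shows that a fault flips one outcome, or is a single-qubit error seen by both
kinds of stabilizers, by its row only, or by none, or else it flips the verification
(`passes_detect`). Random frames only complement all high-level outcomes.

For the decoder, row parities are exact and column parities are known up to complement. Since `n₁`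
is even, the number of coordinates seen is even for every actual error (`Syndrome.even_card`), so an
odd number reveals a faulty extraction. With ideal outcomes, weight one is corrected
(`decodeBody_of_isGenWeightLeOne`), and an error of weight at most two on which the decoder succeeds
has weight at most one (`isGenWeightLeOne_of_decodeBody`). With one faulty extraction and an input
of weight one, the only worse output is a pair of errors in one row, of which only a column was seen
(`decodeSets_one_fault`). Then input errors are forbidden, and the next cycle halts because the pair
keeps a nontrivial syndrome (`IsDeferredPair.not_step`).

Finally, the two error types evolve separately and share only the fault budget (`cycle_cases`), so
each claim reduces to the ways of splitting the faults between the two halves. -/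

/-- The value on the frame `f` of the linear map that sends the single-qubit error at `q` to
`S q`. -/
def pairing [Fintype Q] (S : Q → M) (f : Q → ZMod 2) : M := ∑ q, f q • S q

/-- The sensitivities to errors of type `a` before an instruction, from those after it. -/
def back (a : Basis) : Instr Q → (Q → M) → (Q → M)
  | .prep _ q, S => Function.update S q 0
  | .cx c t, S =>
    match a with
    | .X => Function.update S c (S c + S t)
    | .Z => Function.update S t (S t + S c)
  | .meas _ _, S => S

/-- The faults of type `a` at an instruction, followed by the sensitivities `S`, have effects in
`E`, and the gauge freedom has effects in `G`. -/
def TameAt (a : Basis) (E : Set M) (G : Submodule (ZMod 2) M) : Instr Q → (Q → M) → Prop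
  | .prep b q, S => S q ∈ E ∧ (a = b → S q ∈ G)
  | .cx c t, S => S c ∈ E ∧ S t ∈ E ∧ S c + S t ∈ E
  | .meas _ q, S => S q ∈ E

/-- The sensitivities are `S` after the circuit and `S'` before it, with all the effects of faults
in `E` and of gauge freedom in `G`. -/
inductive Passes (a : Basis) (E : Set M) (G : Submodule (ZMod 2) M) :
    List (Instr Q) → (Q → M) → (Q → M) → Prop
  | nil (S) : Passes a E G [] S S
  | cons {i l S S'} : TameAt a E G i S' → Passes a E G l S S' →
      Passes a E G (i :: l) S (back a i S')

variable {a : Basis} {E : Set M} {G : Submodule (ZMod 2) M}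

theorem Passes.append {l₁ l₂ : List (Instr Q)} {S S' S'' : Q → M} (h₁ : Passes a E G l₁ S' S'')
    (h₂ : Passes a E G l₂ S S') : Passes a E G (l₁ ++ l₂) S S'' := by
  induction h₁ with
  | nil => exact h₂
  | cons ht _ ih => exact .cons ht (ih h₂)

theorem Passes.cons_eq {i : Instr Q} {l : List (Instr Q)} {S S' S'' : Q → M}
    (h : Passes a E G l S S') (ht : TameAt a E G i S') (hb : back a i S' = S'') :
    Passes a E G (i :: l) S S'' :=
  hb ▸ .cons ht h

/-- The table `T l` stands in front of the blocks still to be executed, so its index list shrinks as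
the circuit runs. The suffix hypothesis keeps the order of the blocks available, which the
preparation tree needs. -/
theorem Passes.flatMap_suffix {ι : Type} (f : ι → List (Instr Q)) (T : List ι → Q → M)
    (l : List ι) (h : ∀ i l', i :: l' <:+ l → Passes a E G (f i) (T l') (T (i :: l'))) :
    Passes a E G (l.flatMap f) (T []) (T l) := by
  induction l with
  | nil => exact .nil _
  | cons i l ih =>
    rw [List.flatMap_cons]
    exact (h i l List.suffix_rfl).append
      (ih fun j l' hl => h j l' (hl.trans (List.suffix_cons i l)))

theorem Passes.flatMap {ι : Type} (f : ι → List (Instr Q)) (T : List ι → Q → M)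
    {l : List ι} (hl : l.Nodup)
    (h : ∀ i l', i ∉ l' → Passes a E G (f i) (T l') (T (i :: l'))) :
    Passes a E G (l.flatMap f) (T []) (T l) :=
  flatMap_suffix f T l fun i l' hs =>
    h i l' (List.nodup_cons.1 (hl.sublist hs.sublist)).1

theorem Passes.map_suffix {ι : Type} (f : ι → Instr Q) (T : List ι → Q → M) (l : List ι)
    (h : ∀ i l', i :: l' <:+ l → TameAt a E G (f i) (T l') ∧ back a (f i) (T l') = T (i :: l')) :
    Passes a E G (l.map f) (T []) (T l) := by
  rw [← List.flatMap_singleton' (l.map f), List.flatMap_map]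
  exact flatMap_suffix _ T l fun i l' hs =>
    (Passes.nil _).cons_eq (h i l' hs).1 (h i l' hs).2

theorem Passes.map {ι : Type} (f : ι → Instr Q) (T : List ι → Q → M) {l : List ι} (hl : l.Nodup)
    (h : ∀ i l', i ∉ l' → TameAt a E G (f i) (T l') ∧ back a (f i) (T l') = T (i :: l')) :
    Passes a E G (l.map f) (T []) (T l) :=
  map_suffix f T l fun i l' hs => h i l' (List.nodup_cons.1 (hl.sublist hs.sublist)).1

theorem pairing_update [Fintype Q] (S : Q → M) (f : Q → ZMod 2) (q : Q) (v : ZMod 2) :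
    pairing S (Function.update f q v) = pairing S f + (v - f q) • S q := by
  have h : Function.update f q v = f + Pi.single q (v - f q) := by
    ext q'
    rcases eq_or_ne q' q with rfl | hq <;> simp [*]
  simp [h, pairing, add_smul, Finset.sum_add_distrib, Pi.single_apply, ite_smul]

theorem update_pairing [Fintype Q] (S : Q → M) (f : Q → ZMod 2) (q : Q) (v : M) :
    pairing (Function.update S q v) f = pairing S f + f q • (v - S q) := by
  have h : Function.update S q v = S + Pi.single q (v - S q) := by
    ext q'
    rcases eq_or_ne q' q with rfl | hq <;> simp [*]
  simp [h, pairing, smul_add, Finset.sum_add_distrib, Pi.single_apply, smul_ite]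

theorem addPauli_eq (f : Basis → Q → ZMod 2) (q : Q) (p : Basis → ZMod 2) (a : Basis) :
    addPauli f q p a = Function.update (f a) q (f a q + p a) := by
  ext q'
  rcases eq_or_ne q' q with rfl | hq <;> simp [addPauli, *]

theorem zmod_two_cases : ∀ c : ZMod 2, c = 0 ∨ c = 1 := by decide

theorem smul_mem_or (c : ZMod 2) {m : M} (hm : m ∈ E) : c • m = 0 ∨ c • m ∈ E := by
  rcases zmod_two_cases c with rfl | rfl
  · exact .inl (zero_smul _ _)
  · exact .inr ((one_smul (ZMod 2) m).symm ▸ hm)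

/-- A CX fault restricted to one Pauli type has three nontrivial values; this accounts for the three
memberships in `TameAt`. -/
theorem smul_add_smul_mem_or (c d : ZMod 2) {m n : M} (hm : m ∈ E) (hn : n ∈ E)
    (hmn : m + n ∈ E) : c • m + d • n = 0 ∨ c • m + d • n ∈ E := by
  rcases zmod_two_cases c with rfl | rfl <;> rcases zmod_two_cases d with rfl | rfl <;>
    simp [hm, hn, hmn]

/-- `back` is the adjoint of the noiseless `step`; the noise splits into a gauge part and a fault
part. A nonzero effect forces a fault, while a fault may have no effect of type `a`, so effects
never outnumber faults. -/
theorem pairing_step [Fintype Q] (s : RunState Q) (i : Instr Q) (ε : Event) {S : Q → M}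
    (h : TameAt a E G i S) :
    ∃ g ∈ G, ∃ m, (m = 0 ∨ m ∈ E) ∧ (m ≠ 0 → ε.isFault = true) ∧
      pairing S ((step s (i, ε)).frame a) = pairing (back a i S) (s.frame a) + g + m := by
  have hf : ∀ b, ε.fst b ≠ 0 → ε.isFault = true := fun b hb => by
    simp only [Event.isFault, decide_eq_true_eq]
    exact .inl fun h0 => hb (by simp [h0])
  have hs : ∀ b, ε.snd b ≠ 0 → ε.isFault = true := fun b hb => by
    simp only [Event.isFault, decide_eq_true_eq]
    exact .inr fun h0 => hb (by simp [h0])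
  cases i with
  | prep b q =>
    refine ⟨(if a = b then ε.gauge else 0) • S q, ?_, ε.fst a • S q, smul_mem_or _ h.1,
      fun h0 => hf a fun h1 => h0 (by simp [h1]), ?_⟩
    · split_ifs with hab
      · exact G.smul_mem _ (h.2 hab)
      · simp
    · have : (fun q' => if q' = q then (if a = b then ε.gauge else 0) else s.frame a q') =
          Function.update (s.frame a) q (if a = b then ε.gauge else 0) := by
        ext q'; simp [Function.update_apply]
      simp only [step, addPauli_eq, this, pairing_update, back, update_pairing,
        Function.update_self, if_true]
      module
  | cx c t =>
    refine ⟨0, G.zero_mem, ε.fst a • S c + ε.snd a • S t,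
      smul_add_smul_mem_or _ _ h.1 h.2.1 h.2.2, fun h0 => ?_, ?_⟩
    · by_cases h1 : ε.fst a = 0
      · exact hs a fun h2 => h0 (by simp [h1, h2])
      · exact hf a h1
    · have h2 : ∀ (f : Basis → Q → ZMod 2) (q : Q) (p : Basis → ZMod 2),
          pairing S (addPauli f q p a) = pairing S (f a) + p a • S q := fun f q p => by
        rw [addPauli_eq, pairing_update, add_sub_cancel_left]
      simp only [step, h2]
      cases a with
      | X =>
        have : (fun q' => if q' = t then s.frame .X t + s.frame .X c else s.frame .X q') =
            Function.update (s.frame .X) t (s.frame .X t + s.frame .X c) := by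
          ext q'; simp [Function.update_apply]
        simp only [this, back, pairing_update, update_pairing]
        module
      | Z =>
        have : (fun q' => if q' = c then s.frame .Z c + s.frame .Z t else s.frame .Z q') =
            Function.update (s.frame .Z) c (s.frame .Z c + s.frame .Z t) := by
          ext q'; simp [Function.update_apply]
        simp only [this, back, pairing_update, update_pairing]
        module
  | meas b q =>
    refine ⟨0, G.zero_mem, ε.fst a • S q, smul_mem_or _ h,
      fun h0 => hf a fun h1 => h0 (by simp [h1]), ?_⟩
    simp only [step, addPauli_eq, pairing_update, back]
    module

/-- A faulty run differs from the ideal one by gauge freedom and at most one effect for each faulty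
location. -/
theorem exists_effects [Fintype Q] {L : List (Instr Q × Event)} {S S' : Q → M}
    (h : Passes a E G (L.map Prod.fst) S S') (s : RunState Q) :
    ∃ g ∈ G, ∃ es : List M, es.length ≤ faults L ∧ (∀ m ∈ es, m ∈ E) ∧
      pairing S ((run L s).frame a) = pairing S' (s.frame a) + g + es.sum := by
  induction L generalizing s S' with
  | nil =>
    cases h
    exact ⟨0, G.zero_mem, [], by simp, by simp, by simp [run]⟩
  | cons p L ih =>
    obtain ⟨i, ε⟩ := p
    rw [List.map_cons] at h
    cases h with
    | cons ht h =>
      obtain ⟨g, hg, es, hlen, hes, heq⟩ := ih h (step s (i, ε))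
      obtain ⟨g', hg', m, hm, hmf, hstep⟩ := pairing_step s i ε ht
      have hrun : run ((i, ε) :: L) s = run L (step s (i, ε)) := rfl
      -- Trivial effects are left out of the list, so its length counts only faulty locations.
      by_cases h0 : m = 0
      · refine ⟨g' + g, G.add_mem hg' hg, es, hlen.trans ?_, hes, ?_⟩
        · simp [faults, List.countP_cons]
        · rw [hrun, heq, hstep, h0]; abel
      · refine ⟨g' + g, G.add_mem hg' hg, m :: es, ?_, ?_, ?_⟩
        · have := hmf h0
          simpa [faults, List.countP_cons, this] using hlen
        · simpa using ⟨hm.resolve_left h0, hes⟩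
        · rw [hrun, heq, hstep, List.sum_cons]; abel

end Propagation

/-! ## Records of measured qubits -/

section Records

variable {Q : Type}

/-- The instruction involves the qubit `q`. -/
def Instr.ActsOn : Instr Q → Q → Prop
  | .prep _ q', q => q = q'
  | .cx c t, q => q = c ∨ q = t
  | .meas _ q', q => q = q'

theorem Instr.prep_actsOn {b : Basis} {q q' : Q} : (Instr.prep b q').ActsOn q ↔ q = q' := Iff.rfl

theorem Instr.meas_actsOn {b : Basis} {q q' : Q} : (Instr.meas b q').ActsOn q ↔ q = q' := Iff.rfl

/-- The qubit `q` is measured in the basis `b`, and nothing is done with it afterwards. -/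
def EndsMeasured (b : Basis) (q : Q) (I : List (Instr Q)) : Prop :=
  ∃ I₁ I₂, I = I₁ ++ .meas b q :: I₂ ∧ ∀ i ∈ I₂, ¬ i.ActsOn q

variable {b : Basis} {q : Q} {I J : List (Instr Q)}

theorem EndsMeasured.append_left (h : EndsMeasured b q I) : EndsMeasured b q (J ++ I) := by
  obtain ⟨I₁, I₂, rfl, h⟩ := h
  exact ⟨J ++ I₁, I₂, by simp, h⟩

theorem EndsMeasured.append_right (h : EndsMeasured b q I) (hJ : ∀ i ∈ J, ¬ i.ActsOn q) :
    EndsMeasured b q (I ++ J) := by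
  obtain ⟨I₁, I₂, rfl, h⟩ := h
  refine ⟨I₁, I₂ ++ J, by simp, fun i hi => ?_⟩
  rcases List.mem_append.1 hi with hi | hi
  exacts [h i hi, hJ i hi]

theorem EndsMeasured.flatMap {ι : Type} {l : List ι} (hl : l.Nodup) {f : ι → List (Instr Q)}
    {x : ι} (hx : x ∈ l) (h : EndsMeasured b q (f x))
    (hf : ∀ x', x' ≠ x → ∀ i ∈ f x', ¬ i.ActsOn q) : EndsMeasured b q (l.flatMap f) := by
  obtain ⟨l₁, l₂, rfl⟩ := List.append_of_mem hx
  rw [List.flatMap_append, List.flatMap_cons]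
  refine (h.append_right fun i hi => ?_).append_left
  obtain ⟨x', hx', hi⟩ := List.mem_flatMap.1 hi
  have hnd := (List.nodup_cons.1 (List.nodup_append.1 hl).2.1).1
  exact hf x' (fun h => hnd (h ▸ hx')) i hi

theorem EndsMeasured.map {ι : Type} {l : List ι} (hl : l.Nodup) {f : ι → Q}
    (hf : Function.Injective f) {x : ι} (hx : x ∈ l) :
    EndsMeasured b (f x) (l.map fun x => .meas b (f x)) := by
  rw [← List.flatMap_singleton' (l.map _), List.flatMap_map]
  refine EndsMeasured.flatMap hl hx ⟨[], [], rfl, by simp⟩ fun x' hx' i hi => ?_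
  rw [List.mem_singleton.1 hi]
  exact fun h => hx' (hf h).symm

variable [DecidableEq Q]

theorem run_of_not_actsOn {L : List (Instr Q × Event)} (h : ∀ p ∈ L, ¬ p.1.ActsOn q)
    (s : RunState Q) :
    (∀ a, (run L s).frame a q = s.frame a q) ∧ (run L s).record q = s.record q := by
  induction L generalizing s with
  | nil => exact ⟨fun _ => rfl, rfl⟩
  | cons p L ih =>
    have hrun : run (p :: L) s = run L (step s p) := rfl
    have hp := h p (by simp)
    obtain ⟨h1, h2⟩ := ih (fun p' hp' => h p' (by simp [hp'])) (step s p)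
    obtain ⟨i, ε⟩ := p
    rw [hrun, h2]
    simp only [h1]
    cases i with
    | prep b q' =>
      have : q ≠ q' := hp
      simp [step, addPauli, this]
    | cx c t =>
      have : q ≠ c ∧ q ≠ t := by simpa [Instr.ActsOn] using hp
      refine ⟨fun a => ?_, rfl⟩
      cases a <;> simp [step, addPauli, this]
    | meas b q' =>
      have : q ≠ q' := hp
      simp [step, addPauli, this]

/-- A measurement fault acts before the readout, and the frame of the qubit is frozen afterwards.
Records are therefore coordinates of the final frame, to which linear observables apply. -/
theorem EndsMeasured.record_eq {L : List (Instr Q × Event)}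
    (h : EndsMeasured b q (L.map Prod.fst)) (s : RunState Q) :
    (run L s).record q = (run L s).frame b.dual q := by
  obtain ⟨I₁, I₂, hL, h⟩ := h
  obtain ⟨L₁, L₂, rfl, rfl, hL₂⟩ := List.map_eq_append_iff.1 hL
  obtain ⟨⟨i, ε⟩, L₃, rfl, hi, rfl⟩ := List.map_eq_cons_iff.1 hL₂
  obtain rfl : i = .meas b q := hi
  have hrun : run (L₁ ++ (.meas b q, ε) :: L₃) s = run L₃ (step (run L₁ s) (.meas b q, ε)) := by
    simp [run]
  obtain ⟨h1, h2⟩ := run_of_not_actsOn (L := L₃) (q := q)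
    (fun p hp => h p.1 (List.mem_map_of_mem hp)) (step (run L₁ s) (.meas b q, ε))
  rw [hrun, h1, h2]
  simp [step]

end Records

/-! ## Sensitivities of the extraction circuits -/

section Tables

variable {n₁ n₂ : ℕ}

/-- The qubits as a disjoint union. -/
def Qubit.equivSum : (Fin n₁ × Fin n₂) ⊕ Fin n₁ ⊕ Fin n₁ ⊕ Unit ⊕ Fin n₂ ⊕ Fin n₂ ≃ Qubit n₁ n₂ where
  toFun
    | .inl p => .data p.1 p.2
    | .inr (.inl x) => .anc x
    | .inr (.inr (.inl x)) => .flag x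
    | .inr (.inr (.inr (.inl _))) => .check
    | .inr (.inr (.inr (.inr (.inl y)))) => .rowAnc y
    | .inr (.inr (.inr (.inr (.inr y)))) => .rowFlag y
  invFun
    | .data x y => .inl (x, y)
    | .anc x => .inr (.inl x)
    | .flag x => .inr (.inr (.inl x))
    | .check => .inr (.inr (.inr (.inl ())))
    | .rowAnc y => .inr (.inr (.inr (.inr (.inl y))))
    | .rowFlag y => .inr (.inr (.inr (.inr (.inr y))))
  left_inv p := by rcases p with _ | _ | _ | _ | _ | _ <;> rfl
  right_inv q := by cases q <;> rfl

instance : Fintype (Qubit n₁ n₂) := Fintype.ofEquiv _ Qubit.equivSum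

variable {M : Type}

/-- A function of the qubits, given by its restrictions to the registers. -/
def table (d : Fin n₁ → Fin n₂ → M) (an fl : Fin n₁ → M) (ck : M) (ra rf : Fin n₂ → M) :
    Qubit n₁ n₂ → M
  | .data x y => d x y
  | .anc x => an x
  | .flag x => fl x
  | .check => ck
  | .rowAnc y => ra y
  | .rowFlag y => rf y

variable (d : Fin n₁ → Fin n₂ → M) (an fl : Fin n₁ → M) (ck : M) (ra rf : Fin n₂ → M)

theorem update_table_data (x : Fin n₁) (y : Fin n₂) (v : M) :
    Function.update (table d an fl ck ra rf) (.data x y) v =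
      table (fun x' y' => if x' = x ∧ y' = y then v else d x' y') an fl ck ra rf := by
  ext q; cases q <;> simp [table, Function.update_apply]

theorem update_table_anc (x : Fin n₁) (v : M) :
    Function.update (table d an fl ck ra rf) (.anc x) v =
      table d (fun x' => if x' = x then v else an x') fl ck ra rf := by
  ext q; cases q <;> simp [table, Function.update_apply]

theorem update_table_flag (x : Fin n₁) (v : M) :
    Function.update (table d an fl ck ra rf) (.flag x) v =
      table d an (fun x' => if x' = x then v else fl x') ck ra rf := by
  ext q; cases q <;> simp [table, Function.update_apply]

theorem update_table_check (v : M) :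
    Function.update (table d an fl ck ra rf) .check v = table d an fl v ra rf := by
  ext q; cases q <;> simp [table]

theorem update_table_rowAnc (y : Fin n₂) (v : M) :
    Function.update (table d an fl ck ra rf) (.rowAnc y) v =
      table d an fl ck (fun y' => if y' = y then v else ra y') rf := by
  ext q; cases q <;> simp [table, Function.update_apply]

theorem update_table_rowFlag (y : Fin n₂) (v : M) :
    Function.update (table d an fl ck ra rf) (.rowFlag y) v =
      table d an fl ck ra (fun y' => if y' = y then v else rf y') := by
  ext q; cases q <;> simp [table, Function.update_apply]

theorem table_congr {d d' : Fin n₁ → Fin n₂ → M} {an an' fl fl' : Fin n₁ → M} {ck ck' : M}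
    {ra ra' rf rf' : Fin n₂ → M} (hd : ∀ x y, d x y = d' x y) (han : ∀ x, an x = an' x)
    (hfl : ∀ x, fl x = fl' x) (hck : ck = ck') (hra : ∀ y, ra y = ra' y)
    (hrf : ∀ y, rf y = rf' y) :
    table d an fl ck ra rf = table d' an' fl' ck' ra' rf' := by
  obtain rfl : d = d' := funext fun x => funext (hd x)
  obtain rfl := funext han
  obtain rfl := funext hfl
  obtain rfl := funext hra
  obtain rfl := funext hrf
  rw [hck]

variable [AddCommGroup M]

theorem back_meas (a b : Basis) (q : Qubit n₁ n₂) (S : Qubit n₁ n₂ → M) :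
    back a (.meas b q) S = S := rfl

/-- Hadamard conjugation exchanges the types and reverses the CX, so errors of the extracted type
`b` flow from `c` to `t` in both halves of the cycle, and those of the dual type from `t` to `c`
(`back_dual_couple`). One analysis serves both halves. -/
theorem back_couple (b : Basis) (c t : Qubit n₁ n₂) (S : Qubit n₁ n₂ → M) :
    back b (couple b c t) S = Function.update S c (S c + S t) := by
  cases b <;> rfl

theorem back_dual_couple (b : Basis) (c t : Qubit n₁ n₂) (S : Qubit n₁ n₂ → M) :
    back b.dual (couple b c t) S = Function.update S t (S t + S c) := by
  cases b <;> rfl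

variable [Module (ZMod 2) M]

theorem pairing_table (f : Qubit n₁ n₂ → ZMod 2) :
    pairing (table d an fl ck ra rf) f =
      ∑ x, ∑ y, f (.data x y) • d x y + ∑ x, f (.anc x) • an x + ∑ x, f (.flag x) • fl x +
        f .check • ck + ∑ y, f (.rowAnc y) • ra y + ∑ y, f (.rowFlag y) • rf y := by
  rw [pairing, ← Equiv.sum_comp Qubit.equivSum]
  simp only [Fintype.sum_sum_type, Fintype.sum_prod_type, Finset.univ_unique, Finset.sum_singleton]
  simp only [Qubit.equivSum, Equiv.coe_fn_mk, table, add_assoc]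

theorem tameAt_couple {a b : Basis} {c t : Qubit n₁ n₂} {S : Qubit n₁ n₂ → M} {E : Set M}
    {G : Submodule (ZMod 2) M} :
    TameAt a E G (couple b c t) S ↔ S c ∈ E ∧ S t ∈ E ∧ S c + S t ∈ E := by
  cases b
  · rfl
  · simp only [couple, TameAt, add_comm (S t)]
    tauto

theorem Basis.dual_ne (b : Basis) : b.dual ≠ b := by cases b <;> simp [Basis.dual]

theorem Basis.dual_dual (b : Basis) : b.dual.dual = b := by cases b <;> rfl

end Tables

/-! ### The records -/

section Measured

variable {n₁ n₂ : ℕ} (b : Basis)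

theorem couple_actsOn {c t q : Qubit n₁ n₂} : (couple b c t).ActsOn q ↔ q = c ∨ q = t := by
  cases b
  · rfl
  · exact or_comm

theorem not_actsOn_row_of_ne {q : Qubit n₁ n₂} {y : Fin n₂} (h1 : q ≠ .rowAnc y)
    (h2 : q ≠ .rowFlag y) (h3 : ∀ x, q ≠ .data x y) :
    ∀ i ∈ rowExtraction n₁ n₂ b y, ¬ i.ActsOn q := by
  intro i hi
  simp only [rowExtraction, List.mem_append, List.mem_cons, List.not_mem_nil, or_false,
    List.mem_map] at hi
  rcases hi with ((rfl | rfl | rfl) | ⟨x, -, rfl⟩) | rfl | rfl | rfl <;>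
    simp only [Instr.prep_actsOn, Instr.meas_actsOn, couple_actsOn] <;> (try split_ifs) <;>
    simp [h1, h2, h3]

theorem not_actsOn_rows {q : Qubit n₁ n₂} (h1 : ∀ y, q ≠ .rowAnc y)
    (h2 : ∀ y, q ≠ .rowFlag y) (h3 : ∀ x y, q ≠ .data x y) :
    ∀ i ∈ (List.finRange n₂).flatMap (rowExtraction n₁ n₂ b), ¬ i.ActsOn q := by
  intro i hi
  obtain ⟨y, -, hi⟩ := List.mem_flatMap.1 hi
  exact not_actsOn_row_of_ne b (h1 y) (h2 y) (fun x => h3 x y) i hi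

theorem endsMeasured_check : EndsMeasured b .check (extraction n₁ n₂ b) := by
  refine EndsMeasured.append_right (.append_right (.append_left ⟨[], [], rfl, by simp⟩) ?_)
    (not_actsOn_rows b (by simp) (by simp) (by simp))
  intro i hi
  simp only [highExtraction, List.mem_append, List.mem_map, List.mem_flatMap] at hi
  rcases hi with ((((⟨x, -, rfl⟩ | ⟨x, -, rfl⟩) | ⟨y, -, x, -, rfl⟩) | ⟨x, -, rfl⟩) |
    ⟨x, -, rfl⟩) | ⟨x, -, rfl⟩ <;> simp only [Instr.prep_actsOn, Instr.meas_actsOn, couple_actsOn] <;>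
    (try split_ifs) <;> simp

theorem endsMeasured_anc (x : Fin n₁) : EndsMeasured b (.anc x) (extraction n₁ n₂ b) := by
  refine EndsMeasured.append_right (.append_left (.append_right (.append_left
    (.map (List.nodup_finRange _) (fun _ _ h => by simpa using h) (List.mem_finRange x))) ?_))
    (not_actsOn_rows b (by simp) (by simp) (by simp))
  intro i hi
  obtain ⟨x, -, rfl⟩ := List.mem_map.1 hi
  simp [Instr.meas_actsOn]

theorem endsMeasured_flag (x : Fin n₁) : EndsMeasured b.dual (.flag x) (extraction n₁ n₂ b) :=
  .append_right (.append_left (.append_left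
    (.map (List.nodup_finRange _) (fun _ _ h => by simpa using h) (List.mem_finRange x))))
    (not_actsOn_rows b (by simp) (by simp) (by simp))

theorem endsMeasured_rowAnc (y : Fin n₂) : EndsMeasured b (.rowAnc y) (extraction n₁ n₂ b) := by
  refine .append_left (.flatMap (List.nodup_finRange _) (List.mem_finRange y)
    (.append_left ⟨[couple b (.rowAnc y) (.rowFlag y)], [.meas b.dual (.rowFlag y)], rfl, ?_⟩)
    fun y' hy' => not_actsOn_row_of_ne b ?_ (by simp) (by simp))
  · simp [Instr.meas_actsOn]
  · simpa using hy'.symm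

theorem endsMeasured_rowFlag (y : Fin n₂) :
    EndsMeasured b.dual (.rowFlag y) (extraction n₁ n₂ b) := by
  refine .append_left (.flatMap (List.nodup_finRange _) (List.mem_finRange y)
    (.append_left ⟨[couple b (.rowAnc y) (.rowFlag y), .meas b (.rowAnc y)], [], rfl, by simp⟩)
    fun y' hy' => not_actsOn_row_of_ne b (by simp) ?_ (by simp))
  simpa using hy'.symm

end Measured

/-! ### Transversal layers on the high-level ancilla and its flags -/

section Layers

variable {n₁ n₂ : ℕ} {M : Type} [AddCommGroup M] [Module (ZMod 2) M] {a b : Basis} {E : Set M}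
  {G : Submodule (ZMod 2) M} {d : Fin n₁ → Fin n₂ → M} {an fl : Fin n₁ → M} {ck : M}
  {ra rf : Fin n₂ → M}

theorem passes_meas_anc (h : ∀ x, an x ∈ E) :
    Passes a E G ((List.finRange n₁).map fun x => .meas b (.anc x)) (table d an fl ck ra rf)
      (table d an fl ck ra rf) :=
  Passes.map _ (fun _ => table d an fl ck ra rf) (List.nodup_finRange _)
    fun x _ _ => ⟨h x, rfl⟩

theorem passes_meas_flag (h : ∀ x, fl x ∈ E) :
    Passes a E G ((List.finRange n₁).map fun x => .meas b (.flag x)) (table d an fl ck ra rf)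
      (table d an fl ck ra rf) :=
  Passes.map _ (fun _ => table d an fl ck ra rf) (List.nodup_finRange _)
    fun x _ _ => ⟨h x, rfl⟩

theorem passes_prep_flag (h : ∀ x, fl x ∈ E) (hG : a = b → ∀ x, fl x ∈ G) :
    Passes a E G ((List.finRange n₁).map fun x => .prep b (.flag x)) (table d an fl ck ra rf)
      (table d an (fun _ => 0) ck ra rf) := by
  have := Passes.map (a := a) (E := E) (G := G) (fun x => .prep b (.flag x))
    (fun l => table d an (fun x => if x ∈ l then 0 else fl x) ck ra rf) (List.nodup_finRange n₁)
    fun x l hx => ⟨?_, ?_⟩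
  · simpa using this
  · simpa [TameAt, table, hx, h] using fun hab => hG hab x
  · rw [back, update_table_flag]
    refine table_congr (fun _ _ => rfl) (fun _ => rfl) (fun x' => ?_) rfl (fun _ => rfl)
      (fun _ => rfl)
    by_cases h' : x' = x <;> simp [h']

theorem passes_prep_anc (c : Fin n₁ → Basis) (h : ∀ x, an x ∈ E)
    (hG : ∀ x, a = c x → an x ∈ G) :
    Passes a E G ((List.finRange n₁).map fun x => .prep (c x) (.anc x)) (table d an fl ck ra rf)
      (table d (fun _ => 0) fl ck ra rf) := by
  have := Passes.map (a := a) (E := E) (G := G) (fun x => .prep (c x) (.anc x))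
    (fun l => table d (fun x => if x ∈ l then 0 else an x) fl ck ra rf) (List.nodup_finRange n₁)
    fun x l hx => ⟨?_, ?_⟩
  · simpa using this
  · simpa [TameAt, table, hx, h] using hG x
  · rw [back, update_table_anc]
    refine table_congr (fun _ _ => rfl) (fun x' => ?_) (fun _ => rfl) rfl (fun _ => rfl)
      (fun _ => rfl)
    by_cases h' : x' = x <;> simp [h']

theorem passes_couple_anc_flag (h : ∀ x, an x ∈ E ∧ fl x ∈ E ∧ an x + fl x ∈ E) :
    Passes b E G ((List.finRange n₁).map fun x => couple b (.anc x) (.flag x))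
      (table d an fl ck ra rf) (table d (fun x => an x + fl x) fl ck ra rf) := by
  have := Passes.map (a := b) (E := E) (G := G) (fun x => couple b (.anc x) (.flag x))
    (fun l => table d (fun x => if x ∈ l then an x + fl x else an x) fl ck ra rf)
    (List.nodup_finRange n₁) fun x l hx => ⟨?_, ?_⟩
  · simpa using this
  · simpa [tameAt_couple, table, hx] using h x
  · rw [back_couple, update_table_anc]
    refine table_congr (fun _ _ => rfl) (fun x' => ?_) (fun _ => rfl) rfl (fun _ => rfl)
      (fun _ => rfl)
    by_cases h' : x' = x <;> simp [h', hx, table]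

theorem passes_couple_anc_flag_dual (h : ∀ x, an x ∈ E ∧ fl x ∈ E ∧ an x + fl x ∈ E) :
    Passes b.dual E G ((List.finRange n₁).map fun x => couple b (.anc x) (.flag x))
      (table d an fl ck ra rf) (table d an (fun x => fl x + an x) ck ra rf) := by
  have := Passes.map (a := b.dual) (E := E) (G := G) (fun x => couple b (.anc x) (.flag x))
    (fun l => table d an (fun x => if x ∈ l then fl x + an x else fl x) ck ra rf)
    (List.nodup_finRange n₁) fun x l hx => ⟨?_, ?_⟩
  · simpa using this
  · simpa [tameAt_couple, table, hx] using h x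
  · rw [back_dual_couple, update_table_flag]
    refine table_congr (fun _ _ => rfl) (fun _ => rfl) (fun x' => ?_) rfl (fun _ => rfl)
      (fun _ => rfl)
    by_cases h' : x' = x <;> simp [h', hx, table]

end Layers

/-! ### Arithmetic of strings and of indicator functions -/

section Strings

variable {n₁ n₂ : ℕ}

theorem ite_add_ite_symmDiff {α : Type} [DecidableEq α] (S T : Finset α) (i : α) :
    ((if i ∈ S then 1 else 0) + (if i ∈ T then 1 else 0) : ZMod 2) =
      if i ∈ symmDiff S T then 1 else 0 := by
  by_cases h1 : i ∈ S <;> by_cases h2 : i ∈ T <;> simp [Finset.mem_symmDiff, h1, h2]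
  decide

theorem vString_add_vString (x : Fin n₁) (S T : Finset (Fin n₂)) :
    vString x S + vString x T = vString x (symmDiff S T) := by
  ext i j
  by_cases h : i = x
  · simpa [vString, h] using ite_add_ite_symmDiff S T j
  · simp [vString, h]

theorem hString_add_hString (S T : Finset (Fin n₁)) (y : Fin n₂) :
    hString S y + hString T y = hString (symmDiff S T) y := by
  ext i j
  by_cases h : j = y
  · simpa [hString, h] using ite_add_ite_symmDiff S T i
  · simp [hString, h]

theorem vString_singleton (x : Fin n₁) (y : Fin n₂) : vString x {y} = hString {x} y := by
  ext i j; simp [vString, hString]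

theorem vString_empty (x : Fin n₁) : (vString x ∅ : Grid n₁ n₂) = 0 := by
  ext i j; simp [vString]

theorem hString_empty (y : Fin n₂) : (hString ∅ y : Grid n₁ n₂) = 0 := by
  ext i j; simp [hString]

theorem hString_univ_mem (y : Fin n₂) : (hString Finset.univ y : Grid n₁ n₂) ∈ stabilizers n₁ n₂ :=
  Submodule.subset_span (.inl ⟨y, rfl⟩)

theorem columns_mem (x x' : Fin n₁) :
    (vString x Finset.univ + vString x' Finset.univ : Grid n₁ n₂) ∈ stabilizers n₁ n₂ :=
  Submodule.subset_span (.inr ⟨(x, x'), rfl⟩)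

theorem grid_add_self (e : Grid n₁ n₂) : e + e = 0 := by
  ext x y; exact CharTwo.add_self_eq_zero _

/-- The positions of the ones. -/
def ones {n : ℕ} (f : Fin n → ZMod 2) : Finset (Fin n) := Finset.univ.filter (f · = 1)

theorem ones_zero {n : ℕ} : ones (0 : Fin n → ZMod 2) = ∅ := by simp [ones]

theorem ones_single {n : ℕ} (i : Fin n) : ones (Pi.single i 1) = {i} := by
  ext j; by_cases h : j = i <;> simp [ones, h]

theorem finRange_filter_ends (k : ℕ) :
    (List.finRange (k + 2)).filter (fun x => k + 2 ≤ x.val + 2) =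
      [(Fin.last k).castSucc, Fin.last (k + 1)] := by
  rw [List.finRange_succ_last, List.finRange_succ_last]
  simp [List.filter_map, Function.comp_def]

end Strings

/-! ### Hook errors -/

section Hook

variable {n₁ n₂ : ℕ}

/-- An error, with the flags of the columns and of the rows. -/
abbrev Flagged (n₁ n₂ : ℕ) := Grid n₁ n₂ × (Fin n₁ → ZMod 2) × (Fin n₂ → ZMod 2)

variable (n₁ n₂) in
/-- The effects of a single fault on the errors of the type of the extracted stabilizers. -/
def hookEffects : Set (Flagged n₁ n₂) :=
  {m | IsGenWeightLeOne m.1 (ones m.2.1) (ones m.2.2)}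

variable (n₁ n₂) in
/-- Unflagged stabilizers. -/
def hookGauge : Submodule (ZMod 2) (Flagged n₁ n₂) := (stabilizers n₁ n₂).prod ⊥

/-- A string in a column, without a flag. -/
def colErr (x : Fin n₁) (S : Finset (Fin n₂)) : Flagged n₁ n₂ := (vString x S, 0, 0)

/-- A string in a flagged column. -/
def colHook (x : Fin n₁) (S : Finset (Fin n₂)) : Flagged n₁ n₂ := (vString x S, Pi.single x 1, 0)

/-- A string in a flagged row. -/
def rowHook (S : Finset (Fin n₁)) (y : Fin n₂) : Flagged n₁ n₂ := (hString S y, 0, Pi.single y 1)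

theorem sameError_refl (e : Grid n₁ n₂) : SameError e e := by
  simp [SameError, (stabilizers n₁ n₂).zero_mem]

theorem hookGauge_subset {m : Flagged n₁ n₂} (h : m ∈ hookGauge n₁ n₂) : m ∈ hookEffects n₁ n₂ := by
  obtain ⟨h1, h2⟩ := Submodule.mem_prod.1 h
  rw [Submodule.mem_bot] at h2
  refine .inl ⟨?_, ?_, ?_⟩
  · simpa [SameError] using h1
  · simp [h2, ones_zero]
  · simp [h2, ones_zero]

theorem zero_mem_hookEffects : (0 : Flagged n₁ n₂) ∈ hookEffects n₁ n₂ :=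
  hookGauge_subset (Submodule.zero_mem _)

theorem colErr_singleton_mem (x : Fin n₁) (y : Fin n₂) : colErr x {y} ∈ hookEffects n₁ n₂ :=
  .inr (.inl ⟨x, y, sameError_refl _, ones_zero, ones_zero⟩)

theorem colErr_univ_mem (x : Fin n₁) : colErr x Finset.univ ∈ hookEffects n₁ n₂ :=
  .inr (.inr (.inr (.inr ⟨x, sameError_refl _, ones_zero, ones_zero⟩)))

theorem colHook_mem (x : Fin n₁) (S : Finset (Fin n₂)) : colHook x S ∈ hookEffects n₁ n₂ :=
  .inr (.inr (.inl ⟨x, S, sameError_refl _, ones_single x, ones_zero⟩))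

theorem rowHook_mem (S : Finset (Fin n₁)) (y : Fin n₂) : rowHook S y ∈ hookEffects n₁ n₂ :=
  .inr (.inr (.inr (.inl ⟨y, S, sameError_refl _, ones_zero, ones_single y⟩)))

theorem colErr_add_colErr_mem (x x' : Fin n₁) :
    (colErr x Finset.univ + colErr x' Finset.univ : Flagged n₁ n₂) ∈ hookGauge n₁ n₂ :=
  Submodule.mem_prod.2 ⟨columns_mem x x', by simp [colErr]⟩

theorem single_add_single {n : ℕ} (i : Fin n) : (Pi.single i 1 + Pi.single i 1 : Fin n → ZMod 2) = 0 := by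
  ext j; exact CharTwo.add_self_eq_zero _

theorem symmDiff_singleton {α : Type} [DecidableEq α] {S : Finset α} {i : α} (h : i ∉ S) :
    symmDiff S {i} = insert i S := by
  ext j
  by_cases hj : j = i <;> simp [Finset.mem_symmDiff, hj, h]

theorem colHook_add_colErr (x : Fin n₁) {S : Finset (Fin n₂)} {y : Fin n₂} (h : y ∉ S) :
    colHook x S + colErr x {y} = colHook x (insert y S) := by
  simp [colHook, colErr, vString_add_vString, symmDiff_singleton h]

theorem rowHook_add_colErr {S : Finset (Fin n₁)} {x : Fin n₁} (y : Fin n₂) (h : x ∉ S) :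
    rowHook S y + colErr x {y} = rowHook (insert x S) y := by
  simp [rowHook, colErr, vString_singleton, hString_add_hString, symmDiff_singleton h]

theorem symmDiff_even_odd {n : ℕ} :
    symmDiff (Finset.univ.filter fun y : Fin n => Even y.val)
      (Finset.univ.filter fun y : Fin n => ¬ Even y.val) = Finset.univ := by
  ext y
  by_cases h : Even y.val <;> simp [Finset.mem_symmDiff, h, -Nat.not_even_iff_odd]

/-- The two flag bits cancel: an error on an ancilla qubit before it is copied to its flag becomes
an unflagged full column. This is why full columns must count as weight one. -/
theorem colHook_even_add_odd (x : Fin n₁) :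
    colHook x (Finset.univ.filter fun y : Fin n₂ => Even y.val) +
      colHook x (Finset.univ.filter fun y : Fin n₂ => ¬ Even y.val) = colErr x Finset.univ := by
  simp [colHook, colErr, vString_add_vString, symmDiff_even_odd, single_add_single,
    -Nat.not_even_iff_odd]

/-- The two halves fill the row, which is a stabilizer, so the random frame of the row ancilla is
harmless. -/
theorem rowHook_even_add_odd_mem (y : Fin n₂) :
    rowHook (Finset.univ.filter fun x : Fin n₁ => Even x.val) y +
      rowHook (Finset.univ.filter fun x : Fin n₁ => ¬ Even x.val) y ∈ hookGauge n₁ n₂ := by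
  simp [rowHook, hookGauge, Submodule.mem_prod, hString_add_hString, symmDiff_even_odd,
    single_add_single, hString_univ_mem, -Nat.not_even_iff_odd]

/-- The coupling of one row to the high-level ancilla and its flags. -/
theorem passes_hook_couple_row (b : Basis) (y : Fin n₂) {A B : Finset (Fin n₂)} (hA : y ∉ A)
    (hB : y ∉ B) (ck : Flagged n₁ n₂) (ra rf : Fin n₂ → Flagged n₁ n₂) :
    Passes b (hookEffects n₁ n₂) (hookGauge n₁ n₂)
      ((List.finRange n₁).map fun x =>
        couple b (if Even y.val then .anc x else .flag x) (.data x y))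
      (table (fun x y => colErr x {y}) (fun x => colHook x A) (fun x => colHook x B) ck ra rf)
      (table (fun x y => colErr x {y})
        (fun x => colHook x (if Even y.val then insert y A else A))
        (fun x => colHook x (if Even y.val then B else insert y B)) ck ra rf) := by
  by_cases hy : Even y.val
  · simp only [hy, if_true]
    have := Passes.map (a := b) (E := hookEffects n₁ n₂) (G := hookGauge n₁ n₂)
      (fun x => couple b (.anc x) (.data x y))
      (fun l => table (fun x y => colErr x {y})
        (fun x => if x ∈ l then colHook x (insert y A) else colHook x A)
        (fun x => colHook x B) ck ra rf) (List.nodup_finRange n₁) fun x l hx => ⟨?_, ?_⟩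
    · simpa using this
    · simp [tameAt_couple, table, hx, colHook_mem, colErr_singleton_mem, colHook_add_colErr x hA]
    · rw [back_couple, update_table_anc]
      refine table_congr (fun _ _ => rfl) (fun x' => ?_) (fun _ => rfl) rfl (fun _ => rfl)
        (fun _ => rfl)
      by_cases h' : x' = x <;> simp [h', hx, table, colHook_add_colErr x hA]
  · simp only [hy, if_false]
    have := Passes.map (a := b) (E := hookEffects n₁ n₂) (G := hookGauge n₁ n₂)
      (fun x => couple b (.flag x) (.data x y))
      (fun l => table (fun x y => colErr x {y}) (fun x => colHook x A)
        (fun x => if x ∈ l then colHook x (insert y B) else colHook x B) ck ra rf)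
      (List.nodup_finRange n₁) fun x l hx => ⟨?_, ?_⟩
    · simpa using this
    · simp [tameAt_couple, table, hx, colHook_mem, colErr_singleton_mem, colHook_add_colErr x hB]
    · rw [back_couple, update_table_flag]
      refine table_congr (fun _ _ => rfl) (fun _ => rfl) (fun x' => ?_) rfl (fun _ => rfl)
        (fun _ => rfl)
      by_cases h' : x' = x <;> simp [h', hx, table, colHook_add_colErr x hB]

theorem passes_hook_couple_rows (b : Basis) (ck : Flagged n₁ n₂)
    (ra rf : Fin n₂ → Flagged n₁ n₂) :
    Passes b (hookEffects n₁ n₂) (hookGauge n₁ n₂)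
      ((List.finRange n₂).flatMap fun y => (List.finRange n₁).map fun x =>
        couple b (if Even y.val then .anc x else .flag x) (.data x y))
      (table (fun x y => colErr x {y}) (fun x => colHook x ∅) (fun x => colHook x ∅) ck ra rf)
      (table (fun x y => colErr x {y})
        (fun x => colHook x (Finset.univ.filter fun y => Even y.val))
        (fun x => colHook x (Finset.univ.filter fun y => ¬ Even y.val)) ck ra rf) := by
  have := Passes.flatMap (a := b) (E := hookEffects n₁ n₂) (G := hookGauge n₁ n₂)
    (fun y => (List.finRange n₁).map fun x =>
        couple b (if Even y.val then .anc x else .flag x) (.data x y))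
    (fun l => table (fun x y => colErr x {y})
        (fun x => colHook x (Finset.univ.filter fun y => y ∈ l ∧ Even y.val))
        (fun x => colHook x (Finset.univ.filter fun y => y ∈ l ∧ ¬ Even y.val)) ck ra rf)
    (List.nodup_finRange n₂) fun y l hy => ?_
  · simpa using this
  · convert passes_hook_couple_row b y (A := Finset.univ.filter fun y => y ∈ l ∧ Even y.val)
      (B := Finset.univ.filter fun y => y ∈ l ∧ ¬ Even y.val) (by simp [hy]) (by simp [hy])
      ck ra rf using 6 with x x
    · ext y'
      by_cases h' : y' = y <;> by_cases he : Even y.val <;> simp [h', he, -Nat.not_even_iff_odd]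
    · ext y'
      by_cases h' : y' = y <;> by_cases he : Even y.val <;> simp [h', he, -Nat.not_even_iff_odd]

/-- The coupling of one row to its Bell pair. -/
theorem passes_hook_couple_bell (b : Basis) (y : Fin n₂) (an fl : Fin n₁ → Flagged n₁ n₂)
    (ck : Flagged n₁ n₂) (ra rf : Fin n₂ → Flagged n₁ n₂) (ha : ra y = rowHook ∅ y)
    (hf : rf y = rowHook ∅ y) :
    Passes b (hookEffects n₁ n₂) (hookGauge n₁ n₂)
      ((List.finRange n₁).map fun x =>
        couple b (if Even x.val then .rowAnc y else .rowFlag y) (.data x y))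
      (table (fun x y => colErr x {y}) an fl ck ra rf)
      (table (fun x y => colErr x {y}) an fl ck
        (fun y' => if y' = y then rowHook (Finset.univ.filter fun x => Even x.val) y else ra y')
        (fun y' => if y' = y then rowHook (Finset.univ.filter fun x => ¬ Even x.val) y
          else rf y')) := by
  have := Passes.map (a := b) (E := hookEffects n₁ n₂) (G := hookGauge n₁ n₂)
    (fun x => couple b (if Even x.val then .rowAnc y else .rowFlag y) (.data x y))
    (fun l => table (fun x y => colErr x {y}) an fl ck
      (fun y' => if y' = y then rowHook (Finset.univ.filter fun x => x ∈ l ∧ Even x.val) y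
        else ra y')
      (fun y' => if y' = y then rowHook (Finset.univ.filter fun x => x ∈ l ∧ ¬ Even x.val) y
        else rf y'))
    (List.nodup_finRange n₁) fun x l hx => ⟨?_, ?_⟩
  · convert this using 3 with y' y'
    · by_cases h : y' = y <;> simp [h, ha]
    · by_cases h : y' = y <;> simp [h, hf]
    · simp
    · simp
  · by_cases he : Even x.val
    · simp [tameAt_couple, table, he, rowHook_mem, colErr_singleton_mem, rowHook_add_colErr, hx]
    · simp [tameAt_couple, table, he, rowHook_mem, colErr_singleton_mem, rowHook_add_colErr, hx]
  · have hins : ∀ p : Fin n₁ → Prop, ∀ [DecidablePred p], p x →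
        (Finset.univ.filter fun x' => x' ∈ x :: l ∧ p x') =
          insert x (Finset.univ.filter fun x' => x' ∈ l ∧ p x') := by
      intro p _ hp
      ext x'
      by_cases h' : x' = x <;> simp [h', hp]
    have hskip : ∀ p : Fin n₁ → Prop, ∀ [DecidablePred p], ¬ p x →
        (Finset.univ.filter fun x' => x' ∈ x :: l ∧ p x') =
          Finset.univ.filter fun x' => x' ∈ l ∧ p x' := by
      intro p _ hp
      ext x'
      by_cases h' : x' = x <;> simp [h', hp]
    by_cases he : Even x.val
    · rw [if_pos he, back_couple, update_table_rowAnc,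
        hins (fun x => Even x.val) he, hskip (fun x => ¬ Even x.val) (not_not.2 he)]
      refine table_congr (fun _ _ => rfl) (fun _ => rfl) (fun _ => rfl) rfl (fun y' => ?_)
        (fun _ => rfl)
      by_cases h' : y' = y <;> simp [h', hx, table, rowHook_add_colErr]
    · rw [if_neg he, back_couple, update_table_rowFlag,
        hins (fun x => ¬ Even x.val) he, hskip (fun x => Even x.val) he]
      refine table_congr (fun _ _ => rfl) (fun _ => rfl) (fun _ => rfl) rfl (fun _ => rfl)
        (fun y' => ?_)
      by_cases h' : y' = y <;> simp [h', hx, table, rowHook_add_colErr]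

end Hook

/-! ### Hook errors of the complete extraction circuit -/

section Hook

variable {n₁ n₂ : ℕ}

/-- Between the two CX gates of the Bell pair, an error of type `b` on either qubit raises the row
flag, whatever part of the row it deposits on the data. Before the first gate, an error on the
ancilla deposits the whole row. -/
theorem passes_hook_row (b : Basis) (y : Fin n₂) (an fl : Fin n₁ → Flagged n₁ n₂)
    (ck : Flagged n₁ n₂) (ra rf : Fin n₂ → Flagged n₁ n₂) (ha : ra y = 0)
    (hf : rf y = rowHook ∅ y) :
    Passes b (hookEffects n₁ n₂) (hookGauge n₁ n₂) (rowExtraction n₁ n₂ b y)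
      (table (fun x y => colErr x {y}) an fl ck ra rf)
      (table (fun x y => colErr x {y}) an fl ck (fun y' => if y' = y then 0 else ra y')
        (fun y' => if y' = y then 0 else rf y')) := by
  have h0 : (0 : Flagged n₁ n₂) ∈ hookEffects n₁ n₂ := zero_mem_hookEffects
  have h1 : Passes b (hookEffects n₁ n₂) (hookGauge n₁ n₂)
      [couple b (.rowAnc y) (.rowFlag y), .meas b (.rowAnc y), .meas b.dual (.rowFlag y)]
      (table (fun x y => colErr x {y}) an fl ck ra rf)
      (table (fun x y => colErr x {y}) an fl ck
        (fun y' => if y' = y then rowHook ∅ y else ra y') rf) := by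
    refine (((Passes.nil _).cons_eq ?_ rfl).cons_eq ?_ rfl).cons_eq ?_ ?_
    · simp [TameAt, table, hf, rowHook_mem]
    · simp [TameAt, back, table, ha, h0]
    · simp [tameAt_couple, back, table, ha, hf, h0, rowHook_mem]
    · rw [back_couple]
      simp [back, table, ha, hf, update_table_rowAnc]
  refine Passes.append ?_ h1
  refine Passes.append ?_ (passes_hook_couple_bell b y an fl ck _ rf (if_pos rfl) hf)
  refine (((Passes.nil _).cons_eq ?_ (back_couple _ _ _ _)).cons_eq ?_ rfl).cons_eq ?_ ?_
  · simp [tameAt_couple, table, rowHook_mem, hookGauge_subset (rowHook_even_add_odd_mem y),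
      -Nat.not_even_iff_odd]
  · simp [TameAt, table, rowHook_mem, b.dual_ne.symm]
  · simp [TameAt, table, back, update_table_rowAnc,
      rowHook_even_add_odd_mem, hookGauge_subset (rowHook_even_add_odd_mem y),
      -Nat.not_even_iff_odd]
  · simp only [back, table, update_table_rowAnc, update_table_rowFlag]
    refine table_congr (fun _ _ => rfl) (fun _ => rfl) (fun _ => rfl) rfl (fun y' => ?_)
      (fun y' => ?_) <;> by_cases h' : y' = y <;> simp [h']

theorem passes_hook_rows (b : Basis) (an fl : Fin n₁ → Flagged n₁ n₂) (ck : Flagged n₁ n₂) :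
    Passes b (hookEffects n₁ n₂) (hookGauge n₁ n₂)
      ((List.finRange n₂).flatMap (rowExtraction n₁ n₂ b))
      (table (fun x y => colErr x {y}) an fl ck (fun _ => 0) (fun y => rowHook ∅ y))
      (table (fun x y => colErr x {y}) an fl ck (fun _ => 0) (fun _ => 0)) := by
  have := Passes.flatMap (a := b) (E := hookEffects n₁ n₂) (G := hookGauge n₁ n₂)
    (rowExtraction n₁ n₂ b) (fun l => table (fun x y => colErr x {y}) an fl ck
      (fun _ => 0) (fun y => if y ∈ l then 0 else rowHook ∅ y))
    (List.nodup_finRange n₂) fun y l hy => ?_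
  · simpa using this
  · convert passes_hook_row b y an fl ck (fun _ => 0)
      (fun y => if y ∈ l then 0 else rowHook ∅ y) rfl (if_neg hy) using 2
    · simp
    · ext1 y'
      by_cases h' : y' = y <;> simp [h']

/-- Between the two CX layers, an error of type `b` on the ancilla or flag qubit of a column raises
the flag of that column, so the partial columns it deposits are flagged. Before the first layer, an
error on the ancilla yields the full column. -/
theorem passes_hook_high (b : Basis) (ck : Flagged n₁ n₂) (ra rf : Fin n₂ → Flagged n₁ n₂) :
    Passes b (hookEffects n₁ n₂) (hookGauge n₁ n₂) (highExtraction n₁ n₂ b)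
      (table (fun x y => colErr x {y}) (fun _ => 0) (fun x => colHook x ∅) ck ra rf)
      (table (fun x y => colErr x {y}) (fun x => colErr x Finset.univ) (fun _ => 0) ck ra rf) := by
  have h0 : (0 : Flagged n₁ n₂) ∈ hookEffects n₁ n₂ := zero_mem_hookEffects
  refine Passes.append ?_ (passes_meas_flag fun x => colHook_mem x _)
  refine Passes.append ?_ (passes_meas_anc fun x => h0)
  refine Passes.append ?_ (passes_couple_anc_flag fun x => ?_)
  · simp only [zero_add]
    refine Passes.append ?_ (passes_hook_couple_rows b ck ra rf)
    refine Passes.append ?_ (passes_couple_anc_flag fun x => ?_)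
    · simp only [colHook_even_add_odd]
      -- The flags are prepared in the dual basis, so no gauge freedom of type `b` enters here.
      exact passes_prep_flag (fun x => colHook_mem x _) fun h => absurd h.symm b.dual_ne
    · rw [colHook_even_add_odd]
      exact ⟨colHook_mem x _, colHook_mem x _, colErr_univ_mem x⟩
  · rw [zero_add]
    exact ⟨h0, colHook_mem x _, colHook_mem x _⟩

theorem treeParent_le (x : Fin n₁) : treeParent x ≤ x := Nat.sub_le _ _

theorem tree_suffix {i : Fin n₁} {l : List (Fin n₁)}
    (h : i :: l <:+ (List.finRange n₁).filter fun x => x.val ≠ 0) :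
    i.val ≠ 0 ∧ ∀ j ∈ l, i < j := by
  have h1 := List.mem_filter.1 (h.mem List.mem_cons_self)
  have h2 : ((List.finRange n₁).filter fun x => x.val ≠ 0).Pairwise (· < ·) :=
    (List.pairwise_lt_finRange n₁).filter _
  exact ⟨by simpa using h1.2, (List.pairwise_cons.1 (h2.sublist h.sublist)).1⟩

/-- A qubit copies its error to its parent, and two full columns form a stabilizer. The gate of a
non-root parent precedes those of its children, so backwards the parent still carries its full
column when a child is treated. -/
theorem passes_hook_tree (b : Basis) (fl : Fin n₁ → Flagged n₁ n₂) (ck : Flagged n₁ n₂)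
    (ra rf : Fin n₂ → Flagged n₁ n₂) :
    Passes b (hookEffects n₁ n₂) (hookGauge n₁ n₂)
      (((List.finRange n₁).filter (fun x => x.val ≠ 0)).map
        (fun x => couple b (.anc x) (.anc (treeParent x))))
      (table (fun x y => colErr x {y}) (fun x => colErr x Finset.univ) fl ck ra rf)
      (table (fun x y => colErr x {y}) (fun x => if x.val = 0 then colErr x Finset.univ else
        colErr x Finset.univ + colErr (treeParent x) Finset.univ) fl ck ra rf) := by
  have := Passes.map_suffix (a := b) (E := hookEffects n₁ n₂) (G := hookGauge n₁ n₂)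
    (fun x => couple b (.anc x) (.anc (treeParent x)))
    (fun l => table (fun x y => colErr x {y}) (fun x => if x ∈ l then
      colErr x Finset.univ + colErr (treeParent x) Finset.univ else colErr x Finset.univ)
      fl ck ra rf) ((List.finRange n₁).filter (fun x => x.val ≠ 0)) fun x l hs => ?_
  · convert this using 2
    · simp
    · ext1 x
      by_cases h : x.val = 0 <;> simp [h]
  · obtain ⟨-, hlt⟩ := tree_suffix hs
    have hx : x ∉ l := fun h => lt_irrefl _ (hlt x h)
    have hp : treeParent x ∉ l := fun h => (hlt _ h).not_ge (treeParent_le x)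
    refine ⟨?_, ?_⟩
    · simp [tameAt_couple, table, hx, hp, colErr_univ_mem,
        hookGauge_subset (colErr_add_colErr_mem _ _)]
    · rw [back_couple, update_table_anc]
      refine table_congr (fun _ _ => rfl) (fun x' => ?_) (fun _ => rfl) rfl (fun _ => rfl)
        (fun _ => rfl)
      by_cases h' : x' = x <;> simp [h', hx, hp, table]

theorem passes_hook_preparation {k : ℕ} (b : Basis) (fl : Fin (k + 2) → Flagged (k + 2) n₂)
    (ra rf : Fin n₂ → Flagged (k + 2) n₂) :
    Passes b (hookEffects (k + 2) n₂) (hookGauge (k + 2) n₂) (ancillaPreparation (k + 2) n₂ b)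
      (table (fun x y => colErr x {y}) (fun x => colErr x Finset.univ) fl 0 ra rf)
      (table (fun x y => colErr x {y}) (fun _ => 0) fl 0 ra rf) := by
  have h0 : (0 : Flagged (k + 2) n₂) ∈ hookEffects (k + 2) n₂ := zero_mem_hookEffects
  have hc := fun x x' => colErr_add_colErr_mem (n₁ := k + 2) (n₂ := n₂) x x'
  refine Passes.append ?_ ((Passes.nil _).cons_eq (i := .meas b Qubit.check) ?_ rfl)
  · rw [finRange_filter_ends]
    refine Passes.append (S' := table (fun x y => colErr x {y}) (fun x => colErr x Finset.univ) fl
      (colErr (Fin.last (k + 1)) Finset.univ + colErr (Fin.last k).castSucc Finset.univ) ra rf) ?_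
      (((Passes.nil _).cons_eq ?_ (back_couple _ _ _ _)).cons_eq ?_ ?_)
    · refine Passes.append ?_ ((Passes.nil _).cons_eq (i := .prep b Qubit.check) ?_ rfl)
      · simp only [back, update_table_check]
        refine Passes.append ?_ (passes_hook_tree b fl 0 ra rf)
        refine passes_prep_anc _ (fun x => ?_) fun x hx => ?_
        · split_ifs
          · exact colErr_univ_mem x
          · exact hookGauge_subset (hc _ _)
        -- The root is prepared in the dual basis and has no freedom of type `b`; the freedom of any
        -- other qubit is a pair of columns.
        · split_ifs at hx ⊢ with h
          · exact absurd hx.symm b.dual_ne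
          · exact hc _ _
      · exact ⟨hookGauge_subset (hc _ _), fun _ => hc _ _⟩
    · simp [tameAt_couple, back_meas, table, h0, colErr_univ_mem]
    · simp [tameAt_couple, back_meas, table, update_table_check, colErr_univ_mem,
        hookGauge_subset (hc _ _)]
    · simp [back_couple, back_meas, update_table_check, table]
  · simp [TameAt, table, h0]

/-- The sensitivities of the errors and of the hook flags. -/
theorem passes_hook {k : ℕ} (b : Basis) :
    Passes b (hookEffects (k + 2) n₂) (hookGauge (k + 2) n₂) (extraction (k + 2) n₂ b)
      (table (fun x y => colErr x {y}) (fun _ => 0) (fun x => colHook x ∅) 0 (fun _ => 0)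
        (fun y => rowHook ∅ y))
      (table (fun x y => colErr x {y}) (fun _ => 0) (fun _ => 0) 0 (fun _ => 0) (fun _ => 0)) :=
  ((passes_hook_preparation b _ _ _).append (passes_hook_high b _ _ _)).append
    (passes_hook_rows b _ _ _)

theorem sum_smul_vString (e : Grid n₁ n₂) : ∑ x, ∑ y, e x y • (vString x {y} : Grid n₁ n₂) = e := by
  ext i j
  simp [Finset.sum_apply, vString, ite_and]

/-- The data frame at the beginning of a half cycle. -/
def dataFrame (e : Grid n₁ n₂) : Qubit n₁ n₂ → ZMod 2
  | .data x y => e x y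
  | _ => 0

/-- The final table of `passes_hook` pairs with the frame to the data error and the two flag
records; the initial table sees only the data. -/
theorem hook_half {k : ℕ} {b : Basis} {L : List (Instr (Qubit (k + 2) n₂) × Event)}
    (hL : L.map Prod.fst = extraction (k + 2) n₂ b) (s : RunState (Qubit (k + 2) n₂))
    {e : Grid (k + 2) n₂} (hs : s.frame b = dataFrame e) :
    ∃ g ∈ hookGauge (k + 2) n₂, ∃ es : List (Flagged (k + 2) n₂), es.length ≤ faults L ∧
      (∀ m ∈ es, m ∈ hookEffects (k + 2) n₂) ∧
      ((fun x y => (run L s).frame b (.data x y), fun x => (run L s).record (.flag x),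
        fun y => (run L s).record (.rowFlag y)) : Flagged (k + 2) n₂) =
      (e, 0, 0) + g + es.sum := by
  obtain ⟨g, hg, es, hlen, hes, heq⟩ := exists_effects (hL ▸ passes_hook b) s
  refine ⟨g, hg, es, hlen, hes, ?_⟩
  have hfl : ∀ x, (run L s).record (.flag x) = (run L s).frame b (.flag x) := fun x => by
    rw [(hL ▸ endsMeasured_flag b x : EndsMeasured _ _ (L.map Prod.fst)).record_eq, b.dual_dual]
  have hrf : ∀ y, (run L s).record (.rowFlag y) = (run L s).frame b (.rowFlag y) := fun y => by
    rw [(hL ▸ endsMeasured_rowFlag b y : EndsMeasured _ _ (L.map Prod.fst)).record_eq, b.dual_dual]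
  have hpair : ∀ f : Qubit (k + 2) n₂ → ZMod 2, pairing (table (fun x y => colErr x {y})
      (fun _ => 0) (fun x => colHook x ∅) 0 (fun _ => 0) (fun y => rowHook ∅ y)) f =
      ((fun x y => f (.data x y), fun x => f (.flag x), fun y => f (.rowFlag y)) :
        Flagged (k + 2) n₂) := fun f => by
    rw [pairing_table]
    refine Prod.ext ?_ (Prod.ext ?_ ?_)
    · simpa [Prod.fst_sum, colErr, colHook, rowHook, vString_empty, hString_empty] using
        sum_smul_vString fun x y => f (.data x y)
    · ext x
      simp [Prod.fst_sum, Prod.snd_sum, colErr, colHook, rowHook, Pi.single_apply]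
    · ext y
      simp [Prod.snd_sum, colErr, colHook, rowHook, Pi.single_apply]
  have hpair0 : pairing (table (fun x y => colErr x {y}) (fun _ => 0) (fun _ => 0) 0 (fun _ => 0)
      (fun _ => 0)) (dataFrame e) = ((e, 0, 0) : Flagged (k + 2) n₂) := by
    rw [pairing_table]
    refine Prod.ext ?_ (Prod.ext ?_ ?_)
    · simpa [Prod.fst_sum, colErr, dataFrame] using sum_smul_vString e
    · simp [Prod.snd_sum, colErr]
    · simp [Prod.snd_sum, colErr]
  rw [hpair, hs, hpair0] at heq
  simp only [hfl, hrf, heq]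

end Hook

/-! ### Effects of faults on the errors being detected -/

section Detect

variable {n₁ n₂ : ℕ}

/-- For tables known only through an invariant: the high-level flips accumulated in the tree are not
needed in closed form. -/
theorem Passes.map_invariant {Q ι M : Type} [DecidableEq Q] [AddCommGroup M] [Module (ZMod 2) M]
    {a : Basis} {E : Set M} {G : Submodule (ZMod 2) M} (f : ι → Instr Q)
    (P : List ι → (Q → M) → Prop) (l : List ι) {S : Q → M} (h0 : P [] S)
    (h : ∀ i l' S', i :: l' <:+ l → P l' S' →
      TameAt a E G (f i) S' ∧ P (i :: l') (back a (f i) S')) :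
    ∃ S', P l S' ∧ Passes a E G (l.map f) S S' := by
  induction l with
  | nil => exact ⟨S, h0, .nil S⟩
  | cons i l ih =>
    obtain ⟨S', hP, hS'⟩ := ih fun j l' S' hl => h j l' S' (hl.trans (List.suffix_cons i l))
    obtain ⟨ht, hP'⟩ := h i l S' List.suffix_rfl hP
    exact ⟨_, hP', .cons ht hS'⟩

/-- An error, with the flips of the verification of the high-level ancilla, of the high-level
outcomes, and of the low-level outcomes. -/
abbrev Observed (n₁ n₂ : ℕ) := Grid n₁ n₂ × ZMod 2 × (Fin n₁ → ZMod 2) × (Fin n₂ → ZMod 2)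

/-- The effects of a single fault on the errors that are detected in a half cycle. A data error is
seen by both kinds of stabilizers if it occurs early, and by none if it occurs late. -/
inductive IsDetectEffect : Observed n₁ n₂ → Prop
  | gauge (t : ZMod 2) : IsDetectEffect (0, 0, fun _ => t, 0)
  | high (x) : IsDetectEffect (0, 0, Pi.single x 1, 0)
  | low (y) : IsDetectEffect (0, 0, 0, Pi.single y 1)
  | late (x y) : IsDetectEffect (vString x {y}, 0, 0, 0)
  | mid (x y) : IsDetectEffect (vString x {y}, 0, 0, Pi.single y 1)
  | early (x y) : IsDetectEffect (vString x {y}, 0, Pi.single x 1, Pi.single y 1)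
  | verify (h) : IsDetectEffect (0, 1, h, 0)

variable (n₁ n₂) in
/-- The set of effects of a single fault on the detected errors. -/
def detectEffects : Set (Observed n₁ n₂) := {m | IsDetectEffect m}

variable (n₁ n₂) in
/-- Complementation of the high-level outcomes. -/
def detectGauge : Submodule (ZMod 2) (Observed n₁ n₂) :=
  Submodule.span (ZMod 2) {(0, 0, fun _ => 1, 0)}

/-- A data error. -/
def dataFlip (x : Fin n₁) (y : Fin n₂) : Observed n₁ n₂ := (vString x {y}, 0, 0, 0)

/-- The flip of a high-level outcome. -/
def highFlip (x : Fin n₁) : Observed n₁ n₂ := (0, 0, Pi.single x 1, 0)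

/-- The flip of a low-level outcome. -/
def lowFlip (y : Fin n₂) : Observed n₁ n₂ := (0, 0, 0, Pi.single y 1)

/-- The flip of the outcome of the verification. -/
def checkFlip : Observed n₁ n₂ := (0, 1, 0, 0)

theorem zero_mem_detectEffects : (0 : Observed n₁ n₂) ∈ detectEffects n₁ n₂ := .gauge 0

theorem dataFlip_mem (x : Fin n₁) (y : Fin n₂) : dataFlip x y ∈ detectEffects n₁ n₂ := .late x y

theorem highFlip_mem (x : Fin n₁) : highFlip x ∈ detectEffects n₁ n₂ := .high x

theorem lowFlip_mem (y : Fin n₂) : lowFlip y ∈ detectEffects n₁ n₂ := .low y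

theorem checkFlip_mem : checkFlip ∈ detectEffects n₁ n₂ := .verify 0

theorem midFlip_mem (x : Fin n₁) (y : Fin n₂) :
    dataFlip x y + lowFlip y ∈ detectEffects n₁ n₂ := by
  simpa [detectEffects, dataFlip, lowFlip] using IsDetectEffect.mid x y

theorem earlyFlip_mem (x : Fin n₁) (y : Fin n₂) :
    dataFlip x y + lowFlip y + highFlip x ∈ detectEffects n₁ n₂ := by
  simpa [detectEffects, dataFlip, lowFlip, highFlip] using IsDetectEffect.early x y

theorem lowFlip_add_self (y : Fin n₂) : (lowFlip y + lowFlip y : Observed n₁ n₂) = 0 := by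
  simp [lowFlip, single_add_single]

theorem highFlip_add_self (x : Fin n₁) : (highFlip x + highFlip x : Observed n₁ n₂) = 0 := by
  simp [highFlip, single_add_single]

/-- Between the two CX gates an error of the dual type on the flag also flips the row outcome, so
data coupled to either qubit are measured. Before the first gate the two contributions cancel, and
the preparation of the flag is harmless. -/
theorem passes_detect_row (b : Basis) (y : Fin n₂) (d : Fin n₁ → Fin n₂ → Observed n₁ n₂)
    (an fl : Fin n₁ → Observed n₁ n₂) (ck : Observed n₁ n₂) (ra : Fin n₂ → Observed n₁ n₂)
    (hd : ∀ x, d x y = dataFlip x y) (ha : ra y = lowFlip y) :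
    Passes b.dual (detectEffects n₁ n₂) (detectGauge n₁ n₂) (rowExtraction n₁ n₂ b y)
      (table d an fl ck ra (fun _ => 0))
      (table (fun x y' => if y' = y then dataFlip x y + lowFlip y else d x y') an fl ck
        (fun y' => if y' = y then 0 else ra y') (fun _ => 0)) := by
  have h0 : (0 : Observed n₁ n₂) ∈ detectEffects n₁ n₂ := zero_mem_detectEffects
  have h1 : Passes b.dual (detectEffects n₁ n₂) (detectGauge n₁ n₂)
      [couple b (.rowAnc y) (.rowFlag y), .meas b (.rowAnc y), .meas b.dual (.rowFlag y)]
      (table d an fl ck ra (fun _ => 0))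
      (table d an fl ck ra (fun y' => if y' = y then lowFlip y else 0)) := by
    refine (((Passes.nil _).cons_eq ?_ rfl).cons_eq ?_ rfl).cons_eq ?_ ?_
    · simp [TameAt, table, h0]
    · simp [TameAt, back, table, ha, lowFlip_mem]
    · simp [tameAt_couple, back_meas, table, ha, h0, lowFlip_mem]
    · rw [back_dual_couple]
      simp [back, table, ha, update_table_rowFlag]
  refine Passes.append ?_ h1
  refine Passes.append (S' := table (fun x y' => if y' = y then dataFlip x y + lowFlip y
    else d x y') an fl ck ra (fun y' => if y' = y then lowFlip y else 0)) ?_ ?_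
  · refine (((Passes.nil _).cons_eq ?_ (back_dual_couple _ _ _ _)).cons_eq ?_ rfl).cons_eq ?_ ?_
    · simp [tameAt_couple, table, ha, lowFlip_mem, lowFlip_add_self, h0]
    · simp [TameAt, table, ha, lowFlip_add_self, h0]
    · simp [TameAt, back, table, ha, lowFlip_mem, b.dual_ne]
    · simp only [back, table, update_table_rowAnc, update_table_rowFlag]
      refine table_congr (fun _ _ => rfl) (fun _ => rfl) (fun _ => rfl) rfl (fun y' => rfl)
        (fun y' => ?_)
      by_cases h' : y' = y <;> simp [h']
  · have := Passes.map (a := b.dual) (E := detectEffects n₁ n₂) (G := detectGauge n₁ n₂)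
      (fun x => couple b (if Even x.val then .rowAnc y else .rowFlag y) (.data x y))
      (fun l => table (fun x y' => if x ∈ l ∧ y' = y then dataFlip x y + lowFlip y else d x y')
        an fl ck ra (fun y' => if y' = y then lowFlip y else 0))
      (List.nodup_finRange n₁) fun x l hx => ⟨?_, ?_⟩
    · simpa using this
    · split_ifs <;> simp [tameAt_couple, table, ha, hx, hd, lowFlip_mem, dataFlip_mem,
        add_comm (lowFlip _), midFlip_mem]
    · rw [back_dual_couple, update_table_data]
      refine table_congr (fun x' y' => ?_) (fun _ => rfl) (fun _ => rfl) rfl (fun _ => rfl)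
        (fun _ => rfl)
      by_cases hx' : x' = x <;> by_cases hy' : y' = y <;> split_ifs <;>
        simp_all [table]

theorem passes_detect_rows (b : Basis) (an fl : Fin n₁ → Observed n₁ n₂) (ck : Observed n₁ n₂) :
    Passes b.dual (detectEffects n₁ n₂) (detectGauge n₁ n₂)
      ((List.finRange n₂).flatMap (rowExtraction n₁ n₂ b))
      (table dataFlip an fl ck lowFlip (fun _ => 0))
      (table (fun x y => dataFlip x y + lowFlip y) an fl ck (fun _ => 0) (fun _ => 0)) := by
  have := Passes.flatMap (a := b.dual) (E := detectEffects n₁ n₂) (G := detectGauge n₁ n₂)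
    (rowExtraction n₁ n₂ b)
    (fun l => table (fun x y => if y ∈ l then dataFlip x y + lowFlip y else dataFlip x y)
      an fl ck (fun y => if y ∈ l then 0 else lowFlip y) (fun _ => 0))
    (List.nodup_finRange n₂) fun y l hy => ?_
  · simpa using this
  · convert passes_detect_row b y
      (fun x y => if y ∈ l then dataFlip x y + lowFlip y else dataFlip x y) an fl ck
      (fun y => if y ∈ l then 0 else lowFlip y) (fun x => if_neg hy) (if_neg hy) using 2
    · ext1 x
      ext1 y'
      by_cases h' : y' = y <;> simp [h']
    · ext1 y'
      by_cases h' : y' = y <;> simp [h']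

/-- The coupling of one row to the high-level ancilla and its flags. -/
theorem passes_detect_couple_row (b : Basis) (y : Fin n₂) (d : Fin n₁ → Fin n₂ → Observed n₁ n₂)
    (ck : Observed n₁ n₂) (ra rf : Fin n₂ → Observed n₁ n₂)
    (hd : ∀ x, d x y = dataFlip x y + lowFlip y) :
    Passes b.dual (detectEffects n₁ n₂) (detectGauge n₁ n₂)
      ((List.finRange n₁).map fun x =>
        couple b (if Even y.val then .anc x else .flag x) (.data x y))
      (table d highFlip highFlip ck ra rf)
      (table (fun x y' => if y' = y then dataFlip x y + lowFlip y + highFlip x else d x y')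
        highFlip highFlip ck ra rf) := by
  have := Passes.map (a := b.dual) (E := detectEffects n₁ n₂) (G := detectGauge n₁ n₂)
    (fun x => couple b (if Even y.val then .anc x else .flag x) (.data x y))
    (fun l => table (fun x y' => if x ∈ l ∧ y' = y then dataFlip x y + lowFlip y + highFlip x
      else d x y') highFlip highFlip ck ra rf)
    (List.nodup_finRange n₁) fun x l hx => ⟨?_, ?_⟩
  · simpa using this
  · split_ifs <;> simp [tameAt_couple, table, hx, hd, highFlip_mem, midFlip_mem,
      add_comm (highFlip _), earlyFlip_mem]
  · rw [back_dual_couple, update_table_data]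
    refine table_congr (fun x' y' => ?_) (fun _ => rfl) (fun _ => rfl) rfl (fun _ => rfl)
      (fun _ => rfl)
    by_cases hx' : x' = x <;> by_cases hy' : y' = y <;> split_ifs <;> simp_all [table]

/-- The mechanism of `passes_detect_row`, with one pair of ancilla and flag per column. Data errors
ahead of this layer flip both a high-level and a low-level outcome. -/
theorem passes_detect_high (b : Basis) (ck : Observed n₁ n₂) (ra rf : Fin n₂ → Observed n₁ n₂) :
    Passes b.dual (detectEffects n₁ n₂) (detectGauge n₁ n₂) (highExtraction n₁ n₂ b)
      (table (fun x y => dataFlip x y + lowFlip y) highFlip (fun _ => 0) ck ra rf)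
      (table (fun x y => dataFlip x y + lowFlip y + highFlip x) highFlip (fun _ => 0) ck ra rf) := by
  have h0 : (0 : Observed n₁ n₂) ∈ detectEffects n₁ n₂ := zero_mem_detectEffects
  refine Passes.append ?_ (passes_meas_flag fun x => h0)
  refine Passes.append ?_ (passes_meas_anc fun x => highFlip_mem x)
  refine Passes.append ?_ (passes_couple_anc_flag_dual fun x => ?_)
  · simp only [zero_add]
    refine Passes.append (S' := table (fun x y => dataFlip x y + lowFlip y + highFlip x)
      highFlip highFlip ck ra rf) ?_ ?_
    · refine Passes.append ?_ (passes_couple_anc_flag_dual fun x => ?_)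
      · simp only [highFlip_add_self]
        exact passes_prep_flag (fun x => h0) fun _ x => Submodule.zero_mem _
      · rw [highFlip_add_self]
        exact ⟨highFlip_mem x, highFlip_mem x, h0⟩
    · have := Passes.flatMap (a := b.dual) (E := detectEffects n₁ n₂) (G := detectGauge n₁ n₂)
        (fun y => (List.finRange n₁).map fun x =>
          couple b (if Even y.val then .anc x else .flag x) (.data x y))
        (fun l => table (fun x y => if y ∈ l then dataFlip x y + lowFlip y + highFlip x
          else dataFlip x y + lowFlip y) highFlip highFlip ck ra rf)
        (List.nodup_finRange n₂) fun y l hy => ?_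
      · simpa using this
      · convert passes_detect_couple_row b y
          (fun x y => if y ∈ l then dataFlip x y + lowFlip y + highFlip x
            else dataFlip x y + lowFlip y) ck ra rf (fun x => if_neg hy) using 2
        ext1 x
        ext1 y'
        by_cases h' : y' = y <;> simp [h']
  · rw [add_zero]
    exact ⟨highFlip_mem x, h0, highFlip_mem x⟩

/-- The verification outcome is flipped, and no errors or low-level outcomes. -/
def IsVerifyFlip (m : Observed n₁ n₂) : Prop := ∃ h, m = (0, 1, h, 0)

theorem IsVerifyFlip.mem {m : Observed n₁ n₂} (h : IsVerifyFlip m) : m ∈ detectEffects n₁ n₂ := by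
  obtain ⟨h, rfl⟩ := h
  exact .verify h

theorem IsVerifyFlip.highFlip_add {m : Observed n₁ n₂} (h : IsVerifyFlip m) (x : Fin n₁) :
    IsVerifyFlip (highFlip x + m) := by
  obtain ⟨h, rfl⟩ := h
  exact ⟨Pi.single x 1 + h, by simp [highFlip]⟩

theorem isVerifyFlip_checkFlip : IsVerifyFlip (checkFlip : Observed n₁ n₂) := ⟨0, rfl⟩

/-- The list is increasing, so the remaining gates are exactly those of larger qubits; this turns
suffixes into the threshold of `IsTreeTable`. -/
theorem tree_suffix_mem {i : Fin n₁} {l : List (Fin n₁)}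
    (h : i :: l <:+ (List.finRange n₁).filter fun x => x.val ≠ 0) (j : Fin n₁) :
    j ∈ l ↔ i < j := by
  refine ⟨(tree_suffix h).2 j, fun hj => ?_⟩
  have h2 : ((List.finRange n₁).filter fun x => x.val ≠ 0).Pairwise (· < ·) :=
    (List.pairwise_lt_finRange n₁).filter _
  have hmem : j ∈ (List.finRange n₁).filter fun x => x.val ≠ 0 := by
    have : i.val < j.val := hj
    simp only [ne_eq, decide_not, List.mem_filter, List.mem_finRange, true_and,
      Bool.not_eq_eq_eq_not, Bool.not_true, decide_eq_false_iff_not]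
    omega
  obtain ⟨l', hl'⟩ := h
  rw [← hl'] at h2 hmem
  rcases List.mem_append.1 hmem with hm | hm
  · exact absurd ((List.pairwise_append.1 h2).2.2 j hm i List.mem_cons_self) hj.not_gt
  · exact (List.mem_cons.1 hm).resolve_left hj.ne'

theorem sum_add_ite {ι M : Type} [DecidableEq ι] [AddCommMonoid M] (s : Finset ι) (f : ι → M)
    {p : ι} (hp : p ∈ s) (v : M) : ∑ j ∈ s, (if j = p then f p + v else f j) = ∑ j ∈ s, f j + v := by
  have : ∀ j, (if j = p then f p + v else f j) = f j + if j = p then v else 0 := fun j => by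
    by_cases h : j = p <;> simp [h]
  simp [this, Finset.sum_add_distrib, hp]

/-- The sensitivities of the high-level ancilla inside the tree, with the gates of the qubits beyond
`t` ahead. -/
structure IsTreeTable (an : Fin n₁ → Observed n₁ n₂) (t : ℕ) : Prop where
  inner : ∀ j, j.val ≠ 0 → j.val + 2 ≤ t → an j = highFlip j
  outer : ∀ j, j.val ≠ 0 → t < j.val + 2 → IsVerifyFlip (an j)
  root : ∀ j, j.val = 0 → 2 ≤ t → an j = highFlip j
  root_one : ∀ j, j.val = 0 → t = 1 → IsVerifyFlip (an j)
  sum : ∑ j with j.val ≤ t, an j = (0, 0, fun _ => 1, 0)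

/-- Going back past the gate of `i`, the parent inherits the flips of `i`, with that of the
verification. The sum is preserved: `i` leaves the range, and its value moves to the parent. -/
theorem IsTreeTable.step {an : Fin n₁ → Observed n₁ n₂} {i : Fin n₁} (h : IsTreeTable an i.val)
    (hi : i.val ≠ 0) :
    IsTreeTable (fun x => if x = treeParent i then an (treeParent i) + an i else an x)
      (i.val - 1) := by
  have hpv : (treeParent i).val = i.val - 2 := rfl
  have hii := h.outer i hi (by omega)
  refine ⟨fun j hj hj2 => ?_, fun j hj hj2 => ?_, fun j hj hj2 => ?_, fun j hj hj2 => ?_, ?_⟩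
  · rw [if_neg fun h' => by rw [h'] at hj hj2; omega]
    exact h.inner j hj (by omega)
  · split_ifs with h'
    · rw [h'] at hj
      rw [h.inner (treeParent i) hj (by omega)]
      exact hii.highFlip_add _
    · have : j.val ≠ i.val - 2 := fun h2 => h' (Fin.ext h2)
      exact h.outer j hj (by omega)
  · rw [if_neg fun h' => by rw [h'] at hj; omega]
    exact h.root j hj (by omega)
  · obtain rfl : j = treeParent i := Fin.ext (by omega)
    rw [if_pos rfl, h.root _ hj (by omega)]
    exact hii.highFlip_add _
  · rw [sum_add_ite _ _ (by simp; omega), ← h.sum]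
    have : (Finset.univ.filter fun j : Fin n₁ => j.val ≤ i.val) =
        insert i (Finset.univ.filter fun j : Fin n₁ => j.val ≤ i.val - 1) := by
      ext j
      simp only [Finset.mem_filter_univ, Finset.mem_insert, Fin.ext_iff]
      omega
    rw [this, Finset.sum_insert (by simp; omega), add_comm]

/-- All three effects are single outcomes or carry the verification flip, except for the correlated
fault at the gate from qubit 1 to the root. There the branches meet, their verification flips
cancel, and all outcomes are complemented. -/
theorem IsTreeTable.tame {an : Fin n₁ → Observed n₁ n₂} {i : Fin n₁} (h : IsTreeTable an i.val)
    (hi : i.val ≠ 0) : an i ∈ detectEffects n₁ n₂ ∧ an (treeParent i) ∈ detectEffects n₁ n₂ ∧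
      an i + an (treeParent i) ∈ detectEffects n₁ n₂ := by
  have hpv : (treeParent i).val = i.val - 2 := rfl
  have hii := h.outer i hi (by omega)
  refine ⟨hii.mem, ?_⟩
  rw [add_comm]
  by_cases h1 : i.val = 1
  · refine ⟨(h.root_one _ (by omega) h1).mem, ?_⟩
    -- Only the root and qubit 1 remain in the sum, so it is the effect of the correlated fault.
    have hs := h.sum
    have : (Finset.univ.filter fun j : Fin n₁ => j.val ≤ i.val) = {treeParent i, i} := by
      ext j
      simp only [Finset.mem_filter_univ, Finset.mem_insert, Finset.mem_singleton, Fin.ext_iff]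
      omega
    rw [this, Finset.sum_pair fun h' => by rw [← h'] at hi; omega] at hs
    rw [hs]
    exact .gauge 1
  · have hp : an (treeParent i) = highFlip (treeParent i) := by
      by_cases h2 : i.val = 2
      · exact h.root _ (by omega) (by omega)
      · exact h.inner _ (by omega) (by omega)
    rw [hp]
    exact ⟨highFlip_mem _, (hii.highFlip_add _).mem⟩

/-- Backward induction in which the threshold of `IsTreeTable` is the qubit whose gate is treated
next. -/
theorem passes_detect_tree (b : Basis) (hn : 0 < n₁) (d : Fin n₁ → Fin n₂ → Observed n₁ n₂)
    (fl : Fin n₁ → Observed n₁ n₂) (ck : Observed n₁ n₂) (ra rf : Fin n₂ → Observed n₁ n₂)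
    {an : Fin n₁ → Observed n₁ n₂} (han : IsTreeTable an (n₁ - 1)) :
    ∃ an', IsTreeTable an' 0 ∧ Passes b.dual (detectEffects n₁ n₂) (detectGauge n₁ n₂)
      (((List.finRange n₁).filter (fun x => x.val ≠ 0)).map
        (fun x => couple b (.anc x) (.anc (treeParent x))))
      (table d an fl ck ra rf) (table d an' fl ck ra rf) := by
  have hpass : ∃ S', (∃ an t, t < n₁ ∧ (∀ j : Fin n₁,
      j ∈ (List.finRange n₁).filter (fun x => x.val ≠ 0) ↔ t < j.val) ∧
      S' = table d an fl ck ra rf ∧ IsTreeTable an t) ∧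
      Passes b.dual (detectEffects n₁ n₂) (detectGauge n₁ n₂)
        (((List.finRange n₁).filter (fun x => x.val ≠ 0)).map
          (fun x => couple b (.anc x) (.anc (treeParent x)))) (table d an fl ck ra rf) S' := by
    refine Passes.map_invariant (fun x => couple b (.anc x) (.anc (treeParent x)))
      (fun l S => ∃ an t, t < n₁ ∧ (∀ j : Fin n₁, j ∈ l ↔ t < j.val) ∧
        S = table d an fl ck ra rf ∧ IsTreeTable an t)
      _ ⟨an, n₁ - 1, by omega, fun j => by simp; omega, rfl, han⟩ ?_
    rintro i l _ hs ⟨an, t, ht, hmem, rfl, han⟩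
    obtain ⟨hi, -⟩ := tree_suffix hs
    have hl := tree_suffix_mem hs
    have hit : t = i.val := by
      have h1 := (hmem i).symm.trans (hl i)
      have h2 := (hmem ⟨t, ht⟩).symm.trans (hl ⟨t, ht⟩)
      simp only [lt_self_iff_false, iff_false, not_lt, Fin.lt_def, false_iff] at h1 h2
      omega
    subst hit
    refine ⟨tameAt_couple.2 (han.tame hi), _, i.val - 1, by omega, fun j => ?_, ?_, han.step hi⟩
    · rw [List.mem_cons, hl, Fin.ext_iff, Fin.lt_def]
      omega
    · rw [back_dual_couple, update_table_anc]
      rfl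
  obtain ⟨S', ⟨an', t, ht, hmem, rfl, han'⟩, hpass⟩ := hpass
  -- Otherwise the gate of qubit `t` would be in the full list, but not among those beyond `t`.
  obtain rfl : t = 0 := by
    by_contra h
    have := hmem ⟨t, ht⟩
    simp [h] at this
  exact ⟨an', han', hpass⟩

/-- The verification reads one end of each branch. A flip inside a branch reaches only one end and
is announced; a flip prepared at the root reaches both, unannounced, but merely complements all
outcomes. -/
theorem passes_detect_preparation {k : ℕ} (hk : 0 < k) (b : Basis)
    (d : Fin (k + 2) → Fin n₂ → Observed (k + 2) n₂) (fl : Fin (k + 2) → Observed (k + 2) n₂)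
    (ra rf : Fin n₂ → Observed (k + 2) n₂) :
    Passes b.dual (detectEffects (k + 2) n₂) (detectGauge (k + 2) n₂)
      (ancillaPreparation (k + 2) n₂ b)
      (table d highFlip fl checkFlip ra rf) (table d (fun _ => 0) fl 0 ra rf) := by
  set an : Fin (k + 2) → Observed (k + 2) n₂ :=
    fun x => if k + 2 ≤ x.val + 2 then highFlip x + checkFlip else highFlip x with han
  have hv : ∀ x : Fin (k + 2), IsVerifyFlip (highFlip x + checkFlip : Observed (k + 2) n₂) :=
    fun x => isVerifyFlip_checkFlip.highFlip_add x
  have htree : IsTreeTable an (k + 2 - 1) := by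
    -- `0 < k` separates the root from the two verified ends and makes the initial threshold at
    -- least two.
    refine ⟨fun j hj hj2 => if_neg (by omega), fun j hj hj2 => ?_,
      fun j hj hj2 => if_neg (by omega), fun j hj hj2 => by omega, ?_⟩
    · rw [han]
      simp only
      rw [if_pos (by omega)]
      exact hv j
    · have h1 : ∀ j, an j = highFlip j + if k + 2 ≤ j.val + 2 then checkFlip else 0 := fun j => by
        by_cases h : k + 2 ≤ j.val + 2 <;> simp only [han, h, if_true, if_false, add_zero]
      have h2 : (Finset.univ.filter fun j : Fin (k + 2) => j.val ≤ k + 2 - 1) = Finset.univ :=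
        Finset.filter_true_of_mem fun j _ => by omega
      -- Exactly two ends are verified, and their flips cancel modulo two.
      have h3 : (∑ j : Fin (k + 2), if k + 2 ≤ j.val + 2 then
          (checkFlip : Observed (k + 2) n₂) else 0) = 0 := by
        rw [Fin.sum_univ_castSucc, Fin.sum_univ_castSucc]
        have : ∀ j : Fin k, ¬ k ≤ j.val := fun j => by omega
        simp [this, checkFlip, CharTwo.add_self_eq_zero]
      rw [h2, Finset.sum_congr rfl fun j _ => h1 j, Finset.sum_add_distrib, h3, add_zero]
      refine Prod.ext (by simp [highFlip, Prod.fst_sum]) (Prod.ext ?_ (Prod.ext ?_ ?_))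
      · simp [highFlip, Prod.fst_sum, Prod.snd_sum]
      · ext x
        simp [highFlip, Prod.fst_sum, Prod.snd_sum, Finset.sum_apply, Pi.single_apply]
      · simp [highFlip, Prod.snd_sum]
  obtain ⟨an', han', hpass⟩ := passes_detect_tree b (by omega) d fl 0 ra rf htree
  -- At threshold zero the sum consists of the root alone.
  have hroot : ∀ x, x.val = 0 → an' x = (0, 0, fun _ => 1, 0) := fun x hx => by
    rw [← han'.sum, Finset.sum_eq_single x]
    · intro j hj hjx
      exact absurd (Fin.ext (by rw [Finset.mem_filter_univ] at hj; omega)) hjx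
    · exact fun h => absurd (Finset.mem_filter_univ x |>.2 hx.le) h
  refine Passes.append (S' := table d highFlip fl checkFlip ra rf) ?_
    ((Passes.nil _).cons_eq (i := .meas b Qubit.check) checkFlip_mem rfl)
  refine Passes.append (S' := table d an fl checkFlip ra rf) ?_ ?_
  · refine Passes.append (S' := table d an fl 0 ra rf) ?_
      ((Passes.nil _).cons_eq (i := .prep b Qubit.check) ⟨checkFlip_mem, fun h => ?_⟩ ?_)
    · refine Passes.append ?_ hpass
      refine passes_prep_anc _ (fun x => ?_) fun x hx => ?_
      · by_cases h : x.val = 0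
        · rw [hroot x h]
          exact .gauge 1
        · exact (han'.outer x h (by omega)).mem
      · split_ifs at hx with h
        · rw [hroot x h]
          exact Submodule.mem_span_singleton_self _
        · exact absurd hx b.dual_ne
    · exact absurd h b.dual_ne
    · simp only [back, update_table_check]
  · have := Passes.map (a := b.dual) (E := detectEffects (k + 2) n₂) (G := detectGauge (k + 2) n₂)
      (fun x => couple b .check (.anc x))
      (fun l => table d (fun x => if x ∈ l then highFlip x + checkFlip else highFlip x)
        fl checkFlip ra rf)
      ((List.nodup_finRange (k + 2)).filter (fun x => k + 2 ≤ x.val + 2)) fun x l hx => ⟨?_, ?_⟩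
    · simpa [han] using this
    · simp [tameAt_couple, table, hx, checkFlip_mem, highFlip_mem, add_comm checkFlip,
        (hv x).mem]
    · rw [back_dual_couple, update_table_anc]
      refine table_congr (fun _ _ => rfl) (fun x' => ?_) (fun _ => rfl) rfl (fun _ => rfl)
        (fun _ => rfl)
      by_cases h' : x' = x <;> simp [h', hx, table]

/-- The sensitivities of the errors and of the syndromes. -/
theorem passes_detect {k : ℕ} (hk : 0 < k) (b : Basis) :
    Passes b.dual (detectEffects (k + 2) n₂) (detectGauge (k + 2) n₂) (extraction (k + 2) n₂ b)
      (table dataFlip highFlip (fun _ => 0) checkFlip lowFlip (fun _ => 0))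
      (table (fun x y => dataFlip x y + lowFlip y + highFlip x) (fun _ => 0) (fun _ => 0) 0
        (fun _ => 0) (fun _ => 0)) :=
  ((passes_detect_preparation hk b _ _ _ _).append (passes_detect_high b _ _ _)).append
    (passes_detect_rows b _ _ _)

/-- The parities of the columns. -/
def colSum (e : Grid n₁ n₂) : Fin n₁ → ZMod 2 := fun x => ∑ y, e x y

/-- The parities of the rows. -/
def rowSum (e : Grid n₁ n₂) : Fin n₂ → ZMod 2 := fun y => ∑ x, e x y

/-- The constant `t` comes from the random frame of the root; because of it only relative high-level
outcomes are meaningful. -/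
theorem detect_half {k : ℕ} (hk : 0 < k) {b : Basis}
    {L : List (Instr (Qubit (k + 2) n₂) × Event)}
    (hL : L.map Prod.fst = extraction (k + 2) n₂ b) (s : RunState (Qubit (k + 2) n₂))
    {e : Grid (k + 2) n₂} (hs : s.frame b.dual = dataFrame e) :
    ∃ t : ZMod 2, ∃ es : List (Observed (k + 2) n₂), es.length ≤ faults L ∧
      (∀ m ∈ es, IsDetectEffect m) ∧
      ((fun x y => (run L s).frame b.dual (.data x y), (run L s).record .check,
        fun x => (run L s).record (.anc x), fun y => (run L s).record (.rowAnc y)) :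
          Observed (k + 2) n₂) =
      (e, 0, colSum e, rowSum e) + (0, 0, fun _ => t, 0) + es.sum := by
  obtain ⟨g, hg, es, hlen, hes, heq⟩ := exists_effects (hL ▸ passes_detect hk b) s
  obtain ⟨t, rfl⟩ := Submodule.mem_span_singleton.1 hg
  refine ⟨t, es, hlen, hes, ?_⟩
  have hck : (run L s).record .check = (run L s).frame b.dual .check :=
    (hL ▸ endsMeasured_check b : EndsMeasured _ _ (L.map Prod.fst)).record_eq s
  have han : ∀ x, (run L s).record (.anc x) = (run L s).frame b.dual (.anc x) := fun x =>
    (hL ▸ endsMeasured_anc b x : EndsMeasured _ _ (L.map Prod.fst)).record_eq s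
  have hra : ∀ y, (run L s).record (.rowAnc y) = (run L s).frame b.dual (.rowAnc y) := fun y =>
    (hL ▸ endsMeasured_rowAnc b y : EndsMeasured _ _ (L.map Prod.fst)).record_eq s
  have hpair : ∀ f : Qubit (k + 2) n₂ → ZMod 2, pairing (table dataFlip highFlip (fun _ => 0)
      checkFlip lowFlip (fun _ => 0)) f =
      ((fun x y => f (.data x y), f .check, fun x => f (.anc x), fun y => f (.rowAnc y)) :
        Observed (k + 2) n₂) := fun f => by
    rw [pairing_table]
    refine Prod.ext ?_ (Prod.ext ?_ (Prod.ext ?_ ?_))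
    · simpa [Prod.fst_sum, dataFlip, highFlip, lowFlip, checkFlip] using
        sum_smul_vString fun x y => f (.data x y)
    · simp [Prod.fst_sum, Prod.snd_sum, dataFlip, highFlip, lowFlip, checkFlip]
    · ext x
      simp [Prod.fst_sum, Prod.snd_sum, dataFlip, highFlip, lowFlip, checkFlip, Pi.single_apply]
    · ext y
      simp [Prod.snd_sum, dataFlip, highFlip, lowFlip, checkFlip, Pi.single_apply]
  have hpair0 : pairing (table (fun x y => dataFlip x y + lowFlip y + highFlip x) (fun _ => 0)
      (fun _ => 0) 0 (fun _ => 0) (fun _ => 0)) (dataFrame e) =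
      ((e, 0, colSum e, rowSum e) : Observed (k + 2) n₂) := by
    rw [pairing_table]
    refine Prod.ext ?_ (Prod.ext ?_ (Prod.ext ?_ ?_))
    · simpa [Prod.fst_sum, dataFlip, highFlip, lowFlip, dataFrame] using sum_smul_vString e
    · simp [Prod.fst_sum, Prod.snd_sum, dataFlip, highFlip, lowFlip]
    · ext x
      simp [Prod.fst_sum, Prod.snd_sum, dataFlip, highFlip, lowFlip, Pi.single_apply, dataFrame,
        colSum, Finset.sum_apply]
    · ext y
      simp [Prod.snd_sum, dataFlip, highFlip, lowFlip, Pi.single_apply, dataFrame,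
        rowSum, Finset.sum_apply]
  rw [hpair, hs, hpair0] at heq
  have ht : t • ((0, 0, fun _ => 1, 0) : Observed (k + 2) n₂) = (0, 0, fun _ => t, 0) := by
    refine Prod.ext (by simp) (Prod.ext (by simp) (Prod.ext ?_ (by simp)))
    ext x
    simp
  simp only [hck, han, hra, heq, ht]

end Detect

/-! ## Syndromes -/

/-- An even length, at least four. -/
class EvenLength (n : ℕ) : Prop where
  even : Even n
  four_le : 4 ≤ n

section Syndromes

variable {n₁ n₂ : ℕ}

/-- The indicator function of a set. -/
def ind {n : ℕ} (S : Finset (Fin n)) : Fin n → ZMod 2 := fun i => if i ∈ S then 1 else 0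

theorem ind_empty {n : ℕ} : ind (∅ : Finset (Fin n)) = 0 := by ext; simp [ind]

theorem ind_singleton {n : ℕ} (i : Fin n) : ind {i} = Pi.single i 1 := by
  ext j; simp [ind, Pi.single_apply]

theorem ind_add_ind {n : ℕ} (S T : Finset (Fin n)) : ind S + ind T = ind (symmDiff S T) :=
  funext fun i => ite_add_ite_symmDiff S T i

theorem ind_injective {n : ℕ} : Function.Injective (ind : Finset (Fin n) → Fin n → ZMod 2) := by
  intro S T h
  ext i
  have := congrFun h i
  by_cases hS : i ∈ S <;> by_cases hT : i ∈ T <;> simp_all [ind]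

theorem ind_compl {n : ℕ} (S : Finset (Fin n)) (i : Fin n) : ind Sᶜ i = ind S i + 1 := by
  by_cases h : i ∈ S <;> simp [ind, h]
  decide

theorem sum_ind {n : ℕ} (S : Finset (Fin n)) : ∑ i, ind S i = (S.card : ZMod 2) := by
  simp [ind]

theorem natCast_eq_zero_of_even {n : ℕ} (h : Even n) : (n : ZMod 2) = 0 :=
  (ZMod.natCast_eq_zero_iff_even).2 h

theorem sameError_symm {e e' : Grid n₁ n₂} (h : SameError e e') : SameError e' e := by
  simpa [SameError] using (stabilizers n₁ n₂).neg_mem h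

theorem sameError_trans {e e' e'' : Grid n₁ n₂} (h : SameError e e') (h' : SameError e' e'') :
    SameError e e'' := by
  simpa [SameError] using (stabilizers n₁ n₂).add_mem h h'

theorem sameError_add {e e' f f' : Grid n₁ n₂} (h : SameError e e') (h' : SameError f f') :
    SameError (e + f) (e' + f') := by
  simpa [SameError, add_sub_add_comm] using (stabilizers n₁ n₂).add_mem h h'

theorem sameError_zero {e : Grid n₁ n₂} : SameError e 0 ↔ e ∈ stabilizers n₁ n₂ := by
  simp [SameError]

theorem sameError_column (x x' : Fin n₁) :
    SameError (vString x Finset.univ : Grid n₁ n₂) (vString x' Finset.univ) := by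
  have h : (vString x Finset.univ - vString x' Finset.univ : Grid n₁ n₂) =
      vString x Finset.univ + vString x' Finset.univ := by
    ext i j; exact CharTwo.sub_eq_add _ _
  rw [SameError, h]
  exact columns_mem x x'

theorem sameError_row_compl (S : Finset (Fin n₁)) (y : Fin n₂) :
    SameError (hString S y) (hString Sᶜ y) := by
  have h : (hString S y - hString Sᶜ y : Grid n₁ n₂) = hString Finset.univ y := by
    ext i j
    by_cases h1 : i ∈ S <;> by_cases h2 : j = y <;> simp [hString, h1, h2]
  rw [SameError, h]
  exact hString_univ_mem y

theorem colSum_add (e f : Grid n₁ n₂) : colSum (e + f) = colSum e + colSum f := by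
  ext x; simp [colSum, Finset.sum_add_distrib]

theorem rowSum_add (e f : Grid n₁ n₂) : rowSum (e + f) = rowSum e + rowSum f := by
  ext x; simp [rowSum, Finset.sum_add_distrib]

theorem sum_colSum (e : Grid n₁ n₂) : ∑ x, colSum e x = ∑ y, rowSum e y := Finset.sum_comm

theorem colSum_vString (x : Fin n₁) (S : Finset (Fin n₂)) :
    colSum (vString x S) = ind (if Even S.card then ∅ else {x}) := by
  ext i
  by_cases hi : i = x
  · have : colSum (vString x S) i = S.card := by simp [colSum, vString, hi]
    rw [this]
    split_ifs with h
    · simp [ind, natCast_eq_zero_of_even h]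
    · simpa [ind, hi] using (ZMod.natCast_eq_one_iff_odd).2 (Nat.not_even_iff_odd.1 h)
  · split_ifs <;> simp [colSum, vString, ind, hi]

theorem rowSum_vString (x : Fin n₁) (S : Finset (Fin n₂)) : rowSum (vString x S) = ind S := by
  ext j
  by_cases hj : j ∈ S <;> simp [rowSum, vString, ind, hj]

theorem rowSum_hString (S : Finset (Fin n₁)) (y : Fin n₂) :
    rowSum (hString S y) = ind (if Even S.card then ∅ else {y}) := by
  ext j
  by_cases hj : j = y
  · have : rowSum (hString S y) j = S.card := by simp [rowSum, hString, hj]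
    rw [this]
    split_ifs with h
    · simp [ind, natCast_eq_zero_of_even h]
    · simpa [ind, hj] using (ZMod.natCast_eq_one_iff_odd).2 (Nat.not_even_iff_odd.1 h)
  · split_ifs <;> simp [rowSum, hString, ind, hj]

theorem colSum_hString (S : Finset (Fin n₁)) (y : Fin n₂) : colSum (hString S y) = ind S := by
  ext i
  by_cases hi : i ∈ S <;> simp [colSum, hString, ind, hi]

theorem colSum_zero : colSum (0 : Grid n₁ n₂) = 0 := by ext; simp [colSum]

theorem rowSum_zero : rowSum (0 : Grid n₁ n₂) = 0 := by ext; simp [rowSum]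

theorem colSum_single (x : Fin n₁) (y : Fin n₂) : colSum (vString x {y}) = Pi.single x 1 := by
  rw [colSum_vString, if_neg (by simp), ind_singleton]

theorem rowSum_single (x : Fin n₁) (y : Fin n₂) : rowSum (vString x {y}) = Pi.single y 1 := by
  rw [rowSum_vString, ind_singleton]

/-- The high-level coordinates `xs`, up to complement, and the low-level coordinates `ys` come from
outcomes `h` and `l`. -/
structure Syndrome (h : Fin n₁ → ZMod 2) (l : Fin n₂ → ZMod 2) (xs : Finset (Fin n₁))
    (ys : Finset (Fin n₂)) : Prop where
  card_le : 2 * xs.card ≤ n₁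
  high : ∃ t, ∀ x, ind xs x = h x + t
  low : ind ys = l

/-- The coordinates come from the ideal syndrome of `e`. -/
abbrev SyndromeOf (e : Grid n₁ n₂) := Syndrome (colSum e) (rowSum e)

variable {h : Fin n₁ → ZMod 2} {l : Fin n₂ → ZMod 2} {xs : Finset (Fin n₁)} {ys : Finset (Fin n₂)}

theorem Syndrome.eq_or_eq_compl {A : Finset (Fin n₁)} (hs : Syndrome (ind A) l xs ys) :
    xs = A ∨ xs = Aᶜ := by
  obtain ⟨t, ht⟩ := hs.high
  rcases zmod_two_cases t with rfl | rfl
  · exact .inl (ind_injective (funext fun x => by simpa using ht x))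
  · exact .inr (ind_injective (funext fun x => by rw [ht x, ind_compl]))

/-- The complement of a set smaller than half is larger than half, which `card_le` excludes. -/
theorem Syndrome.eq_of_card_lt {A : Finset (Fin n₁)} (hs : Syndrome (ind A) l xs ys)
    (hA : 2 * A.card < n₁) : xs = A := by
  refine hs.eq_or_eq_compl.resolve_right fun hx => ?_
  have h1 := hs.card_le
  rw [hx, Finset.card_compl, Fintype.card_fin] at h1
  omega

/-- `S` may be larger than half, or exactly half, of the columns, so the complement stays possible;
it is equivalent by `sameError_row_compl`. -/
theorem SyndromeOf.hString {y : Fin n₂} {S : Finset (Fin n₁)} (hs : SyndromeOf (hString S y) xs ys) :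
    (xs = S ∨ xs = Sᶜ) ∧ ys = if Even S.card then ∅ else {y} := by
  have hlow := hs.low
  rw [SyndromeOf, colSum_hString] at hs
  exact ⟨hs.eq_or_eq_compl, ind_injective (hlow.trans (rowSum_hString S y))⟩

variable [EvenLength n₁]

theorem SyndromeOf.vString {x : Fin n₁} {S : Finset (Fin n₂)} (hs : SyndromeOf (vString x S) xs ys) :
    xs = (if Even S.card then ∅ else {x}) ∧ ys = S := by
  have h4 := EvenLength.four_le (n := n₁)
  have hlow := hs.low
  rw [SyndromeOf, colSum_vString] at hs
  refine ⟨hs.eq_of_card_lt ?_, ind_injective (hlow.trans (rowSum_vString x S))⟩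
  split_ifs <;> simp <;> omega

/-- Complementing the column coordinates preserves the parity of their number, because `n₁` is even.
-/
theorem Syndrome.card_add_card (hs : Syndrome h l xs ys) :
    ((xs.card + ys.card : ℕ) : ZMod 2) = ∑ x, h x + ∑ y, l y := by
  obtain ⟨t, ht⟩ := hs.high
  rw [Nat.cast_add, ← sum_ind xs, ← sum_ind ys, hs.low, Finset.sum_congr rfl fun x _ => ht x,
    Finset.sum_add_distrib]
  simp [natCast_eq_zero_of_even (EvenLength.even (n := n₁))]

/-- Column and row parities count the same errors modulo two. An odd number of coordinates thus
betrays a wrong outcome. -/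
theorem Syndrome.even_card {e : Grid n₁ n₂} (hs : Syndrome (colSum e) (rowSum e) xs ys) :
    Even (xs.card + ys.card) := by
  rw [← ZMod.natCast_eq_zero_iff_even, hs.card_add_card, sum_colSum]
  exact CharTwo.add_self_eq_zero _

theorem Syndrome.odd_card_of_high {e : Grid n₁ n₂} {z : Fin n₁}
    (hs : Syndrome (colSum e + Pi.single z 1) (rowSum e) xs ys) : Odd (xs.card + ys.card) := by
  rw [← ZMod.natCast_eq_one_iff_odd, hs.card_add_card]
  simp only [Pi.add_apply, Finset.sum_add_distrib, Finset.sum_pi_single', Finset.mem_univ, if_true,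
    sum_colSum]
  rw [add_right_comm, CharTwo.add_self_eq_zero, zero_add]

theorem Syndrome.odd_card_of_low {e : Grid n₁ n₂} {z : Fin n₂}
    (hs : Syndrome (colSum e) (rowSum e + Pi.single z 1) xs ys) : Odd (xs.card + ys.card) := by
  rw [← ZMod.natCast_eq_one_iff_odd, hs.card_add_card]
  simp only [Pi.add_apply, Finset.sum_add_distrib, Finset.sum_pi_single', Finset.mem_univ, if_true,
    sum_colSum]
  rw [← add_assoc, CharTwo.add_self_eq_zero, zero_add]

variable [EvenLength n₂]

/-- Commutation of the stabilizers: a full row is odd in every column and even in its row, while a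
pair of columns is even everywhere. Both lengths must be even for this. -/
theorem colSum_rowSum_of_mem {e : Grid n₁ n₂} (he : e ∈ stabilizers n₁ n₂) :
    (∃ t, ∀ x, colSum e x = t) ∧ rowSum e = 0 := by
  induction he using Submodule.span_induction with
  | mem e he =>
    rcases he with ⟨y, rfl⟩ | ⟨p, rfl⟩
    · refine ⟨⟨1, fun x => by simp [colSum_hString, ind]⟩, ?_⟩
      have := EvenLength.even (n := n₁)
      simp [rowSum_hString, this, ind_empty]
    · have := EvenLength.even (n := n₂)
      refine ⟨⟨0, fun x => by simp [colSum_add, colSum_vString, this, ind_empty]⟩, ?_⟩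
      ext y
      simpa [rowSum_add, rowSum_vString, ind] using CharTwo.add_self_eq_zero (1 : ZMod 2)
  | zero => exact ⟨⟨0, fun x => by simp [colSum_zero]⟩, rowSum_zero⟩
  | add e f _ _ he hf =>
    obtain ⟨⟨t, ht⟩, he⟩ := he
    obtain ⟨⟨u, hu⟩, hf⟩ := hf
    exact ⟨⟨t + u, fun x => by simp [colSum_add, ht, hu]⟩, by simp [rowSum_add, he, hf]⟩
  | smul c e _ he =>
    rcases zmod_two_cases c with rfl | rfl
    · rw [zero_smul]
      exact ⟨⟨0, fun x => by simp [colSum_zero]⟩, rowSum_zero⟩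
    · rwa [one_smul]

theorem Syndrome.congr {e e' : Grid n₁ n₂} (he : SameError e e')
    (hs : Syndrome (colSum e + h) (rowSum e + l) xs ys) :
    Syndrome (colSum e' + h) (rowSum e' + l) xs ys := by
  obtain ⟨⟨t, ht⟩, hr⟩ := colSum_rowSum_of_mem he
  have he' : e = (e - e') + e' := (sub_add_cancel e e').symm
  refine ⟨hs.card_le, ?_, ?_⟩
  · obtain ⟨u, hu⟩ := hs.high
    refine ⟨t + u, fun x => ?_⟩
    rw [hu x, he', colSum_add]
    simp only [Pi.add_apply, ht]
    ring
  · rw [hs.low, he', rowSum_add, hr, zero_add]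

theorem SyndromeOf.congr {e e' : Grid n₁ n₂} (he : SameError e e') (hs : SyndromeOf e xs ys) :
    SyndromeOf e' xs ys := by
  have := Syndrome.congr (h := 0) (l := 0) he (by simpa using hs)
  simpa using this

end Syndromes

/-! ## The decoder -/

section Decoding

variable {n₁ n₂ : ℕ}

/-- The decoder after the check that an input error is allowed. -/
def decodeBody (m : Memory n₁ n₂) (xs : Finset (Fin n₁)) (ys : Finset (Fin n₂)) :
    Option (Grid n₁ n₂ × Memory n₁ n₂) :=
  if m.hookCols = ∅ ∧ m.hookRows = ∅ then
    if xs.card + ys.card = 1 then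
      if 0 < m.prevFailures then none
      else some (0, ⟨∅, ∅, 1, decide (xs = ∅)⟩)
    else (noiselessDecode xs ys).map (fun c => (c, Memory.blank))
  else if m.hookCols.card = 1 ∧ m.hookRows = ∅ then
    if xs = (if Even ys.card then ∅ else m.hookCols) then
      some (rectangle m.hookCols ys, Memory.blank) else none
  else if m.hookCols = ∅ ∧ m.hookRows.card = 1 then
    if ys = (if Even xs.card then ∅ else m.hookRows) then
      some (rectangle xs m.hookRows, Memory.blank) else none
  else none

/-- The decoder as a function of the coordinates. -/
def decodeSets (m : Memory n₁ n₂) (xs : Finset (Fin n₁)) (ys : Finset (Fin n₂)) :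
    Option (Grid n₁ n₂ × Memory n₁ n₂) :=
  if m.inputErrorAllowed = false ∧ ¬ (xs = ∅ ∧ ys = ∅ ∧ m.hookCols = ∅ ∧ m.hookRows = ∅) then none
  else decodeBody m xs ys

theorem rectangle_singleton_left (x : Fin n₁) (T : Finset (Fin n₂)) :
    rectangle {x} T = vString x T := by
  ext i j; simp [rectangle, vString]

theorem rectangle_singleton_right (S : Finset (Fin n₁)) (y : Fin n₂) :
    rectangle S {y} = hString S y := by
  ext i j; simp [rectangle, hString]

variable {m m' : Memory n₁ n₂} {xs : Finset (Fin n₁)} {ys : Finset (Fin n₂)} {c : Grid n₁ n₂}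

theorem decodeBody_of_decodeSets (h : decodeSets m xs ys = some (c, m')) :
    decodeBody m xs ys = some (c, m') := by
  unfold decodeSets at h
  split_ifs at h
  exact h

theorem eq_empty_of_decodeSets (h : decodeSets m xs ys = some (c, m'))
    (hm : m.inputErrorAllowed = false) :
    xs = ∅ ∧ ys = ∅ ∧ m.hookCols = ∅ ∧ m.hookRows = ∅ := by
  unfold decodeSets at h
  split_ifs at h with h'
  by_contra hne
  exact h' ⟨hm, hne⟩

theorem decodeSets_of_allowed (hm : m.inputErrorAllowed = true) :
    decodeSets m xs ys = decodeBody m xs ys := by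
  simp [decodeSets, hm]

variable [EvenLength n₁]

theorem fin_pos : 0 < n₁ := lt_of_lt_of_le (by norm_num) (EvenLength.four_le (n := n₁))

theorem filter_val_eq_zero :
    (Finset.univ.filter fun x : Fin n₁ => x.val = 0) = {⟨0, fin_pos⟩} := by
  ext x; simp [Fin.ext_iff]

/-- The possible reasons for which the decoder succeeds. -/
inductive DecodeCase (m : Memory n₁ n₂) (xs : Finset (Fin n₁)) (ys : Finset (Fin n₂)) :
    Grid n₁ n₂ → Memory n₁ n₂ → Prop
  | single (hx : m.hookCols = ∅) (hy : m.hookRows = ∅) (h : xs.card + ys.card = 1) :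
      DecodeCase m xs ys 0 ⟨∅, ∅, 1, decide (xs = ∅)⟩
  | trivial (hx : m.hookCols = ∅) (hy : m.hookRows = ∅) (h : xs = ∅) (h' : ys = ∅) :
      DecodeCase m xs ys 0 Memory.blank
  | point (hx : m.hookCols = ∅) (hy : m.hookRows = ∅) (x y) (h : xs = {x}) (h' : ys = {y}) :
      DecodeCase m xs ys (vString x {y}) Memory.blank
  | column (hx : m.hookCols = ∅) (hy : m.hookRows = ∅) (x) (h : xs = ∅)
      (h' : ys = Finset.univ) : DecodeCase m xs ys (vString x Finset.univ) Memory.blank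
  | vertical (x) (hx : m.hookCols = {x}) (hy : m.hookRows = ∅)
      (h : xs = if Even ys.card then ∅ else {x}) :
      DecodeCase m xs ys (vString x ys) Memory.blank
  | horizontal (y) (hx : m.hookCols = ∅) (hy : m.hookRows = {y})
      (h : ys = if Even xs.card then ∅ else {y}) :
      DecodeCase m xs ys (hString xs y) Memory.blank

theorem DecodeCase.of_eq_some (h : decodeBody m xs ys = some (c, m')) :
    DecodeCase m xs ys c m' := by
  unfold decodeBody at h
  by_cases h1 : m.hookCols = ∅ ∧ m.hookRows = ∅
  · rw [if_pos h1] at h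
    by_cases h2 : xs.card + ys.card = 1
    · rw [if_pos h2] at h
      split_ifs at h
      obtain ⟨rfl, rfl⟩ := Prod.mk.inj (Option.some.inj h)
      exact .single h1.1 h1.2 h2
    · rw [if_neg h2] at h
      unfold noiselessDecode at h
      split_ifs at h with h3 h4 h5
      · obtain ⟨rfl, rfl⟩ := Prod.mk.inj (Option.some.inj h)
        exact .trivial h1.1 h1.2 h3.1 h3.2
      · obtain ⟨x, rfl⟩ := Finset.card_eq_one.1 h4.1
        obtain ⟨y, rfl⟩ := Finset.card_eq_one.1 h4.2
        obtain ⟨rfl, rfl⟩ := Prod.mk.inj (Option.some.inj h)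
        rw [rectangle_singleton_left]
        exact .point h1.1 h1.2 x y rfl rfl
      · obtain ⟨rfl, rfl⟩ := Prod.mk.inj (Option.some.inj h)
        rw [filter_val_eq_zero, rectangle_singleton_left]
        exact .column h1.1 h1.2 _ h5.1 h5.2
      · simp at h
  · rw [if_neg h1] at h
    by_cases h2 : m.hookCols.card = 1 ∧ m.hookRows = ∅
    · rw [if_pos h2] at h
      obtain ⟨x, hx⟩ := Finset.card_eq_one.1 h2.1
      rw [hx] at h
      by_cases h3 : xs = if Even ys.card then ∅ else {x}
      · rw [if_pos h3] at h
        obtain ⟨rfl, rfl⟩ := Prod.mk.inj (Option.some.inj h)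
        rw [rectangle_singleton_left]
        exact .vertical x hx h2.2 h3
      · simp [h3] at h
    · rw [if_neg h2] at h
      by_cases h3 : m.hookCols = ∅ ∧ m.hookRows.card = 1
      · rw [if_pos h3] at h
        obtain ⟨y, hy⟩ := Finset.card_eq_one.1 h3.2
        rw [hy] at h
        by_cases h4 : ys = if Even xs.card then ∅ else {y}
        · rw [if_pos h4] at h
          obtain ⟨rfl, rfl⟩ := Prod.mk.inj (Option.some.inj h)
          rw [rectangle_singleton_right]
          exact .horizontal y h3.1 hy h4
        · simp [h4] at h
      · simp [h3] at h

end Decoding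

/-! ### Decoding of ideal syndromes and generalized weight -/

section Weights

variable {n₁ n₂ : ℕ} {m m' : Memory n₁ n₂} {xs : Finset (Fin n₁)} {ys : Finset (Fin n₂)}
  {c e e' : Grid n₁ n₂} {C : Finset (Fin n₁)} {R : Finset (Fin n₂)}

/-- The sets of rows of an unflagged vertical string of generalized weight at most one. -/
def IsUnflagged (S : Finset (Fin n₂)) : Prop := S = ∅ ∨ (∃ y, S = {y}) ∨ S = Finset.univ

theorem IsGenWeightLeOne.congr (he : SameError e e') (h : IsGenWeightLeOne e' C R) :
    IsGenWeightLeOne e C R := by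
  rcases h with ⟨h, h'⟩ | ⟨x, y, h, h'⟩ | ⟨x, S, h, h'⟩ | ⟨x, S, h, h'⟩ | ⟨x, h, h'⟩
  exacts [.inl ⟨sameError_trans he h, h'⟩, .inr (.inl ⟨x, y, sameError_trans he h, h'⟩),
    .inr (.inr (.inl ⟨x, S, sameError_trans he h, h'⟩)),
    .inr (.inr (.inr (.inl ⟨x, S, sameError_trans he h, h'⟩))),
    .inr (.inr (.inr (.inr ⟨x, sameError_trans he h, h'⟩)))]

theorem isGenWeightLeOne_of_isUnflagged {x : Fin n₁} {S : Finset (Fin n₂)} (hS : IsUnflagged S)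
    (he : SameError e (vString x S)) : IsGenWeightLeOne e ∅ ∅ := by
  rcases hS with rfl | ⟨y, rfl⟩ | rfl
  · exact .inl ⟨by rwa [vString_empty] at he, rfl, rfl⟩
  · exact .inr (.inl ⟨x, y, he, rfl, rfl⟩)
  · exact .inr (.inr (.inr (.inr ⟨x, he, rfl, rfl⟩)))

theorem isGenWeightLeOne_of_sameError_zero (he : SameError e 0) : IsGenWeightLeOne e ∅ ∅ :=
  .inl ⟨he, rfl, rfl⟩

theorem isGenWeightLeOne_single (x : Fin n₁) (y : Fin n₂) :
    IsGenWeightLeOne (vString x {y}) ∅ ∅ :=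
  isGenWeightLeOne_of_isUnflagged (.inr (.inl ⟨y, rfl⟩)) (sameError_refl _)

theorem sameError_add_zero {v : Grid n₁ n₂} (he : SameError e v) (hc : SameError c v) :
    SameError (e + c) 0 := by
  have := sameError_add he hc
  rwa [grid_add_self] at this

theorem IsGenWeightLeTwo.add {f : Grid n₁ n₂} {C' : Finset (Fin n₁)} {R' : Finset (Fin n₂)}
    (he : IsGenWeightLeOne e C R) (hf : IsGenWeightLeOne f C' R') :
    IsGenWeightLeTwo (e + f) (C ∪ C') (R ∪ R') :=
  .inl ⟨e, C, R, f, C', R', he, hf, rfl, rfl, rfl⟩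

theorem IsGenWeightLeTwo.add_unflagged {f : Grid n₁ n₂}
    (he : IsGenWeightLeOne e C R) (hf : IsGenWeightLeOne f ∅ ∅) :
    IsGenWeightLeTwo (e + f) C R := by
  simpa using he.congr (sameError_refl _) |> fun h => IsGenWeightLeTwo.add h hf

theorem IsGenWeightLeOne.leTwo (he : IsGenWeightLeOne e C R) : IsGenWeightLeTwo e C R := by
  simpa using IsGenWeightLeTwo.add_unflagged he
    (isGenWeightLeOne_of_sameError_zero (sameError_refl (0 : Grid n₁ n₂)))

theorem IsGenWeightLeTwo.congr (he : SameError e e') (h : IsGenWeightLeTwo e' C R) :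
    IsGenWeightLeTwo e C R := by
  rcases h with ⟨e₁, C₁, R₁, e₂, C₂, R₂, h₁, h₂, rfl, hC, hR⟩ | ⟨x, S, h, h'⟩ | ⟨y, S, h, h'⟩
  · refine .inl ⟨e - e₂, C₁, R₁, e₂, C₂, R₂, h₁.congr ?_, h₂, by simp, hC, hR⟩
    simpa [SameError, sub_sub, add_comm] using he
  · exact .inr (.inl ⟨x, S, sameError_trans he h, h'⟩)
  · exact .inr (.inr ⟨y, S, sameError_trans he h, h'⟩)

variable [EvenLength n₁]

/-- No error, a single-qubit error and a full column are all vertical strings, with the row sets of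
`IsUnflagged`; this leaves three cases instead of five. -/
theorem IsGenWeightLeOne.cases (h : IsGenWeightLeOne e C R) :
    (∃ x S, IsUnflagged S ∧ SameError e (vString x S) ∧ C = ∅ ∧ R = ∅) ∨
    (∃ x S, SameError e (vString x S) ∧ C = {x} ∧ R = ∅) ∨
    (∃ y S, SameError e (hString S y) ∧ C = ∅ ∧ R = {y}) := by
  rcases h with ⟨h, h'⟩ | ⟨x, y, h, h'⟩ | ⟨x, S, h, h'⟩ | ⟨x, S, h, h'⟩ | ⟨x, h, h'⟩
  · exact .inl ⟨⟨0, fin_pos⟩, ∅, .inl rfl, by rwa [vString_empty], h'⟩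
  · exact .inl ⟨x, {y}, .inr (.inl ⟨y, rfl⟩), h, h'⟩
  · exact .inr (.inl ⟨x, S, h, h'⟩)
  · exact .inr (.inr ⟨x, S, h, h'⟩)
  · exact .inl ⟨x, Finset.univ, .inr (.inr rfl), h, h'⟩

variable [EvenLength n₂]

/-- Errors of generalized weight at most one are corrected. -/
theorem decodeBody_of_isGenWeightLeOne (he : IsGenWeightLeOne e m.hookCols m.hookRows)
    (hs : SyndromeOf e xs ys) :
    ∃ c, decodeBody m xs ys = some (c, Memory.blank) ∧ SameError (e + c) 0 := by
  have h4 := EvenLength.four_le (n := n₂)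
  have hev := EvenLength.even (n := n₂)
  rcases he.cases with ⟨x, S, hS, he, hC, hR⟩ | ⟨x, S, he, hC, hR⟩ | ⟨y, S, he, hC, hR⟩
  · obtain ⟨hx, hy⟩ := (hs.congr he).vString
    subst hy
    rcases hS with rfl | ⟨y, rfl⟩ | rfl
    · refine ⟨0, ?_, by simpa [vString_empty] using he⟩
      simp [decodeBody, hC, hR, noiselessDecode, hx]
    · refine ⟨vString x {y}, ?_, sameError_add_zero he (sameError_refl _)⟩
      simp only [Finset.card_singleton, Nat.not_even_one, if_false] at hx
      simp [decodeBody, hC, hR, noiselessDecode, hx, rectangle_singleton_left]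
    -- Correcting column 0 suffices, since all full columns are equivalent.
    · refine ⟨vString ⟨0, fin_pos⟩ Finset.univ, ?_, sameError_add_zero he (sameError_column _ _)⟩
      have hne : (Finset.univ : Finset (Fin n₂)) ≠ ∅ :=
        Finset.univ_eq_empty_iff.not.2 fun h => h.false ⟨0, by omega⟩
      have h1 : n₂ ≠ 1 := by omega
      simp only [Finset.card_univ, Fintype.card_fin, hev, if_true] at hx
      simp [decodeBody, hC, hR, noiselessDecode, hx, rectangle_singleton_left, filter_val_eq_zero,
        hne, h1]
  · obtain ⟨hx, rfl⟩ := (hs.congr he).vString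
    refine ⟨vString x ys, ?_, sameError_add_zero he (sameError_refl _)⟩
    simp [decodeBody, hC, hR, hx, rectangle_singleton_left]
  · obtain ⟨hx, hy⟩ := (hs.congr he).hString
    -- The outcomes may show the complement of `S`; the parity test of the decoder does not notice
    -- the difference.
    have hcompl : Even Sᶜ.card ↔ Even S.card := by
      have h1 := Finset.card_le_univ S
      rw [Fintype.card_fin] at h1
      rw [Finset.card_compl, Fintype.card_fin, Nat.even_sub h1]
      simp [EvenLength.even (n := n₁)]
    refine ⟨hString xs y, ?_, sameError_add_zero he ?_⟩
    · have hy' : ys = if Even xs.card then ∅ else {y} := by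
        rcases hx with rfl | rfl
        · exact hy
        · rw [hy]
          simp only [hcompl]
      rw [decodeBody, if_neg (by simp [hR]), if_neg (by simp [hR]), if_pos (by simp [hC, hR]), hR,
        if_pos hy', rectangle_singleton_right]
    · rcases hx with rfl | rfl
      · exact sameError_refl _
      · exact sameError_symm (sameError_row_compl _ _)

/-- The rows of the string are read off exactly. Success without flags accepts none, one or all of
them, a lone coordinate being excluded by parity. -/
theorem DecodeCase.leOne_of_vString {x : Fin n₁} {S : Finset (Fin n₂)}
    (h : DecodeCase m xs ys c m') (hs : SyndromeOf e xs ys) (he : SameError e (vString x S))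
    (hC : m.hookCols = ∅) (hR : m.hookRows = ∅) : IsGenWeightLeOne e ∅ ∅ := by
  obtain ⟨hx, rfl⟩ := (hs.congr he).vString
  refine isGenWeightLeOne_of_isUnflagged ?_ he
  cases h with
  | single _ _ h => exact absurd hs.even_card (by simp [h])
  | trivial _ _ _ h => exact .inl h
  | point _ _ _ y _ h => exact .inr (.inl ⟨y, h⟩)
  | column _ _ _ _ h => exact .inr (.inr h)
  | vertical x h => simp [hC] at h
  | horizontal y _ h => simp [hR] at h

/-- At most one row is seen, which excludes the full-column branch; the columns are correct up to a
row stabilizer, and success accepts at most one. -/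
theorem DecodeCase.leOne_of_hString {y : Fin n₂} {S : Finset (Fin n₁)}
    (h : DecodeCase m xs ys c m') (hs : SyndromeOf e xs ys) (he : SameError e (hString S y))
    (hC : m.hookCols = ∅) (hR : m.hookRows = ∅) : IsGenWeightLeOne e ∅ ∅ := by
  have h4 := EvenLength.four_le (n := n₂)
  obtain ⟨hx, hy⟩ := (hs.congr he).hString
  have hxs : SameError e (hString xs y) := by
    rcases hx with rfl | rfl
    · exact he
    · exact sameError_trans he (sameError_row_compl _ _)
  cases h with
  | single _ _ h => exact absurd hs.even_card (by simp [h])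
  | trivial _ _ h _ =>
    rw [h, hString_empty] at hxs
    exact isGenWeightLeOne_of_sameError_zero hxs
  | point _ _ x _ h _ =>
    rw [h, ← vString_singleton] at hxs
    exact (isGenWeightLeOne_single x y).congr hxs
  | column _ _ _ _ h =>
    have h1 : ys.card ≤ 1 := by rw [hy]; split_ifs <;> simp
    rw [h, Finset.card_univ, Fintype.card_fin] at h1
    omega
  | vertical x h => simp [hC] at h
  | horizontal y _ h => simp [hR] at h

/-- In a common row the errors form a horizontal string. Otherwise exactly two rows are seen, which
no successful branch without flags admits. -/
theorem DecodeCase.leOne_of_singles {x x' : Fin n₁} {y y' : Fin n₂}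
    (h : DecodeCase m xs ys c m') (hs : SyndromeOf e xs ys)
    (he : SameError e (vString x {y} + vString x' {y'}))
    (hC : m.hookCols = ∅) (hR : m.hookRows = ∅) : IsGenWeightLeOne e ∅ ∅ := by
  have h4 := EvenLength.four_le (n := n₂)
  by_cases hyy : y = y'
  · subst hyy
    rw [vString_singleton, vString_singleton, hString_add_hString] at he
    exact h.leOne_of_hString hs he hC hR
  · have hy : ys = {y, y'} := by
      apply ind_injective
      rw [(hs.congr he).low, rowSum_add, rowSum_vString, rowSum_vString, ind_add_ind,
        symmDiff_singleton (by simpa using fun h => hyy h.symm), Finset.pair_comm]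
    have hcard : ys.card = 2 := by rw [hy, Finset.card_pair hyy]
    cases h with
    | single _ _ h => exact absurd hs.even_card (by simp [h])
    | trivial _ _ _ h => simp [h] at hcard
    | point _ _ _ _ _ h => simp [h] at hcard
    | column _ _ _ _ h =>
      rw [h, Finset.card_univ, Fintype.card_fin] at hcard
      omega
    | vertical x h => simp [hC] at h
    | horizontal y _ h => simp [hR] at h

/-- A full column can be moved to the column of the other error, which turns the product into a
vertical string; only two single-qubit errors need a separate argument. -/
theorem DecodeCase.leOne_of_unflagged {f : Grid n₁ n₂} (h : DecodeCase m xs ys c m')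
    (hs : SyndromeOf (e + f) xs ys) {x x' : Fin n₁} {S S' : Finset (Fin n₂)} (hS : IsUnflagged S)
    (hS' : IsUnflagged S') (he : SameError e (vString x S)) (hf : SameError f (vString x' S'))
    (hC : m.hookCols = ∅) (hR : m.hookRows = ∅) : IsGenWeightLeOne (e + f) ∅ ∅ := by
  rcases hS with rfl | ⟨y, rfl⟩ | rfl
  · have := sameError_add he hf
    rw [vString_empty, zero_add] at this
    exact isGenWeightLeOne_of_isUnflagged hS' this
  · rcases hS' with rfl | ⟨y', rfl⟩ | rfl
    · have := sameError_add he hf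
      rw [vString_empty, add_zero] at this
      exact (isGenWeightLeOne_single x y).congr this
    · exact h.leOne_of_singles hs (sameError_add he hf) hC hR
    · have := sameError_add he (sameError_trans hf (sameError_column x' x))
      rw [vString_add_vString] at this
      exact h.leOne_of_vString hs this hC hR
  · have := sameError_add (sameError_trans he (sameError_column x x')) hf
    rw [vString_add_vString] at this
    exact h.leOne_of_vString hs this hC hR

/-- Success confines the columns seen to the flagged one, so a single-qubit error must lie there. A
full column can be moved there. -/
theorem DecodeCase.leOne_of_vertical {f : Grid n₁ n₂} (h : DecodeCase m xs ys c m')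
    (hs : SyndromeOf (e + f) xs ys) {x x' : Fin n₁} {S S' : Finset (Fin n₂)}
    (he : SameError e (vString x S)) (hS' : IsUnflagged S') (hf : SameError f (vString x' S'))
    (hC : m.hookCols = {x}) : IsGenWeightLeOne (e + f) {x} ∅ := by
  have key : ∀ S'', SameError f (vString x S'') → IsGenWeightLeOne (e + f) {x} ∅ := fun S'' hf' => by
    have := sameError_add he hf'
    rw [vString_add_vString] at this
    exact .inr (.inr (.inl ⟨x, _, this, rfl, rfl⟩))
  rcases hS' with rfl | ⟨y', rfl⟩ | rfl
  · exact key ∅ (by rwa [vString_empty] at hf ⊢)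
  · by_cases hx : x' = x
    · exact key {y'} (hx ▸ hf)
    · exfalso
      have h4 := EvenLength.four_le (n := n₁)
      have h1 : xs ⊆ {x} := by
        cases h with
        | vertical x₁ hx₁ _ h =>
          rw [hC] at hx₁
          rw [h, Finset.singleton_inj.1 hx₁]
          split_ifs <;> simp
        | _ => simp_all
      have h2 := hs.congr (sameError_add he hf)
      rw [SyndromeOf, colSum_add, colSum_vString, colSum_vString, ind_add_ind] at h2
      -- `A` consists of the odd columns. It contains `x'` and has at most two elements, so neither
      -- it nor its complement is contained in `{x}`.
      set A : Finset (Fin n₁) := symmDiff (if Even S.card then ∅ else {x})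
        (if Even (Finset.card {y'}) then ∅ else {x'}) with hA
      have hAx : x' ∈ A := by
        rw [hA, Finset.mem_symmDiff]
        right
        split_ifs <;> simp_all
      have hAsub : A ⊆ {x, x'} := by
        intro z hz
        rw [hA, Finset.mem_symmDiff] at hz
        split_ifs at hz <;> simp_all
        tauto
      rcases h2.eq_or_eq_compl with rfl | h3
      · exact hx (by simpa using h1 hAx)
      · have h5 := Finset.card_le_card hAsub
        have h6 := Finset.card_le_card h1
        have h7 := Finset.card_le_two (a := x) (b := x')
        rw [h3, Finset.card_compl, Fintype.card_fin, Finset.card_singleton] at h6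
        omega
  · exact key Finset.univ (sameError_trans hf (sameError_column x' x))

/-- Row outcomes are exact and success confines them to the flagged row. Outside that row they
coincide with `S'`, so `S'` lies in it. -/
theorem DecodeCase.leOne_of_horizontal {f : Grid n₁ n₂} (h : DecodeCase m xs ys c m')
    (hs : SyndromeOf (e + f) xs ys) {y : Fin n₂} {x' : Fin n₁} {S : Finset (Fin n₁)}
    {S' : Finset (Fin n₂)} (he : SameError e (hString S y)) (hS' : IsUnflagged S')
    (hf : SameError f (vString x' S')) (hR : m.hookRows = {y}) :
    IsGenWeightLeOne (e + f) ∅ {y} := by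
  have h4 := EvenLength.four_le (n := n₂)
  have key : ∀ S'', SameError f (hString S'' y) → IsGenWeightLeOne (e + f) ∅ {y} := fun S'' hf' => by
    have := sameError_add he hf'
    rw [hString_add_hString] at this
    exact .inr (.inr (.inr (.inl ⟨y, _, this, rfl, rfl⟩)))
  have h1 : ys ⊆ {y} := by
    cases h with
    | horizontal y₁ _ hy₁ h =>
      rw [hR] at hy₁
      rw [h, Finset.singleton_inj.1 hy₁]
      split_ifs <;> simp
    | _ => simp_all
  have h2 : ys = symmDiff (if Even S.card then ∅ else {y}) S' := by
    apply ind_injective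
    rw [(hs.congr (sameError_add he hf)).low, rowSum_add, rowSum_hString, rowSum_vString,
      ind_add_ind]
  have h3 : ∀ z ∈ S', z = y := fun z hz => by
    by_contra hne
    have : z ∈ ys := by
      rw [h2, Finset.mem_symmDiff]
      refine .inr ⟨hz, ?_⟩
      split_ifs <;> simp [hne]
    exact hne (by simpa using h1 this)
  rcases hS' with rfl | ⟨y', rfl⟩ | rfl
  · exact key ∅ (by rwa [vString_empty, ← hString_empty y] at hf)
  · obtain rfl := h3 y' (by simp)
    exact key {x'} (by rwa [vString_singleton] at hf)
  · have h5 : (⟨0, by omega⟩ : Fin n₂) = ⟨1, by omega⟩ :=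
      (h3 _ (Finset.mem_univ _)).trans (h3 _ (Finset.mem_univ _)).symm
    simp at h5

/-- The decoder halts on errors of generalized weight two. -/
theorem isGenWeightLeOne_of_decodeBody (he : IsGenWeightLeTwo e m.hookCols m.hookRows)
    (hs : SyndromeOf e xs ys) (h : decodeBody m xs ys = some (c, m')) :
    IsGenWeightLeOne e m.hookCols m.hookRows := by
  replace h := DecodeCase.of_eq_some h
  rcases he with ⟨e₁, C₁, R₁, e₂, C₂, R₂, h₁, h₂, rfl, hC, hR⟩ | ⟨x, S, he, hC, hR⟩ |
    ⟨y, S, he, hC, hR⟩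
  · rcases h₁.cases with ⟨x, S, hS, he, rfl, rfl⟩ | ⟨x, S, he, rfl, rfl⟩ | ⟨y, S, he, rfl, rfl⟩ <;>
    rcases h₂.cases with ⟨x', S', hS', he', rfl, rfl⟩ | ⟨x', S', he', rfl, rfl⟩ |
      ⟨y', S', he', rfl, rfl⟩ <;>
    simp only [Finset.empty_union, Finset.union_empty] at hC hR
    · rw [hC, hR]
      exact h.leOne_of_unflagged hs hS hS' he he' hC hR
    · rw [hC, hR, add_comm]
      exact h.leOne_of_vertical (add_comm e₁ e₂ ▸ hs) he' hS he hC
    · rw [hC, hR, add_comm]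
      exact h.leOne_of_horizontal (add_comm e₁ e₂ ▸ hs) he' hS he hR
    · rw [hC, hR]
      exact h.leOne_of_vertical hs he hS' he' hC
    -- Success requires a single flagged column, so the two strings share it.
    · have hxx : x = x' := by
        have hmem : x ∈ m.hookCols := by simp [hC]
        cases h with
        | vertical x₁ hx₁ _ h =>
          rw [hC] at hx₁
          have h1 : x ∈ ({x₁} : Finset (Fin n₁)) := hx₁ ▸ by simp
          have h2 : x' ∈ ({x₁} : Finset (Fin n₁)) := hx₁ ▸ by simp
          simp_all
        | _ => simp [‹m.hookCols = ∅›] at hmem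
      subst hxx
      rw [hC, hR, Finset.union_self]
      have := sameError_add he he'
      rw [vString_add_vString] at this
      exact .inr (.inr (.inl ⟨x, _, this, rfl, rfl⟩))
    -- A flagged column together with a flagged row makes the decoder halt.
    · exfalso
      cases h <;> simp_all
    · rw [hC, hR]
      exact h.leOne_of_horizontal hs he hS' he' hR
    · exfalso
      cases h <;> simp_all
    · have hyy : y = y' := by
        have hmem : y ∈ m.hookRows := by simp [hR]
        cases h with
        | horizontal y₁ _ hy₁ h =>
          rw [hR] at hy₁
          have h1 : y ∈ ({y₁} : Finset (Fin n₂)) := hy₁ ▸ by simp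
          have h2 : y' ∈ ({y₁} : Finset (Fin n₂)) := hy₁ ▸ by simp
          simp_all
        | _ => simp [‹m.hookRows = ∅›] at hmem
      subst hyy
      rw [hC, hR, Finset.union_self]
      have := sameError_add he he'
      rw [hString_add_hString] at this
      exact .inr (.inr (.inr (.inl ⟨y, _, this, rfl, rfl⟩)))
  · rw [hC, hR]
    exact h.leOne_of_vString hs he hC hR
  · rw [hC, hR]
    exact h.leOne_of_hString hs he hC hR

end Weights

/-! ## Faulty syndrome extraction -/

section Faulty

variable {n₁ n₂ : ℕ} {m m' : Memory n₁ n₂} {xs : Finset (Fin n₁)} {ys : Finset (Fin n₂)}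
  {c e e' : Grid n₁ n₂}

/-- With at most `k` faults in the extraction that detects it, the error `e` becomes `e'`, and the
coordinates are `xs` and `ys`. -/
def Detects (k : ℕ) (e e' : Grid n₁ n₂) (xs : Finset (Fin n₁)) (ys : Finset (Fin n₂)) : Prop :=
  2 * xs.card ≤ n₁ ∧ ∃ t : ZMod 2, ∃ es : List (Observed n₁ n₂), es.length ≤ k ∧
    (∀ m ∈ es, IsDetectEffect m) ∧ ((e', 0, ind xs, ind ys) : Observed n₁ n₂) =
      (e, 0, colSum e, rowSum e) + (0, 0, fun _ => t, 0) + es.sum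

theorem Detects.mono {k k' : ℕ} (h : Detects k e e' xs ys) (hk : k ≤ k') :
    Detects k' e e' xs ys := by
  obtain ⟨hc, t, es, hlen, h⟩ := h
  exact ⟨hc, t, es, hlen.trans hk, h⟩

/-- There are exactly two effects, when trivial ones are admitted. -/
theorem Detects.two (h : Detects 2 e e' xs ys) :
    ∃ m₁ m₂, IsDetectEffect m₁ ∧ IsDetectEffect m₂ ∧ e' = e + m₁.1 + m₂.1 ∧
      m₁.2.1 + m₂.2.1 = 0 ∧
      Syndrome (colSum e + m₁.2.2.1 + m₂.2.2.1) (rowSum e + m₁.2.2.2 + m₂.2.2.2) xs ys := by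
  obtain ⟨hc, t, es, hlen, hes, h⟩ := h
  obtain ⟨m₁, m₂, h₁, h₂, hsum⟩ : ∃ m₁ m₂, IsDetectEffect m₁ ∧ IsDetectEffect m₂ ∧
      es.sum = m₁ + m₂ := by
    -- `.gauge 0` is the zero effect and pads shorter lists.
    match es, hlen with
    | [], _ => exact ⟨_, _, .gauge 0, .gauge 0, by ext <;> simp⟩
    | [m₁], _ => exact ⟨m₁, _, hes m₁ (by simp), .gauge 0, by ext <;> simp⟩
    | [m₁, m₂], _ => exact ⟨m₁, m₂, hes m₁ (by simp), hes m₂ (by simp), by simp⟩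
  rw [hsum] at h
  refine ⟨m₁, m₂, h₁, h₂, ?_, ?_, hc, ⟨t, fun x => ?_⟩, ?_⟩
  · simpa [add_assoc] using congrArg Prod.fst h
  · simpa [add_assoc] using (congrArg (fun p => p.2.1) h).symm
  · have := congrFun (congrArg (fun p => p.2.2.1) h) x
    simp only [Prod.snd_add, Prod.fst_add, Pi.add_apply] at this ⊢
    rw [this]
    ring
  · simpa [add_assoc] using congrArg (fun p => p.2.2.2) h

theorem Detects.one (h : Detects 1 e e' xs ys) :
    ∃ m, IsDetectEffect m ∧ e' = e + m.1 ∧ m.2.1 = 0 ∧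
      Syndrome (colSum e + m.2.2.1) (rowSum e + m.2.2.2) xs ys := by
  obtain ⟨hc, t, es, hlen, hes, h⟩ := h
  obtain ⟨m, hm, hsum⟩ : ∃ m, IsDetectEffect m ∧ es.sum = m := by
    match es, hlen with
    | [], _ => exact ⟨_, .gauge 0, by ext <;> simp⟩
    | [m], _ => exact ⟨m, hes m (by simp), by simp⟩
  rw [hsum] at h
  refine ⟨m, hm, ?_, ?_, hc, ⟨t, fun x => ?_⟩, ?_⟩
  · simpa using congrArg Prod.fst h
  · simpa using (congrArg (fun p => p.2.1) h).symm
  · have := congrFun (congrArg (fun p => p.2.2.1) h) x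
    simp only [Prod.snd_add, Prod.fst_add, Pi.add_apply] at this ⊢
    rw [this]
    ring
  · simpa using congrArg (fun p => p.2.2.2) h

theorem Detects.zero (h : Detects 0 e e' xs ys) : e' = e ∧ SyndromeOf e xs ys := by
  obtain ⟨hc, t, es, hlen, hes, h⟩ := h
  obtain rfl : es = [] := List.length_eq_zero_iff.1 (by omega)
  refine ⟨by simpa using congrArg Prod.fst h, hc, ⟨t, fun x => ?_⟩, ?_⟩
  · simpa using congrFun (congrArg (fun p => p.2.2.1) h) x
  · simpa using congrArg (fun p => p.2.2.2) h

theorem Syndrome.of_const {h : Fin n₁ → ZMod 2} {l : Fin n₂ → ZMod 2} {t : ZMod 2}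
    (hs : Syndrome (h + fun _ => t) l xs ys) : Syndrome h l xs ys := by
  obtain ⟨u, hu⟩ := hs.high
  exact ⟨hs.card_le, ⟨t + u, fun x => by rw [hu x, Pi.add_apply]; ring⟩, hs.low⟩

/-- The ways in which a single fault affects the extraction of the syndrome. -/
theorem Detects.one_cases (h : Detects 1 e e' xs ys) :
    (e' = e ∧ SyndromeOf e xs ys) ∨
    (∃ x y, e' = e + vString x {y} ∧ SyndromeOf e xs ys) ∨
    (∃ x y, e' = e + vString x {y} ∧ SyndromeOf e' xs ys) ∨
    (∃ z, e' = e ∧ Syndrome (colSum e + Pi.single z 1) (rowSum e) xs ys) ∨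
    (∃ y, e' = e ∧ Syndrome (colSum e) (rowSum e + Pi.single y 1) xs ys) ∨
    (∃ x y, e' = e + vString x {y} ∧ Syndrome (colSum e) (rowSum e + Pi.single y 1) xs ys) := by
  obtain ⟨m, hm, he, hc, hs⟩ := h.one
  cases hm with
  | gauge t => exact .inl ⟨by simpa using he, Syndrome.of_const (by simpa using hs)⟩
  | high x => exact .inr (.inr (.inr (.inl ⟨x, by simpa using he, by simpa using hs⟩)))
  | low y => exact .inr (.inr (.inr (.inr (.inl ⟨y, by simpa using he, by simpa using hs⟩))))
  | late x y => exact .inr (.inl ⟨x, y, he, by simpa using hs⟩)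
  | mid x y => exact .inr (.inr (.inr (.inr (.inr ⟨x, y, he, by simpa using hs⟩))))
  | early x y =>
    refine .inr (.inr (.inl ⟨x, y, he, ?_⟩))
    rw [he, SyndromeOf, colSum_add, rowSum_add, colSum_single, rowSum_single]
    exact hs
  | verify h => exact absurd hc one_ne_zero

/-- Two errors in the same row, of which the decoder only saw a column, so that it forbade input
errors in the next cycle. -/
def IsDeferredPair (e : Grid n₁ n₂) (m : Memory n₁ n₂) : Prop :=
  (∃ x x' y, x ≠ x' ∧ SameError e (vString x {y} + vString x' {y})) ∧ m = ⟨∅, ∅, 1, false⟩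

theorem DecodeCase.hooks_eq (h : DecodeCase m xs ys c m') : m'.hookCols = ∅ ∧ m'.hookRows = ∅ := by
  cases h <;> exact ⟨rfl, rfl⟩

theorem sameError_correct_add {f : Grid n₁ n₂} (h : SameError (e + c) 0) :
    SameError (e + f + c) f := by
  have := sameError_add h (sameError_refl f)
  rwa [zero_add, add_right_comm] at this

theorem IsDetectEffect.error_cases {p : Observed n₁ n₂} (h : IsDetectEffect p) :
    p.1 = 0 ∨ ∃ x y, p.1 = vString x {y} ∧
      (p.2.2.1 = 0 ∧ p.2.2.2 = 0 ∨ p.2.2.1 = 0 ∧ p.2.2.2 = Pi.single y 1 ∨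
        p.2.2.1 = Pi.single x 1 ∧ p.2.2.2 = Pi.single y 1) := by
  cases h with
  | late x y => exact .inr ⟨x, y, rfl, .inl ⟨rfl, rfl⟩⟩
  | mid x y => exact .inr ⟨x, y, rfl, .inr (.inl ⟨rfl, rfl⟩)⟩
  | early x y => exact .inr ⟨x, y, rfl, .inr (.inr ⟨rfl, rfl⟩)⟩
  | _ => exact .inl rfl

theorem IsDetectEffect.leOne {p : Observed n₁ n₂} (h : IsDetectEffect p) :
    IsGenWeightLeOne p.1 ∅ ∅ := by
  rcases h.error_cases with h | ⟨x, y, h, -⟩ <;> rw [h]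
  · exact isGenWeightLeOne_of_sameError_zero (sameError_refl _)
  · exact isGenWeightLeOne_single x y

/-- A late error together with an error that is corrected as a single-qubit error. -/
theorem decoded_pair_of_late [EvenLength n₁] {p : Observed n₁ n₂} {x x₁ x₂ : Fin n₁} {y y₁ y₂ : Fin n₂}
    (hs : Syndrome p.2.2.1 p.2.2.2 {x} {y})
    (h : p.2.2.1 = 0 ∧ p.2.2.2 = 0 ∨ p.2.2.1 = 0 ∧ p.2.2.2 = Pi.single y₁ 1 ∨
        p.2.2.1 = Pi.single x₁ 1 ∧ p.2.2.2 = Pi.single y₁ 1) :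
    IsGenWeightLeOne (vString x₂ {y₂} + vString x₁ {y₁} + vString x {y}) ∅ ∅ := by
  have h4 := EvenLength.four_le (n := n₁)
  have hne : ∀ l : Fin n₂ → ZMod 2, ¬ Syndrome (0 : Fin n₁ → ZMod 2) l {x} {y} := fun l hl => by
    rw [← ind_empty] at hl
    have := hl.eq_of_card_lt (by simp; omega)
    simp at this
  rcases h with ⟨h1, -⟩ | ⟨h1, -⟩ | ⟨h1, h2⟩
  · exact absurd (h1 ▸ hs) (hne _)
  · exact absurd (h1 ▸ hs) (hne _)
  · rw [h1, h2, ← ind_singleton, ← ind_singleton] at hs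
    obtain rfl := Finset.singleton_inj.1 (hs.eq_of_card_lt (by simp; omega))
    obtain rfl := Finset.singleton_inj.1 (ind_injective hs.low)
    rw [add_assoc, grid_add_self, add_zero]
    exact isGenWeightLeOne_single _ _

variable [EvenLength n₂]

/-- All successful branches other than `single` accept only an even number of coordinates: the tests
for flagged strings enforce it, and a full column shows an even number `n₂` of rows. -/
theorem DecodeCase.of_odd (h : DecodeCase m xs ys c m') (hodd : Odd (xs.card + ys.card)) :
    m.hookCols = ∅ ∧ m.hookRows = ∅ ∧ xs.card + ys.card = 1 ∧ c = 0 ∧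
      m' = ⟨∅, ∅, 1, decide (xs = ∅)⟩ := by
  have hev := EvenLength.even (n := n₂)
  rw [← Nat.not_even_iff_odd] at hodd
  cases h with
  | single h1 h2 h3 => exact ⟨h1, h2, h3, rfl, rfl⟩
  | trivial _ _ h h' => simp [h, h'] at hodd
  | point _ _ x y h h' => exact absurd (by simp [h, h']) hodd
  | column _ _ x h h' => simp [h, h', hev] at hodd
  | vertical x _ _ h =>
    rw [Nat.even_add] at hodd
    rw [h] at hodd
    split_ifs at hodd <;> simp_all
  | horizontal y _ _ h =>
    rw [Nat.even_add] at hodd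
    rw [h] at hodd
    split_ifs at hodd <;> simp_all

theorem IsDetectEffect.low_cases {p : Observed n₁ n₂} (h : IsDetectEffect p) :
    ∃ y₀, ∀ y, y ≠ y₀ → p.2.2.2 y = 0 := by
  cases h with
  | low y₀ | mid _ y₀ | early _ y₀ =>
    exact ⟨y₀, fun y hy => by simp [hy]⟩
  | _ => exact ⟨⟨0, fin_pos⟩, fun _ _ => rfl⟩

variable [EvenLength n₁]

theorem clean_of_decodeSets (he : IsGenWeightLeOne e m.hookCols m.hookRows)
    (hs : SyndromeOf e xs ys) (h : decodeSets m xs ys = some (c, m')) :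
    SameError (e + c) 0 ∧ m' = Memory.blank := by
  obtain ⟨c', hc', hz⟩ := decodeBody_of_isGenWeightLeOne he hs
  rw [decodeBody_of_decodeSets h] at hc'
  obtain ⟨rfl, rfl⟩ := Prod.mk.inj (Option.some.inj hc')
  exact ⟨hz, rfl⟩

/-- One fault in the extraction, with an input of generalized weight at most one. -/
theorem decodeSets_one_fault (he : IsGenWeightLeOne e m.hookCols m.hookRows)
    (hd : Detects 1 e e' xs ys) (h : decodeSets m xs ys = some (c, m')) :
    IsGenWeightLeOne (e' + c) m'.hookCols m'.hookRows ∨ IsDeferredPair (e' + c) m' := by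
  have h4 := EvenLength.four_le (n := n₂)
  have hcase := DecodeCase.of_eq_some (decodeBody_of_decodeSets h)
  obtain ⟨hm1, hm2⟩ := hcase.hooks_eq
  rcases hd.one_cases with ⟨rfl, hs⟩ | ⟨x, y, rfl, hs⟩ | ⟨x, y, rfl, hs⟩ | ⟨z, rfl, hs⟩ |
    ⟨y, rfl, hs⟩ | ⟨x, y, rfl, hs⟩
  · left
    rw [hm1, hm2]
    exact isGenWeightLeOne_of_sameError_zero (clean_of_decodeSets he hs h).1
  · left
    rw [hm1, hm2]
    exact (isGenWeightLeOne_single x y).congr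
      (sameError_correct_add (clean_of_decodeSets he hs h).1)
  · left
    rw [hm1, hm2]
    -- An early error acts as a second input error before an ideal extraction, where success leaves
    -- only weight at most one.
    have h1 := isGenWeightLeOne_of_decodeBody
      (IsGenWeightLeTwo.add_unflagged he (isGenWeightLeOne_single x y)) hs
      (decodeBody_of_decodeSets h)
    exact isGenWeightLeOne_of_sameError_zero (clean_of_decodeSets h1 hs h).1
  -- A flipped outcome makes the number of coordinates odd, so the decoder postpones and the input
  -- persists.
  · left
    obtain ⟨h1, h2, -, rfl, rfl⟩ := hcase.of_odd hs.odd_card_of_high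
    rw [add_zero]
    rwa [h1, h2] at he
  · left
    obtain ⟨h1, h2, -, rfl, rfl⟩ := hcase.of_odd hs.odd_card_of_low
    rw [add_zero]
    rwa [h1, h2] at he
  -- The new error is seen by its row only. An input error in the same row cancels that row outcome
  -- and leaves just a column coordinate.
  · obtain ⟨h1, h2, hcard, rfl, rfl⟩ := hcase.of_odd hs.odd_card_of_low
    rw [h1, h2] at he
    rw [add_zero]
    rcases he.cases with ⟨x₀, S, hS, he, -, -⟩ | ⟨_, _, -, hC, -⟩ | ⟨_, _, -, -, hR⟩
    · have hs' := Syndrome.congr (h := 0) he (by simpa using hs)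
      rw [add_zero] at hs'
      have hys : ys = symmDiff S {y} := ind_injective <| by
        rw [hs'.low, rowSum_vString, ← ind_singleton, ind_add_ind]
      rcases hS with rfl | ⟨y₀, rfl⟩ | rfl
      · left
        rw [vString_empty] at he
        have := sameError_add he (sameError_refl (vString x {y}))
        rw [zero_add] at this
        exact (isGenWeightLeOne_single x y).congr this
      · have hxs : xs = {x₀} := by
          have h4' := EvenLength.four_le (n := n₁)
          rw [colSum_vString, if_neg (by simp)] at hs'
          exact hs'.eq_of_card_lt (by simp; omega)
        have hy0 : ys = ∅ := by
          rw [hxs, Finset.card_singleton] at hcard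
          exact Finset.card_eq_zero.1 (by omega)
        have hyy : y₀ = y := by
          rw [hy0, eq_comm, ← Finset.bot_eq_empty, symmDiff_eq_bot] at hys
          exact Finset.singleton_inj.1 hys
        subst hyy
        have hsum := sameError_add he (sameError_refl (vString x {y₀}))
        by_cases hx : x₀ = x
        · left
          subst hx
          rw [grid_add_self] at hsum
          exact isGenWeightLeOne_of_sameError_zero hsum
        · right
          exact ⟨⟨x₀, x, y₀, hx, hsum⟩, by simp [hxs]⟩
      -- A full column would show all rows but one, hence at least three coordinates.
      · exfalso
        have : ys = {y}ᶜ := by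
          ext z
          simp [hys, Finset.mem_symmDiff]
        rw [this, Finset.card_compl, Fintype.card_fin, Finset.card_singleton] at hcard
        omega
    · simp at hC
    · simp at hR

/-- One fault in the extraction, with an error-free input. -/
theorem exists_decodeSets_one_fault (he : SameError e 0) (hd : Detects 1 e e' xs ys) :
    ∃ c m', decodeSets Memory.blank xs ys = some (c, m') ∧
      IsGenWeightLeOne (e' + c) m'.hookCols m'.hookRows ∧
      (m'.inputErrorAllowed = true ∨ IsWeightZero (e' + c) m'.hookCols m'.hookRows) := by
  have h4 := EvenLength.four_le (n := n₁)
  have he1 := isGenWeightLeOne_of_sameError_zero he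
  have hbody : decodeSets Memory.blank xs ys = decodeBody Memory.blank xs ys :=
    decodeSets_of_allowed rfl
  rw [hbody]
  have hlow : ∀ y, Syndrome (colSum e) (rowSum e + Pi.single y 1) xs ys →
      decodeBody Memory.blank xs ys = some (0, ⟨∅, ∅, 1, true⟩) := fun y hs => by
    have hs' := Syndrome.congr (h := 0) he (by simpa using hs)
    rw [colSum_zero, rowSum_zero, zero_add, zero_add, ← ind_empty, ← ind_singleton] at hs'
    have hx : xs = ∅ := hs'.eq_of_card_lt (by simp; omega)
    have hy : ys = {y} := ind_injective hs'.low
    simp [decodeBody, Memory.blank, hx, hy]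
  rcases hd.one_cases with ⟨rfl, hs⟩ | ⟨x, y, rfl, hs⟩ | ⟨x, y, rfl, hs⟩ | ⟨z, rfl, hs⟩ |
    ⟨y, rfl, hs⟩ | ⟨x, y, rfl, hs⟩
  · obtain ⟨c, hc, hz⟩ := decodeBody_of_isGenWeightLeOne (m := Memory.blank) he1 hs
    exact ⟨c, _, hc, isGenWeightLeOne_of_sameError_zero hz, .inl rfl⟩
  · obtain ⟨c, hc, hz⟩ := decodeBody_of_isGenWeightLeOne (m := Memory.blank) he1 hs
    exact ⟨c, _, hc, (isGenWeightLeOne_single x y).congr (sameError_correct_add hz), .inl rfl⟩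
  · have h1 : SameError (e + vString x {y}) (vString x {y}) := by
      have := sameError_add he (sameError_refl (vString x {y}))
      rwa [zero_add] at this
    obtain ⟨c, hc, hz⟩ := decodeBody_of_isGenWeightLeOne (m := Memory.blank)
      ((isGenWeightLeOne_single x y).congr h1) hs
    exact ⟨c, _, hc, isGenWeightLeOne_of_sameError_zero hz, .inl rfl⟩
  -- A lone column coordinate forbids input errors, which is consistent because the data carry none.
  · refine ⟨0, ⟨∅, ∅, 1, false⟩, ?_, ?_, .inr ⟨?_, rfl, rfl⟩⟩
    · have hs' := Syndrome.congr (l := 0) he (by simpa using hs)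
      rw [colSum_zero, rowSum_zero, zero_add, zero_add, ← ind_empty, ← ind_singleton] at hs'
      have hx : xs = {z} := hs'.eq_of_card_lt (by simp; omega)
      have hy : ys = ∅ := ind_injective hs'.low
      simp [decodeBody, Memory.blank, hx, hy]
    · rw [add_zero]
      exact he1
    · rwa [add_zero]
  · exact ⟨0, _, hlow y hs, by rw [add_zero]; exact he1, .inl rfl⟩
  · refine ⟨0, _, hlow y hs, ?_, .inl rfl⟩
    rw [add_zero]
    have := sameError_add he (sameError_refl (vString x {y}))
    rw [zero_add] at this
    exact (isGenWeightLeOne_single x y).congr this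

/-- A pair of errors in one row, even with another error, has a nontrivial syndrome. -/
theorem not_syndromeOf_pair {f : Grid n₁ n₂} {x x' : Fin n₁} {y : Fin n₂} (hx : x ≠ x')
    (he : SameError e (vString x {y} + vString x' {y})) (hf : IsGenWeightLeOne f ∅ ∅) :
    ¬ SyndromeOf (e + f) ∅ ∅ := by
  intro hs
  have h4 := EvenLength.four_le (n := n₁)
  rw [vString_singleton, vString_singleton, hString_add_hString,
    symmDiff_singleton (by simpa using hx.symm)] at he
  have hcard : ({x', x} : Finset (Fin n₁)).card = 2 := Finset.card_pair hx.symm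
  rcases hf.cases with ⟨x₀, S, hS, hf, -, -⟩ | ⟨_, _, -, hC, -⟩ | ⟨_, _, -, -, hR⟩
  · have hs1 := hs.congr (sameError_add he hf)
    -- The pair is invisible to the rows, so trivial row outcomes force the other error to be
    -- trivial.
    have hS0 : S = ∅ := by
      have := hs1.low
      rw [rowSum_add, rowSum_hString, if_pos (by rw [hcard]; decide), rowSum_vString, ind_add_ind,
        ← Finset.bot_eq_empty, bot_symmDiff] at this
      exact (ind_injective this).symm
    rw [hS0, vString_empty, add_zero] at hs1
    rcases hs1.hString.1 with h | h
    · exact absurd h.symm (Finset.insert_ne_empty _ _)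
    · rw [eq_comm, Finset.compl_eq_empty_iff] at h
      rw [h, Finset.card_univ, Fintype.card_fin] at hcard
      omega
  · simp at hC
  · simp at hR

/-- After a deferred pair of errors the decoder halts, if there is at most one more fault. -/
theorem IsDeferredPair.decodeSets_ne_some {f : Grid n₁ n₂} {C : Finset (Fin n₁)}
    {R : Finset (Fin n₂)} {m₀ : Memory n₁ n₂} (hm₀ : IsDeferredPair e m₀)
    (hm : m = { m₀ with hookCols := m₀.hookCols ∪ C, hookRows := m₀.hookRows ∪ R })
    (hf : IsGenWeightLeOne f C R) {k : ℕ} (hk : k = 0 ∨ k = 1 ∧ SameError f 0)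
    (hd : Detects k (e + f) e' xs ys) : decodeSets m xs ys ≠ some (c, m') := by
  intro h
  obtain ⟨⟨x, x', y, hx, he⟩, rfl⟩ := hm₀
  obtain ⟨rfl, rfl, h1, h2⟩ := eq_empty_of_decodeSets h (by rw [hm])
  obtain ⟨rfl, rfl⟩ : C = ∅ ∧ R = ∅ := by simpa [hm] using And.intro h1 h2
  rcases hk with rfl | ⟨rfl, hf0⟩
  · exact not_syndromeOf_pair hx he hf hd.zero.2
  · rcases hd.one_cases with ⟨rfl, hs⟩ | ⟨x₁, y₁, rfl, hs⟩ | ⟨x₁, y₁, rfl, hs⟩ | ⟨z, rfl, hs⟩ |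
      ⟨y₁, rfl, hs⟩ | ⟨x₁, y₁, rfl, hs⟩
    · exact not_syndromeOf_pair hx he hf hs
    · exact not_syndromeOf_pair hx he hf hs
    · rw [add_assoc] at hs
      refine not_syndromeOf_pair hx he ((isGenWeightLeOne_single x₁ y₁).congr ?_) hs
      have := sameError_add hf0 (sameError_refl (vString x₁ {y₁}))
      rwa [zero_add] at this
    -- A wrong outcome would make the number of coordinates odd, and here there are none.
    · simpa using hs.odd_card_of_high
    · simpa using hs.odd_card_of_low
    · simpa using hs.odd_card_of_low

/-- Two faults in the extraction, with an error-free input. -/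
theorem decodeSets_two_faults (he : SameError e 0) (hC : m.hookCols = ∅) (hR : m.hookRows = ∅)
    (hd : Detects 2 e e' xs ys) (h : decodeSets m xs ys = some (c, m')) :
    IsGenWeightLeTwo (e' + c) m'.hookCols m'.hookRows := by
  have h4 := EvenLength.four_le (n := n₂)
  have hcase := DecodeCase.of_eq_some (decodeBody_of_decodeSets h)
  obtain ⟨hm1, hm2⟩ := hcase.hooks_eq
  rw [hm1, hm2]
  obtain ⟨p, q, hp, hq, rfl, -, hs⟩ := hd.two
  have hs' := Syndrome.congr (e := e) (e' := 0) (h := p.2.2.1 + q.2.2.1) (l := p.2.2.2 + q.2.2.2)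
    he (by simpa only [add_assoc] using hs)
  rw [colSum_zero, rowSum_zero, zero_add, zero_add] at hs'
  have he' : ∀ c, SameError (e + p.1 + q.1 + c) (p.1 + q.1 + c) := fun c => by
    have := sameError_add he (sameError_refl (p.1 + q.1 + c))
    rwa [zero_add, ← add_assoc, ← add_assoc] at this
  refine IsGenWeightLeTwo.congr (he' c) ?_
  have hpq : IsGenWeightLeTwo (p.1 + q.1) ∅ ∅ := .add_unflagged hp.leOne hq.leOne
  cases hcase with
  | single | trivial => rwa [add_zero]
  -- The correction is a third factor. This is harmless if some effect leaves the data alone, as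
  -- verification flips do; otherwise exactly one effect is late, and the correction cancels the
  -- other.
  | point _ _ x y hx hy =>
    subst hx hy
    have hxy := isGenWeightLeOne_single x y
    rcases hp.error_cases with hp0 | ⟨x₁, y₁, hp1, hp2⟩
    · rw [hp0, zero_add]
      exact .add_unflagged hq.leOne hxy
    rcases hq.error_cases with hq0 | ⟨x₂, y₂, hq1, hq2⟩
    · rw [hq0, add_zero]
      exact .add_unflagged hp.leOne hxy
    rw [hp1, hq1]
    by_cases hp3 : p.2.2.1 = 0 ∧ p.2.2.2 = 0
    · rw [hp3.1, hp3.2, zero_add, zero_add] at hs'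
      exact (decoded_pair_of_late hs' hq2).leTwo
    by_cases hq3 : q.2.2.1 = 0 ∧ q.2.2.2 = 0
    · rw [hq3.1, hq3.2, add_zero, add_zero] at hs'
      rw [add_comm (vString x₁ {y₁})]
      exact (decoded_pair_of_late hs' hp2).leTwo
    -- Two effects each flipping one row outcome cannot make a single row odd.
    · exfalso
      have hp4 : p.2.2.2 = Pi.single y₁ 1 := by tauto
      have hq4 : q.2.2.2 = Pi.single y₂ 1 := by tauto
      have := hs'.low
      rw [hp4, hq4] at this
      have hsum := congrArg (fun l : Fin n₂ → ZMod 2 => ∑ i, l i) this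
      simp only [sum_ind, Pi.add_apply, Finset.sum_add_distrib, Finset.sum_pi_single',
        Finset.mem_univ, if_true, Finset.card_singleton, Nat.cast_one] at hsum
      rw [CharTwo.add_self_eq_zero] at hsum
      exact one_ne_zero hsum
  -- Two effects disturb at most two of at least four rows.
  | column _ _ x hx hy =>
    exfalso
    obtain ⟨y₁, h1⟩ := hp.low_cases
    obtain ⟨y₂, h2⟩ := hq.low_cases
    obtain ⟨y, hy'⟩ : ∃ y, y ∉ ({y₁, y₂} : Finset (Fin n₂)) := by
      by_contra! hall
      have h3 := Finset.card_le_two (a := y₁) (b := y₂)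
      rw [Finset.eq_univ_iff_forall.2 hall, Finset.card_univ, Fintype.card_fin] at h3
      omega
    simp only [Finset.mem_insert, Finset.mem_singleton, not_or] at hy'
    have := congrFun hs'.low y
    simp [hy, ind, h1 y hy'.1, h2 y hy'.2] at this
  | vertical x hx => exact absurd (hx.symm.trans hC) (Finset.singleton_ne_empty _)
  | horizontal y _ hy => exact absurd (hy.symm.trans hR) (Finset.singleton_ne_empty _)

end Faulty

/-! ## The evolution of the errors of one type -/

section Steps

variable {n₁ n₂ : ℕ} {e e' e₁ : Grid n₁ n₂} {m m' m₁ : Memory n₁ n₂} {δ : Grid n₁ n₂}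
  {C C' : Finset (Fin n₁)} {R R' : Finset (Fin n₂)} {j j' : ℕ}

/-- The errors and the flags of hook faults in a half cycle with at most `k` faults. -/
def Hooks (k : ℕ) (δ : Grid n₁ n₂) (C : Finset (Fin n₁)) (R : Finset (Fin n₂)) : Prop :=
  ∃ g ∈ hookGauge n₁ n₂, ∃ es : List (Flagged n₁ n₂), es.length ≤ k ∧
    (∀ m ∈ es, m ∈ hookEffects n₁ n₂) ∧ δ = (g + es.sum).1 ∧ C = ones (g + es.sum).2.1 ∧
    R = ones (g + es.sum).2.2

/-- The passage of errors and memory through the half cycle that causes hook errors. -/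
def HookStep (k : ℕ) (e : Grid n₁ n₂) (m : Memory n₁ n₂) (e' : Grid n₁ n₂) (m' : Memory n₁ n₂) :
    Prop :=
  ∃ δ C R, Hooks k δ C R ∧ e' = e + δ ∧
    m' = { m with hookCols := m.hookCols ∪ C, hookRows := m.hookRows ∪ R }

/-- The passage of errors and memory through the half cycle that detects the errors. -/
def DetectStep (k : ℕ) (e : Grid n₁ n₂) (m : Memory n₁ n₂) (e' : Grid n₁ n₂)
    (m' : Memory n₁ n₂) : Prop :=
  ∃ e₁ xs ys c, Detects k e e₁ xs ys ∧ decodeSets m xs ys = some (c, m') ∧ e' = e₁ + c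

/-- The decoder halts. -/
def DetectHalt (k : ℕ) (e : Grid n₁ n₂) (m : Memory n₁ n₂) : Prop :=
  ∃ e₁ xs ys, Detects k e e₁ xs ys ∧ decodeSets m xs ys = none

/-- No error, and a blank memory. -/
def IsClean (e : Grid n₁ n₂) (m : Memory n₁ n₂) : Prop := SameError e 0 ∧ m = Memory.blank

/-- The decoder admits the error. -/
def IsAllowed (e : Grid n₁ n₂) (m : Memory n₁ n₂) : Prop :=
  m.inputErrorAllowed = true ∨ IsWeightZero e m.hookCols m.hookRows

theorem HookStep.mono (h : HookStep j e m e' m') (hj : j ≤ j') : HookStep j' e m e' m' := by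
  obtain ⟨δ, C, R, ⟨g, hg, es, hes, h⟩, h'⟩ := h
  exact ⟨δ, C, R, ⟨g, hg, es, hes.trans hj, h⟩, h'⟩

theorem DetectStep.mono (h : DetectStep j e m e' m') (hj : j ≤ j') : DetectStep j' e m e' m' := by
  obtain ⟨e₁, xs, ys, c, h, h'⟩ := h
  exact ⟨e₁, xs, ys, c, h.mono hj, h'⟩

theorem DetectHalt.mono (h : DetectHalt j e m) (hj : j ≤ j') : DetectHalt j' e m := by
  obtain ⟨e₁, xs, ys, h, h'⟩ := h
  exact ⟨e₁, xs, ys, h.mono hj, h'⟩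

theorem ones_add {n : ℕ} (f g : Fin n → ZMod 2) : ones (f + g) = symmDiff (ones f) (ones g) := by
  ext i
  simp only [ones, Pi.add_apply, Finset.mem_filter_univ, Finset.mem_symmDiff]
  generalize f i = a
  generalize g i = b
  revert a b
  decide

theorem symmDiff_singleton_singleton {α : Type} [DecidableEq α] {x x' : α} (h : x ≠ x') :
    symmDiff ({x} : Finset α) {x'} = {x} ∪ {x'} := by
  ext z
  simp only [Finset.mem_symmDiff, Finset.mem_singleton, Finset.mem_union]
  constructor
  · tauto
  · rintro (rfl | rfl)
    exacts [.inl ⟨rfl, h⟩, .inr ⟨rfl, h.symm⟩]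

theorem Hooks.zero (h : Hooks 0 δ C R) : SameError δ 0 ∧ C = ∅ ∧ R = ∅ := by
  obtain ⟨g, hg, es, hlen, -, rfl, rfl, rfl⟩ := h
  obtain rfl : es = [] := List.length_eq_zero_iff.1 (by omega)
  obtain ⟨h1, h2⟩ := Submodule.mem_prod.1 hg
  rw [Submodule.mem_bot] at h2
  simp [h2, ones_zero, sameError_zero, h1]

theorem add_hookGauge_leOne {g p : Flagged n₁ n₂} (hg : g ∈ hookGauge n₁ n₂)
    (hp : p ∈ hookEffects n₁ n₂) : g + p ∈ hookEffects n₁ n₂ := by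
  obtain ⟨h1, h2⟩ := Submodule.mem_prod.1 hg
  rw [Submodule.mem_bot] at h2
  have : SameError (g.1 + p.1) p.1 := by simpa [SameError] using h1
  simpa [hookEffects, h2] using IsGenWeightLeOne.congr this hp

theorem Hooks.one (h : Hooks 1 δ C R) : IsGenWeightLeOne δ C R := by
  obtain ⟨g, hg, es, hlen, hes, rfl, rfl, rfl⟩ := h
  match es, hlen with
  | [], _ => simpa [hookEffects] using hookGauge_subset hg
  | [p], _ => simpa [hookEffects] using add_hookGauge_leOne hg (hes p (by simp))

theorem HookStep.zero (h : HookStep 0 e m e' m') : SameError e' e ∧ m' = m := by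
  obtain ⟨δ, C, R, h, rfl, rfl⟩ := h
  obtain ⟨h1, rfl, rfl⟩ := h.zero
  have := sameError_add (sameError_refl e) h1
  rw [add_zero] at this
  exact ⟨this, by simp⟩

theorem IsClean.leOne (h : IsClean e m) : IsGenWeightLeOne e m.hookCols m.hookRows := by
  obtain ⟨h, rfl⟩ := h
  exact isGenWeightLeOne_of_sameError_zero h

theorem IsClean.isAllowed (h : IsClean e m) : IsAllowed e m := by
  obtain ⟨-, rfl⟩ := h
  exact .inl rfl

theorem HookStep.one_of_isClean (h : HookStep 1 e m e' m') (hc : IsClean e m) :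
    IsGenWeightLeOne e' m'.hookCols m'.hookRows ∧ m'.inputErrorAllowed = true := by
  obtain ⟨δ, C, R, h, rfl, rfl⟩ := h
  obtain ⟨he, rfl⟩ := hc
  have := sameError_add he (sameError_refl δ)
  rw [zero_add] at this
  exact ⟨by simpa [Memory.blank] using h.one.congr this, rfl⟩

theorem HookStep.one_of_leOne (h : HookStep 1 e m e' m')
    (he : IsGenWeightLeOne e m.hookCols m.hookRows) :
    IsGenWeightLeTwo e' m'.hookCols m'.hookRows := by
  obtain ⟨δ, C, R, h, rfl, rfl⟩ := h
  exact .add he h.one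

theorem IsDeferredPair.leTwo (hp : IsDeferredPair e m) :
    IsGenWeightLeTwo e m.hookCols m.hookRows := by
  obtain ⟨⟨x, x', y, -, he⟩, rfl⟩ := hp
  exact (IsGenWeightLeTwo.add_unflagged (isGenWeightLeOne_single x y)
    (isGenWeightLeOne_single x' y)).congr he

variable [EvenLength n₁]

/-- Flags raised in one half cycle add modulo two. Two faults flagging the same line cancel the flag
and leave an unflagged string; this is why such strings appear in `IsGenWeightLeTwo`. -/
theorem IsGenWeightLeOne.add_symmDiff {f : Grid n₁ n₂} (he : IsGenWeightLeOne e C R)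
    (hf : IsGenWeightLeOne f C' R') :
    IsGenWeightLeTwo (e + f) (symmDiff C C') (symmDiff R R') := by
  have hadd := IsGenWeightLeTwo.add he hf
  have h0 : ∀ {n : ℕ} (S : Finset (Fin n)), symmDiff ∅ S = S := fun S => bot_symmDiff S
  have h0' : ∀ {n : ℕ} (S : Finset (Fin n)), symmDiff S ∅ = S := fun S => symmDiff_bot S
  rcases he.cases with ⟨x, S, hS, hv, rfl, rfl⟩ | ⟨x, S, hv, rfl, rfl⟩ | ⟨y, S, hv, rfl, rfl⟩ <;>
  rcases hf.cases with ⟨x', S', hS', hv', rfl, rfl⟩ | ⟨x', S', hv', rfl, rfl⟩ |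
    ⟨y', S', hv', rfl, rfl⟩ <;>
  simp only [h0, h0', Finset.empty_union, Finset.union_empty] at hadd ⊢ <;> try exact hadd
  · by_cases h : x = x'
    · subst h
      rw [symmDiff_self]
      have := sameError_add hv hv'
      rw [vString_add_vString] at this
      exact .inr (.inl ⟨x, _, this, rfl, rfl⟩)
    · rwa [symmDiff_singleton_singleton h]
  · by_cases h : y = y'
    · subst h
      rw [symmDiff_self]
      have := sameError_add hv hv'
      rw [hString_add_hString] at this
      exact .inr (.inr ⟨y, _, this, rfl, rfl⟩)
    · rwa [symmDiff_singleton_singleton h]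

theorem Hooks.two (h : Hooks 2 δ C R) : IsGenWeightLeTwo δ C R := by
  obtain ⟨g, hg, es, hlen, hes, rfl, rfl, rfl⟩ := h
  match es, hlen with
  | [], _ => simpa [hookEffects] using IsGenWeightLeOne.leTwo (hookGauge_subset hg)
  | [p], _ => simpa [hookEffects] using (add_hookGauge_leOne hg (hes p (by simp))).leTwo
  | [p, q], _ =>
    have := IsGenWeightLeOne.add_symmDiff (add_hookGauge_leOne hg (hes p (by simp)))
      (hes q (by simp))
    simpa [← ones_add, add_assoc] using this

theorem HookStep.two_of_isClean (h : HookStep 2 e m e' m') (hc : IsClean e m) :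
    IsGenWeightLeTwo e' m'.hookCols m'.hookRows := by
  obtain ⟨δ, C, R, h, rfl, rfl⟩ := h
  obtain ⟨he, rfl⟩ := hc
  have := sameError_add he (sameError_refl δ)
  rw [zero_add] at this
  simpa [Memory.blank] using h.two.congr this

variable [EvenLength n₂]

theorem DetectStep.zero_of_leOne (h : DetectStep 0 e m e' m')
    (he : IsGenWeightLeOne e m.hookCols m.hookRows) : IsClean e' m' := by
  obtain ⟨e₁, xs, ys, c, hd, h, rfl⟩ := h
  obtain ⟨rfl, hs⟩ := hd.zero
  exact clean_of_decodeSets he hs h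

theorem DetectStep.zero_leOne_of_leTwo (h : DetectStep 0 e m e' m')
    (he : IsGenWeightLeTwo e m.hookCols m.hookRows) :
    IsGenWeightLeOne e m.hookCols m.hookRows := by
  obtain ⟨e₁, xs, ys, c, hd, h, rfl⟩ := h
  exact isGenWeightLeOne_of_decodeBody he hd.zero.2 (decodeBody_of_decodeSets h)

theorem DetectStep.zero_of_leTwo (h : DetectStep 0 e m e' m')
    (he : IsGenWeightLeTwo e m.hookCols m.hookRows) : IsClean e' m' :=
  h.zero_of_leOne (h.zero_leOne_of_leTwo he)

theorem not_detectHalt_zero (he : IsGenWeightLeOne e m.hookCols m.hookRows)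
    (ha : IsAllowed e m) : ¬ DetectHalt 0 e m := by
  rintro ⟨e₁, xs, ys, hd, h⟩
  obtain ⟨rfl, hs⟩ := hd.zero
  obtain ⟨c, hc, -⟩ := decodeBody_of_isGenWeightLeOne he hs
  unfold decodeSets at h
  split_ifs at h with h'
  · rcases ha with ha | ⟨h0, hC, hR⟩
    · simp [ha] at h'
    · have h1 := hs.congr h0
      rw [← vString_empty ⟨0, fin_pos⟩] at h1
      obtain ⟨rfl, rfl⟩ := h1.vString
      simp [hC, hR] at h'
  · simp [hc] at h

theorem not_detectHalt_one (hc : IsClean e m) : ¬ DetectHalt 1 e m := by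
  rintro ⟨e₁, xs, ys, hd, h⟩
  obtain ⟨he, rfl⟩ := hc
  obtain ⟨c, m', h', -⟩ := exists_decodeSets_one_fault he hd
  simp [h] at h'

theorem DetectStep.one_of_isClean (h : DetectStep 1 e m e' m') (hc : IsClean e m) :
    IsGenWeightLeOne e' m'.hookCols m'.hookRows ∧ IsAllowed e' m' := by
  obtain ⟨e₁, xs, ys, c, hd, h, rfl⟩ := h
  obtain ⟨he, rfl⟩ := hc
  obtain ⟨c', m'', h', h1⟩ := exists_decodeSets_one_fault he hd
  rw [h] at h'
  obtain ⟨rfl, rfl⟩ := Prod.mk.inj (Option.some.inj h')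
  exact h1

theorem DetectStep.one_of_leOne (h : DetectStep 1 e m e' m')
    (he : IsGenWeightLeOne e m.hookCols m.hookRows) :
    IsGenWeightLeOne e' m'.hookCols m'.hookRows ∨ IsDeferredPair e' m' := by
  obtain ⟨e₁, xs, ys, c, hd, h, rfl⟩ := h
  exact decodeSets_one_fault he hd h

theorem DetectStep.two_of_isClean (h : DetectStep 2 e m e' m') (hc : IsClean e m) :
    IsGenWeightLeTwo e' m'.hookCols m'.hookRows := by
  obtain ⟨e₁, xs, ys, c, hd, h, rfl⟩ := h
  obtain ⟨he, rfl⟩ := hc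
  exact decodeSets_two_faults he rfl rfl hd h

/-- A deferred pair of errors cannot pass the next cycle. -/
theorem IsDeferredPair.not_step (hp : IsDeferredPair e m) (h : HookStep j e m e₁ m₁)
    (h' : DetectStep j' e₁ m₁ e' m') (hj : j + j' ≤ 1) : False := by
  obtain ⟨δ, C, R, hh, rfl, hm⟩ := h
  obtain ⟨e₂, xs, ys, c, hd, hs, rfl⟩ := h'
  have hj' : j = 1 ∧ j' = 0 ∨ j = 0 ∧ j' = 0 ∨ j = 0 ∧ j' = 1 := by omega
  rcases hj' with ⟨rfl, rfl⟩ | ⟨rfl, rfl⟩ | ⟨rfl, rfl⟩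
  · exact hp.decodeSets_ne_some hm hh.one (.inl rfl) hd hs
  · obtain ⟨h0, rfl, rfl⟩ := hh.zero
    exact hp.decodeSets_ne_some hm (isGenWeightLeOne_of_sameError_zero h0) (.inl rfl) hd hs
  · obtain ⟨h0, rfl, rfl⟩ := hh.zero
    exact hp.decodeSets_ne_some hm (isGenWeightLeOne_of_sameError_zero h0) (.inr ⟨rfl, h0⟩) hd hs

end Steps

/-! ## The cycle -/

section Cycles

variable {n₁ n₂ : ℕ}

theorem ind_ones {n : ℕ} (f : Fin n → ZMod 2) : ind (ones f) = f := by
  ext i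
  rcases zmod_two_cases (f i) with h | h <;> simp [ind, ones, h]

theorem xCoords_spec (high : Fin n₁ → ZMod 2) :
    2 * (xCoords high).card ≤ n₁ ∧ ∃ t, ind (xCoords high) = high + fun _ => t := by
  have hS : Finset.univ.filter (fun x => high x = 1) = ones high := rfl
  simp only [xCoords, hS]
  split_ifs with h
  · exact ⟨h, 0, by rw [ind_ones]; ext; simp⟩
  · rw [Finset.card_compl, Fintype.card_fin]
    refine ⟨by omega, 1, funext fun x => ?_⟩
    rw [ind_compl, ind_ones]
    rfl

/-- A half cycle that does not halt. -/
def HalfStep (b : Basis) (k : ℕ) (s s' : CycleState n₁ n₂) : Prop :=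
  HookStep k (s.err b) (s.mem b) (s'.err b) (s'.mem b) ∧
    DetectStep k (s.err b.dual) (s.mem b.dual) (s'.err b.dual) (s'.mem b.dual)

theorem exists_halfCycle_eq (b : Basis) (L : List (Instr (Qubit n₁ n₂) × Event))
    (s : CycleState n₁ n₂) :
    ∃ s₀ : RunState (Qubit n₁ n₂),
      (halfCycle b L s = if (run L s₀).record .check ≠ 0 then .discarded
        else match decodeSets (s.mem b.dual) (xCoords fun x => (run L s₀).record (.anc x))
          (yCoords fun y => (run L s₀).record (.rowAnc y)) with
        | none => .halted
        | some (c, m) => .ok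
          { err := fun a x y => (run L s₀).frame a (.data x y) + (if a = b then 0 else c x y)
            mem := fun a =>
              if a = b then
                { s.mem b with
                  hookCols := (s.mem b).hookCols ∪ ones fun x => (run L s₀).record (.flag x)
                  hookRows := (s.mem b).hookRows ∪ ones fun y => (run L s₀).record (.rowFlag y) }
              else m }) ∧
      ∀ a, s₀.frame a = dataFrame (s.err a) := by
  have h0 : (fun (a : Basis) (q : Qubit n₁ n₂) => match q with
      | .data x y => s.err a x y
      | _ => 0) = fun a => dataFrame (s.err a) := by
    ext a q
    cases q <;> rfl
  refine ⟨⟨fun a => dataFrame (s.err a), fun _ => 0⟩, ?_, fun a => rfl⟩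
  rw [← h0]
  rfl

theorem halfCycle_cases {k : ℕ} (hk : 0 < k) (b : Basis)
    {L : List (Instr (Qubit (k + 2) n₂) × Event)}
    (hL : L.map Prod.fst = extraction (k + 2) n₂ b) (s : CycleState (k + 2) n₂) :
    (0 < faults L ∧ halfCycle b L s = .discarded) ∨
    (DetectHalt (faults L) (s.err b.dual) (s.mem b.dual) ∧ halfCycle b L s = .halted) ∨
    ∃ s', HalfStep b (faults L) s s' ∧ halfCycle b L s = .ok s' := by
  obtain ⟨s₀, hdef, hframe⟩ := exists_halfCycle_eq b L s
  obtain ⟨g, hg, es, hlen, hes, hhook⟩ := hook_half hL s₀ (hframe b)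
  obtain ⟨t, es', hlen', hes', hdet⟩ := detect_half hk hL s₀ (hframe b.dual)
  set r := run L s₀ with hr
  rw [hdef]
  by_cases hck : r.record .check = 0
  · right
    rw [if_neg (not_not.2 hck)]
    obtain ⟨hx, u, hu⟩ := xCoords_spec fun x => r.record (.anc x)
    have hy : ind (yCoords fun y => r.record (.rowAnc y)) = fun y => r.record (.rowAnc y) :=
      ind_ones _
    have hd : Detects (faults L) (s.err b.dual) (fun x y => r.frame b.dual (.data x y))
        (xCoords fun x => r.record (.anc x)) (yCoords fun y => r.record (.rowAnc y)) := by
      refine ⟨hx, t + u, es', hlen', hes', ?_⟩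
      rw [hu, hy]
      rw [hck] at hdet
      have h1 : (((fun x y => r.frame b.dual (.data x y)), 0,
          (fun x => r.record (.anc x)) + fun _ => u, fun y => r.record (.rowAnc y)) :
          Observed (k + 2) n₂) = ((fun x y => r.frame b.dual (.data x y)), 0,
          fun x => r.record (.anc x), fun y => r.record (.rowAnc y)) + (0, 0, fun _ => u, 0) := by
        simp
      have h2 : ((0, 0, fun _ => t + u, 0) : Observed (k + 2) n₂) =
          (0, 0, fun _ => t, 0) + (0, 0, fun _ => u, 0) := by
        simp only [Prod.mk_add_mk, add_zero]
        rfl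
      rw [h1, h2, hdet]
      abel
    cases hdec : decodeSets (s.mem b.dual) (xCoords fun x => r.record (.anc x))
        (yCoords fun y => r.record (.rowAnc y)) with
    | none => exact .inl ⟨⟨_, _, _, hd, hdec⟩, rfl⟩
    | some p =>
      obtain ⟨c, m⟩ := p
      refine .inr ⟨_, ⟨⟨_, _, _, ⟨g, hg, es, hlen, hes, rfl, rfl, rfl⟩, ?_, ?_⟩,
        ⟨_, _, _, c, hd, ?_, ?_⟩⟩, rfl⟩
      · have := congrArg Prod.fst hhook
        rw [add_assoc] at this
        simpa using this
      · rw [add_assoc] at hhook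
        have h1 := congrArg (fun p => p.2.1) hhook
        have h2 := congrArg (fun p => p.2.2) hhook
        simp only [Prod.snd_add, Prod.fst_add, zero_add] at h1 h2
        simp [h1, h2]
      · rw [hdec]
        simp [b.dual_ne]
      · ext x y
        simp [b.dual_ne]
  · left
    rw [if_pos hck]
    refine ⟨Nat.pos_of_ne_zero fun h0 => hck ?_, rfl⟩
    obtain rfl : es' = [] := List.length_eq_zero_iff.1 (by omega)
    simpa using congrArg (fun p => p.2.1) hdet

theorem cycle_cases {k j : ℕ} (hk : 0 < k) {ρ : CycleRun (k + 2) n₂} (hρ : IsCycle j ρ)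
    (s : CycleState (k + 2) n₂) :
    ∃ j₁ j₂, j₁ + j₂ ≤ j ∧
      ((0 < j ∧ cycle ρ s = .discarded) ∨
      (cycle ρ s = .halted ∧ (DetectHalt j₁ (s.err .Z) (s.mem .Z) ∨
        ∃ e m, HookStep j₁ (s.err .X) (s.mem .X) e m ∧ DetectHalt j₂ e m)) ∨
      ∃ s', cycle ρ s = .ok s' ∧
        (∃ e m, HookStep j₁ (s.err .X) (s.mem .X) e m ∧
          DetectStep j₂ e m (s'.err .X) (s'.mem .X)) ∧
        (∃ e m, DetectStep j₁ (s.err .Z) (s.mem .Z) e m ∧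
          HookStep j₂ e m (s'.err .Z) (s'.mem .Z))) := by
  obtain ⟨h1, h2, hj⟩ := hρ
  refine ⟨faults ρ.1, faults ρ.2, hj, ?_⟩
  rcases halfCycle_cases hk .X h1 s with ⟨hpos, h⟩ | ⟨hh, h⟩ | ⟨s₁, hs₁, h⟩
  · exact .inl ⟨by omega, by simp only [cycle, h]⟩
  · exact .inr (.inl ⟨by simp only [cycle, h], .inl hh⟩)
  · have hc : cycle ρ s = halfCycle .Z ρ.2 s₁ := by simp only [cycle, h]
    rw [hc]
    rcases halfCycle_cases hk .Z h2 s₁ with ⟨hpos, h⟩ | ⟨hh, h⟩ | ⟨s₂, hs₂, h⟩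
    · exact .inl ⟨by omega, h⟩
    · exact .inr (.inl ⟨h, .inr ⟨_, _, hs₁.1, hh⟩⟩)
    · exact .inr (.inr ⟨s₂, h, ⟨_, _, hs₁.1, hs₂.2⟩, ⟨_, _, hs₁.2, hs₂.1⟩⟩)

theorem cycle_ne_discarded {k : ℕ} (hk : 0 < k) {ρ : CycleRun (k + 2) n₂}
    (hρ : IsCycle 0 ρ) (s : CycleState (k + 2) n₂) :
    cycle ρ s ≠ .discarded := by
  obtain ⟨j₁, j₂, -, ⟨h, -⟩ | ⟨h, -⟩ | ⟨s', h, -⟩⟩ := cycle_cases hk hρ s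
  · exact absurd h (lt_irrefl 0)
  · simp [h]
  · simp [h]

end Cycles

section Steps

variable {n₁ n₂ : ℕ} {e e' : Grid n₁ n₂} {m m' : Memory n₁ n₂} {j j' : ℕ}

theorem HookStep.refl (e : Grid n₁ n₂) (m : Memory n₁ n₂) : HookStep j e m e m := by
  refine ⟨0, ∅, ∅, ⟨0, zero_mem _, [], Nat.zero_le _, by simp, ?_, ?_, ?_⟩, (add_zero e).symm, ?_⟩
  · simp
  · simp [ones]
  · simp [ones]
  · simp

theorem HookStep.leOne (h : HookStep 0 e m e' m')
    (he : IsGenWeightLeOne e m.hookCols m.hookRows) :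
    IsGenWeightLeOne e' m'.hookCols m'.hookRows := by
  obtain ⟨hs, rfl⟩ := h.zero
  exact he.congr hs

theorem HookStep.leOne_of_leOne (h : HookStep 0 e m e' m')
    (he : IsGenWeightLeOne e' m'.hookCols m'.hookRows) :
    IsGenWeightLeOne e m.hookCols m.hookRows := by
  obtain ⟨hs, rfl⟩ := h.zero
  exact he.congr (sameError_symm hs)

theorem HookStep.leTwo (h : HookStep 0 e m e' m')
    (he : IsGenWeightLeTwo e m.hookCols m.hookRows) :
    IsGenWeightLeTwo e' m'.hookCols m'.hookRows := by
  obtain ⟨hs, rfl⟩ := h.zero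
  exact he.congr hs

theorem HookStep.isClean (h : HookStep 0 e m e' m') (he : IsClean e m) : IsClean e' m' := by
  obtain ⟨hs, rfl⟩ := h.zero
  exact ⟨sameError_trans hs he.1, he.2⟩

theorem HookStep.isAllowed (h : HookStep 0 e m e' m') (he : IsAllowed e m) : IsAllowed e' m' := by
  obtain ⟨hs, rfl⟩ := h.zero
  exact he.imp_right fun h0 => ⟨sameError_trans hs h0.1, h0.2⟩

theorem HookStep.isDeferredPair (h : HookStep 0 e m e' m') (he : IsDeferredPair e m) :
    IsDeferredPair e' m' := by
  obtain ⟨hs, rfl⟩ := h.zero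
  obtain ⟨⟨x, x', y, hx, he⟩, hm⟩ := he
  exact ⟨⟨x, x', y, hx, sameError_trans hs he⟩, hm⟩

end Steps

section Cycles

variable {k n₂ : ℕ} [EvenLength (k + 2)] [EvenLength n₂]
  {ρ : CycleRun (k + 2) n₂} {s s' : CycleState (k + 2) n₂}

/-- Without faults, errors of generalized weight at most one are corrected. -/
theorem cycle_of_genWeightLeOne (hk : 0 < k) (hρ : IsCycle 0 ρ) (hs : s.GenWeightLeOne)
    (ha : s.Allowed) : ∃ s', cycle ρ s = .ok s' ∧ s'.ErrorFree := by
  obtain ⟨j₁, j₂, hj, h⟩ := cycle_cases hk hρ s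
  obtain ⟨rfl, rfl⟩ : j₁ = 0 ∧ j₂ = 0 := by omega
  rcases h with ⟨h, -⟩ | ⟨-, h | ⟨e, m, h, h'⟩⟩ | ⟨s', h, ⟨e, m, hX, hX'⟩, ⟨e', m', hZ, hZ'⟩⟩
  · exact absurd h (lt_irrefl 0)
  · exact absurd h (not_detectHalt_zero (hs .Z) (ha .Z))
  · exact absurd h' (not_detectHalt_zero (h.leOne (hs .X)) (h.isAllowed (ha .X)))
  · refine ⟨s', h, fun a => ?_⟩
    cases a
    · exact hX'.zero_of_leOne (hX.leOne (hs .X))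
    · exact hZ'.isClean (hZ.zero_of_leOne (hs .Z))

/-- Without faults, errors of generalized weight two are detected. -/
theorem cycle_of_genWeightTwo (hk : 0 < k) (hρ : IsCycle 0 ρ) (hs : s.GenWeightTwo) :
    cycle ρ s = .halted := by
  obtain ⟨j₁, j₂, hj, h⟩ := cycle_cases hk hρ s
  obtain ⟨rfl, rfl⟩ : j₁ = 0 ∧ j₂ = 0 := by omega
  rcases h with ⟨h, -⟩ | ⟨h, -⟩ | ⟨s', -, ⟨e, m, hX, hX'⟩, ⟨e', m', hZ, -⟩⟩
  · exact absurd h (lt_irrefl 0)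
  · exact h
  · refine absurd (fun a => ?_) hs.2
    cases a
    · exact hX.leOne_of_leOne (hX'.zero_leOne_of_leTwo (hX.leTwo (hs.1 .X)))
    · exact hZ.zero_leOne_of_leTwo (hs.1 .Z)

/-- One fault causes an error of generalized weight at most one, and the cycle does not halt. -/
theorem cycle_one_fault_of_errorFree (hk : 0 < k) (hρ : IsCycle 1 ρ) (hd : cycle ρ s ≠ .discarded)
    (hs : s.ErrorFree) : ∃ s', cycle ρ s = .ok s' ∧ s'.GenWeightLeOne ∧ s'.Allowed := by
  have hs : ∀ a, IsClean (s.err a) (s.mem a) := hs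
  obtain ⟨j₁, j₂, hj, h⟩ := cycle_cases hk hρ s
  have hj : j₁ ≤ 0 ∧ j₂ ≤ 1 ∨ j₁ ≤ 1 ∧ j₂ ≤ 0 := by omega
  rcases h with ⟨-, h⟩ | ⟨-, h | ⟨e, m, h, h'⟩⟩ | ⟨s', h, ⟨e, m, hX, hX'⟩, ⟨e', m', hZ, hZ'⟩⟩
  · exact absurd h hd
  · exact absurd (h.mono (by omega)) (not_detectHalt_one (hs .Z))
  · rcases hj with ⟨h₁, h₂⟩ | ⟨h₁, h₂⟩
    · exact absurd (h'.mono h₂) (not_detectHalt_one ((h.mono h₁).isClean (hs .X)))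
    · obtain ⟨h1, ha⟩ := (h.mono h₁).one_of_isClean (hs .X)
      exact absurd (h'.mono h₂) (not_detectHalt_zero h1 (.inl ha))
  · suffices h1 : ∀ a, IsGenWeightLeOne (s'.err a) (s'.mem a).hookCols (s'.mem a).hookRows ∧
        IsAllowed (s'.err a) (s'.mem a) from ⟨s', h, fun a => (h1 a).1, fun a => (h1 a).2⟩
    rcases hj with ⟨h₁, h₂⟩ | ⟨h₁, h₂⟩ <;> rintro (_ | _)
    · exact (hX'.mono h₂).one_of_isClean ((hX.mono h₁).isClean (hs .X))
    · have := (hZ'.mono h₂).one_of_isClean ((hZ.mono h₁).zero_of_leOne (hs .Z).leOne)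
      exact this.imp_right .inl
    · have := (hX'.mono h₂).zero_of_leOne ((hX.mono h₁).one_of_isClean (hs .X)).1
      exact ⟨this.leOne, this.isAllowed⟩
    · have hZ' := hZ'.mono h₂
      have := (hZ.mono h₁).one_of_isClean (hs .Z)
      exact ⟨hZ'.leOne this.1, hZ'.isAllowed this.2⟩

/-- A cycle with at most one fault halts on a deferred pair of errors. -/
theorem cycle_of_isDeferredPair (hk : 0 < k) (hρ : IsCycle 1 ρ) (hd : cycle ρ s ≠ .discarded)
    (hs : ∃ a, IsDeferredPair (s.err a) (s.mem a)) : cycle ρ s = .halted := by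
  obtain ⟨j₁, j₂, hj, h⟩ := cycle_cases hk hρ s
  rcases h with ⟨-, h⟩ | ⟨h, -⟩ | ⟨s', -, ⟨e, m, hX, hX'⟩, ⟨e', m', hZ, -⟩⟩
  · exact absurd h hd
  · exact h
  · obtain ⟨_ | _, hs⟩ := hs
    · exact (hs.not_step hX hX' hj).elim
    · exact (hs.not_step (HookStep.refl (j := 0) _ _) hZ (by omega)).elim

/-- One fault and an error of generalized weight at most one cause an error of generalized weight
at most one or a deferred pair, if the cycle does not halt. -/
theorem cycle_one_fault_of_genWeightLeOne (hk : 0 < k) (hρ : IsCycle 1 ρ)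
    (hd : cycle ρ s ≠ .discarded) (hs : s.GenWeightLeOne) :
    cycle ρ s = .halted ∨ ∃ s', cycle ρ s = .ok s' ∧
      ∀ a, IsGenWeightLeOne (s'.err a) (s'.mem a).hookCols (s'.mem a).hookRows ∨
        IsDeferredPair (s'.err a) (s'.mem a) := by
  obtain ⟨j₁, j₂, hj, h⟩ := cycle_cases hk hρ s
  have hj : j₁ ≤ 0 ∧ j₂ ≤ 1 ∨ j₁ ≤ 1 ∧ j₂ ≤ 0 := by omega
  rcases h with ⟨-, h⟩ | ⟨h, -⟩ | ⟨s', h, ⟨e, m, hX, hX'⟩, ⟨e', m', hZ, hZ'⟩⟩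
  · exact absurd h hd
  · exact .inl h
  · refine .inr ⟨s', h, ?_⟩
    rcases hj with ⟨h₁, h₂⟩ | ⟨h₁, h₂⟩ <;> rintro (_ | _)
    · exact (hX'.mono h₂).one_of_leOne ((hX.mono h₁).leOne (hs .X))
    · exact .inl ((hZ'.mono h₂).one_of_isClean ((hZ.mono h₁).zero_of_leOne (hs .Z))).1
    · exact .inl ((hX'.mono h₂).zero_of_leTwo ((hX.mono h₁).one_of_leOne (hs .X))).leOne
    · have hZ' := hZ'.mono h₂
      exact ((hZ.mono h₁).one_of_leOne (hs .Z)).imp hZ'.leOne hZ'.isDeferredPair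

/-- Two faults cause an error of generalized weight at most two, if the cycle does not halt. -/
theorem cycle_two_faults_of_errorFree (hk : 0 < k) (hρ : IsCycle 2 ρ)
    (hd : cycle ρ s ≠ .discarded) (hs : s.ErrorFree) :
    cycle ρ s = .halted ∨ ∃ s', cycle ρ s = .ok s' ∧ s'.GenWeightLeTwo := by
  have hs : ∀ a, IsClean (s.err a) (s.mem a) := hs
  obtain ⟨j₁, j₂, hj, h⟩ := cycle_cases hk hρ s
  have hj : j₁ ≤ 0 ∧ j₂ ≤ 2 ∨ j₁ ≤ 1 ∧ j₂ ≤ 1 ∨ j₁ ≤ 2 ∧ j₂ ≤ 0 := by omega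
  rcases h with ⟨-, h⟩ | ⟨h, -⟩ | ⟨s', h, ⟨e, m, hX, hX'⟩, ⟨e', m', hZ, hZ'⟩⟩
  · exact absurd h hd
  · exact .inl h
  · refine .inr ⟨s', h, ?_⟩
    rcases hj with ⟨h₁, h₂⟩ | ⟨h₁, h₂⟩ | ⟨h₁, h₂⟩ <;> rintro (_ | _)
    · exact (hX'.mono h₂).two_of_isClean ((hX.mono h₁).isClean (hs .X))
    · exact (hZ'.mono h₂).two_of_isClean ((hZ.mono h₁).zero_of_leOne (hs .Z).leOne)
    · exact ((hX'.mono h₂).one_of_leOne ((hX.mono h₁).one_of_isClean (hs .X)).1).elim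
        IsGenWeightLeOne.leTwo IsDeferredPair.leTwo
    · exact (hZ'.mono h₂).one_of_leOne ((hZ.mono h₁).one_of_isClean (hs .Z)).1
    · exact ((hX'.mono h₂).zero_of_leTwo ((hX.mono h₁).two_of_isClean (hs .X))).leOne.leTwo
    · exact (hZ'.mono h₂).leTwo ((hZ.mono h₁).two_of_isClean (hs .Z))

end Cycles

end Iceberg

theorem proposition1 (k₁ k₂ : ℕ) (hk₁ : Even k₁) (hk₁pos : 0 < k₁)
    (hk₂ : Even k₂) (hk₂pos : 0 < k₂) :
    -- no fault
    (∀ (s : Iceberg.CycleState (k₁ + 2) (k₂ + 2)) (ρ : Iceberg.CycleRun (k₁ + 2) (k₂ + 2)),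
      Iceberg.IsCycle 0 ρ →
        (s.GenWeightLeOne → s.Allowed →
          ∃ s', Iceberg.cycle ρ s = .ok s' ∧ s'.ErrorFree) ∧
        (s.GenWeightTwo → Iceberg.cycle ρ s = .halted)) ∧
    -- one fault, error-free input
    (∀ (s : Iceberg.CycleState (k₁ + 2) (k₂ + 2)) (ρ : Iceberg.CycleRun (k₁ + 2) (k₂ + 2)),
      Iceberg.IsCycle 1 ρ → Iceberg.cycle ρ s ≠ .discarded → s.ErrorFree →
        ∃ s', Iceberg.cycle ρ s = .ok s' ∧ s'.GenWeightLeOne ∧ s'.Allowed) ∧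
    -- one fault, input of generalized weight one
    (∀ (s : Iceberg.CycleState (k₁ + 2) (k₂ + 2)) (ρ : Iceberg.CycleRun (k₁ + 2) (k₂ + 2)),
      Iceberg.IsCycle 1 ρ → Iceberg.cycle ρ s ≠ .discarded → s.GenWeightLeOne →
        Iceberg.cycle ρ s = .halted ∨
        ∃ s', Iceberg.cycle ρ s = .ok s' ∧
          (s'.GenWeightLeOne ∨
            ∀ ρ' : Iceberg.CycleRun (k₁ + 2) (k₂ + 2),
              (Iceberg.IsCycle 0 ρ' → Iceberg.cycle ρ' s' = .halted) ∧
              (Iceberg.IsCycle 1 ρ' → Iceberg.cycle ρ' s' ≠ .discarded →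
                Iceberg.cycle ρ' s' = .halted))) ∧
    -- two faults, error-free input
    (∀ (s : Iceberg.CycleState (k₁ + 2) (k₂ + 2)) (ρ : Iceberg.CycleRun (k₁ + 2) (k₂ + 2)),
      Iceberg.IsCycle 2 ρ → Iceberg.cycle ρ s ≠ .discarded → s.ErrorFree →
        Iceberg.cycle ρ s = .halted ∨
        ∃ s', Iceberg.cycle ρ s = .ok s' ∧ s'.GenWeightLeTwo) := by
  have : Iceberg.EvenLength (k₁ + 2) := ⟨hk₁.add even_two, by obtain ⟨r, rfl⟩ := hk₁; omega⟩
  have : Iceberg.EvenLength (k₂ + 2) := ⟨hk₂.add even_two, by obtain ⟨r, rfl⟩ := hk₂; omega⟩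
  refine ⟨fun s ρ hρ => ⟨Iceberg.cycle_of_genWeightLeOne hk₁pos hρ,
      Iceberg.cycle_of_genWeightTwo hk₁pos hρ⟩,
    fun s ρ hρ => Iceberg.cycle_one_fault_of_errorFree hk₁pos hρ, fun s ρ hρ hd hs => ?_,
    fun s ρ hρ => Iceberg.cycle_two_faults_of_errorFree hk₁pos hρ⟩
  refine (Iceberg.cycle_one_fault_of_genWeightLeOne hk₁pos hρ hd hs).imp_right ?_
  rintro ⟨s', h, hs'⟩
  refine ⟨s', h, or_iff_not_imp_left.2 fun h1 ρ' => ?_⟩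
  have hp : ∃ a, Iceberg.IsDeferredPair (s'.err a) (s'.mem a) := by
    by_contra hp
    exact h1 fun a => (hs' a).resolve_right fun ha => hp ⟨a, ha⟩
  exact ⟨fun h0 => Iceberg.cycle_of_isDeferredPair hk₁pos ⟨h0.1, h0.2.1, h0.2.2.trans zero_le_one⟩
      (Iceberg.cycle_ne_discarded hk₁pos h0 s') hp,
    fun h0 hd' => Iceberg.cycle_of_isDeferredPair hk₁pos h0 hd' hp⟩
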